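/- For a finite simple graph $F$ let $\Delta(F)$ denote its maximum degree, $\mathbf{cc}(F)$ its number of connected components, and $\mathbf{fvs}(F)$ its feedback vertex set number, i.e. the minimum size of a set of vertices whose deletion leaves a forest. In the \textsc{Subgraph Isomorphism} problem one is given two finite simple graphs $H$ and $G$ and asks whether there is an injective map $\eta\colon V(H)\to V(G)$ such that $\eta(u)\eta(v)\in E(G)$ whenever $uv\in E(H)$. There are an algorithm $\mathbb{A}$ (a program of a unit-cost random access machine with addition and subtraction), a computable function $f\colon\mathbb{N}^3\to\mathbb{N}$ and a constant $c\in\mathbb{N}$ such that for all finite simple graphs $H$ and $G$ with $\Delta(H)\le 2$ (that is, $H$ is a disjoint union of paths and cycles), $\mathbb{A}$ on input $(H,G)$ halts after at most $$f\bigl(\Delta(G),\mathbf{fvs}(G),\mathbf{cc}(H)\bigr)\cdot n^{c}$$ steps and correctly decides whether $(H,G)$ is a yes-instance of \textsc{Subgraph Isomorphism}. Here the graphs are given by their numbers of vertices and their adjacency matrices, and $n=2+|V(H)|^2+|V(G)|^2$ is the total size of the input in machine words. -/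

import Mathlib

/-! ### The machine model

A random access machine with unbounded registers `X₀, X₁, X₂, …` holding natural numbers, a
read-only input (a finite list of natural numbers, accessed by position) and unit-cost instructions.
The only arithmetic is addition and truncated subtraction (no multiplication), so time on this
machine is polynomially related to time on Turing machines. Programs are built from instructions by
sequencing, branching and looping. -/

namespace RAM

/-- The contents of all registers. -/
abbrev Memory := ℕ → ℕ

/-- The instructions. Each of them takes one step. -/
inductive Instr where
  /-- `X_i := c` -/
  | const (i c : ℕ)
  /-- `X_i := X_j + X_k` -/
  | add (i j k : ℕ)
  /-- `X_i := X_j - X_k` (and `0` if `X_j < X_k`) -/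
  | sub (i j k : ℕ)
  /-- `X_i := X_(X_j)` -/
  | load (i j : ℕ)
  /-- `X_(X_i) := X_j` -/
  | store (i j : ℕ)
  /-- `X_i :=` the input word at position `X_j` (and `0` beyond the end of the input) -/
  | read (i j : ℕ)

/-- The effect of one instruction on the memory. -/
def Instr.exec (input : List ℕ) (m : Memory) : Instr → Memory
  | .const i c => Function.update m i c
  | .add i j k => Function.update m i (m j + m k)
  | .sub i j k => Function.update m i (m j - m k)
  | .load i j => Function.update m i (m (m j))
  | .store i j => Function.update m (m i) (m j)
  | .read i j => Function.update m i (input.getD (m j) 0)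

/-- Programs. -/
inductive Program where
  | instr (a : Instr)
  | seq (p q : Program)
  /-- if `X_i ≠ 0` then `p` else `q` -/
  | ite (i : ℕ) (p q : Program)
  /-- while `X_i ≠ 0` do `p` -/
  | loop (i : ℕ) (p : Program)

/-- `Runs input p m t m'`: on the given input, the program `p` started with memory `m` halts after
exactly `t` steps with memory `m'`. Each instruction and each test of a register is one step. -/
inductive Runs (input : List ℕ) : Program → Memory → ℕ → Memory → Prop
  | instr (a : Instr) (m : Memory) : Runs input (.instr a) m 1 (a.exec input m)
  | seq {p q : Program} {m m' m'' : Memory} {t t' : ℕ} :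
      Runs input p m t m' → Runs input q m' t' m'' → Runs input (.seq p q) m (t + t') m''
  | ite_true {i : ℕ} {p q : Program} {m m' : Memory} {t : ℕ} :
      m i ≠ 0 → Runs input p m t m' → Runs input (.ite i p q) m (1 + t) m'
  | ite_false {i : ℕ} {p q : Program} {m m' : Memory} {t : ℕ} :
      m i = 0 → Runs input q m t m' → Runs input (.ite i p q) m (1 + t) m'
  | loop_true {i : ℕ} {p : Program} {m m' m'' : Memory} {t t' : ℕ} :
      m i ≠ 0 → Runs input p m t m' → Runs input (.loop i p) m' t' m'' →
        Runs input (.loop i p) m (1 + t + t') m''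
  | loop_false {i : ℕ} {p : Program} {m : Memory} :
      m i = 0 → Runs input (.loop i p) m 1 m

/-- The machine is deterministic: running time and final memory are determined by the program, the
input and the initial memory. -/
theorem Runs.deterministic {input : List ℕ} {p : Program} {m m₁ : Memory} {t₁ : ℕ}
    (h₁ : Runs input p m t₁ m₁) :
    ∀ {t₂ : ℕ} {m₂ : Memory}, Runs input p m t₂ m₂ → t₁ = t₂ ∧ m₁ = m₂ := by
  induction h₁ with
  | instr a m => intro t₂ m₂ h₂; cases h₂; exact ⟨rfl, rfl⟩
  | seq _ _ ih ih' =>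
    intro t₂ m₂ h₂
    cases h₂ with
    | seq h h' =>
      obtain ⟨rfl, rfl⟩ := ih h
      obtain ⟨rfl, rfl⟩ := ih' h'
      exact ⟨rfl, rfl⟩
  | ite_true hi _ ih =>
    intro t₂ m₂ h₂
    cases h₂ with
    | ite_true _ h => obtain ⟨rfl, rfl⟩ := ih h; exact ⟨rfl, rfl⟩
    | ite_false hi' _ => exact absurd hi' hi
  | ite_false hi _ ih =>
    intro t₂ m₂ h₂
    cases h₂ with
    | ite_true hi' _ => exact absurd hi hi'
    | ite_false _ h => obtain ⟨rfl, rfl⟩ := ih h; exact ⟨rfl, rfl⟩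
  | loop_true hi _ _ ih ih' =>
    intro t₂ m₂ h₂
    cases h₂ with
    | loop_true _ h h' =>
      obtain ⟨rfl, rfl⟩ := ih h
      obtain ⟨rfl, rfl⟩ := ih' h'
      exact ⟨rfl, rfl⟩
    | loop_false hi' => exact absurd hi' hi
  | loop_false hi =>
    intro t₂ m₂ h₂
    cases h₂ with
    | loop_true hi' _ _ => exact absurd hi hi'
    | loop_false _ => exact ⟨rfl, rfl⟩

/-- Started with all registers `0`, the program halts on the input after exactly `t` steps with
the answer `b` in `X₀` (`1` for yes, `0` for no). -/
def Answers (p : Program) (input : List ℕ) (t : ℕ) (b : Prop) : Prop :=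
  ∃ m : Memory, Runs input p (fun _ => 0) t m ∧ (b → m 0 = 1) ∧ (¬ b → m 0 = 0)

end RAM

/-! ### Instances of Subgraph Isomorphism and their parameters -/

namespace SubgraphIso

open Classical in
/-- The rows of the adjacency matrix, one after the other, as a list of zeros and ones. -/
noncomputable def adjList {n : ℕ} (G : SimpleGraph (Fin n)) : List ℕ :=
  (List.finRange n).flatMap fun i => (List.finRange n).map fun j => if G.Adj i j then 1 else 0

/-- The input `(H, G)` as given to the machine: the two numbers of vertices, then the two
adjacency matrices. -/
noncomputable def encode {h g : ℕ} (H : SimpleGraph (Fin h)) (G : SimpleGraph (Fin g)) : List ℕ :=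
  h :: g :: (adjList H ++ adjList G)

open Classical in
/-- The maximum degree `Δ(G)`. -/
noncomputable def maxDeg {V : Type*} [Fintype V] (G : SimpleGraph V) : ℕ := G.maxDegree

/-- The feedback vertex set number: the least size of a set of vertices whose deletion leaves a
forest. -/
noncomputable def fvs {V : Type*} [Fintype V] (G : SimpleGraph V) : ℕ :=
  sInf {k | ∃ S : Finset V, S.card = k ∧ (G.induce {v | v ∉ S}).IsAcyclic}

/-- The number of connected components. -/
noncomputable def cc {V : Type*} [Fintype V] (G : SimpleGraph V) : ℕ := Nat.card G.ConnectedComponent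

end SubgraphIso

/-! ### Terms with bounded sums and their compilation -/

/-! Let K be the 2-core of G and call a vertex of K with at least three neighbours in K a branch
vertex. K without a feedback vertex set S is a forest, so the degrees in K sum to at most 2|K \ S| +
2Δ|S|. All of them are at least 2, hence their total excess over 2 is at most 2Δ|S|, and at most
6Δ·fvs edges of K meet a branch vertex (`sum_branch_degree_le`). All subsets of these edges can be
tried (the mask `b`). For a given embedding of H, delete those of them that the embedding does not
use. Then a vertex set of minimum degree two induces only degrees equal to two: a vertex with three
neighbours in the set would be a branch vertex, its three edges would all be used, and H has maximum
degree two (`exists_selection`). So every component of what remains has at most one cycle.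

Such a graph is dissolved vertex by vertex. A vertex with at most one alive neighbour is merged into
that neighbour, or into a virtual vertex `g` if there is none. If no such vertex exists, the alive
vertices form cycles, and one cycle is opened by merging a vertex into one of its two neighbours. At
every time, edges leave a block of merged vertices only at its root and at one further vertex, its
tag (`shape_succ`). Hence the vertices of H that an embedding sends into a block form a union of
components of H without the edges at `x` and `t`, the preimages of root and tag. There are at most
cc(H) + 6 such components (`card_rep_le`), so the set is coded by a mask `m` with that many digits.
A partial solution for a block is (x, t, a, m), `a` being the tag. Combining partial solutions along
the merges is sound (`sound`) and finds every embedding (`complete`).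

All auxiliary data and the partial solutions form one table with `B ^ 8` cells, whose rule is a
formula with quantifiers bounded by `B`. Such formulas are terms with bounded sums, and these
compile to programs with running time polynomial in `B` (`Tm.compile_spec`, `Tm.cost_le`). Masks
require `B` to be at least 2 to the number s of digits. The table is therefore filled with the bound
h + g + 10, which suffices to compute s; the bound is doubled s times and the table is filled again.
Since s ≤ 6Δ·fvs + cc + 7 (`digits_le`), the time is of the required form. -/

namespace RAM

/-- Terms denoting natural numbers. Variables are de Bruijn indices; `sum t` is the sum of `t` over
all values below the bound of the context. -/
inductive Tm where
  | var (i : ℕ)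
  | const (c : ℕ)
  | add (s t : Tm)
  | sub (s t : Tm)
  | inp (t : Tm)
  | tab (t : Tm)
  | sum (t : Tm)

/-- The data a term refers to: the input, a table, and the bound for sums. -/
structure Ctx where
  inp : List ℕ
  tab : ℕ → ℕ
  B : ℕ

/-- The value of a term. -/
def Tm.eval (c : Ctx) : Tm → List ℕ → ℕ
  | .var i, ρ => ρ.getD i 0
  | .const k, _ => k
  | .add s t, ρ => s.eval c ρ + t.eval c ρ
  | .sub s t, ρ => s.eval c ρ - t.eval c ρ
  | .inp t, ρ => c.inp.getD (t.eval c ρ) 0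
  | .tab t, ρ => c.tab (t.eval c ρ)
  | .sum t, ρ => ∑ x ∈ Finset.range c.B, t.eval c (x :: ρ)

/-- Number of working registers used by the compiled term. -/
def Tm.size : Tm → ℕ
  | .var _ => 1
  | .const _ => 1
  | .add s t => s.size + t.size + 1
  | .sub s t => s.size + t.size + 1
  | .inp t => t.size + 1
  | .tab t => t.size + 2
  | .sum t => t.size + 3

/-- A bound for the running time of the compiled term. -/
def Tm.cost (B : ℕ) : Tm → ℕ
  | .var _ => 2
  | .const _ => 2
  | .add s t => s.cost B + t.cost B + 1
  | .sub s t => s.cost B + t.cost B + 1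
  | .inp t => t.cost B + 1
  | .tab t => t.cost B + 3
  | .sum t => 4 + B * (4 + t.cost B)

/-- Sequential composition of programs. -/
infixr:60 " ;; " => Program.seq

/-- Compilation of a term. The bound is kept in register `1`, the table starts at address `β`,
variables are found in the registers `vs`, the result is put into register `d`; only the registers
from `d` up to `β` are changed. -/
def Tm.compile (β : ℕ) : Tm → List ℕ → ℕ → Program
  | .var i, vs, d => .instr (.const d 0) ;;
      (match vs[i]? with
        | some v => .instr (.add d v d)
        | none => .instr (.const d 0))
  | .const k, _, d => .instr (.const d k)
  | .add s t, vs, d => s.compile β vs d ;; t.compile β vs (d + 1) ;; .instr (.add d d (d + 1))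
  | .sub s t, vs, d => s.compile β vs d ;; t.compile β vs (d + 1) ;; .instr (.sub d d (d + 1))
  | .inp t, vs, d => t.compile β vs d ;; .instr (.read d d)
  | .tab t, vs, d => t.compile β vs d ;; .instr (.const (d + 1) β) ;;
      .instr (.add d d (d + 1)) ;; .instr (.load d d)
  -- The counter in `d + 1` is itself the bound variable: it is decremented before the body runs,
  -- which thus sees B - 1, …, 0.
  | .sum t, vs, d => .instr (.const d 0) ;; .instr (.const (d + 1) 0) ;;
      .instr (.add (d + 1) 1 (d + 1)) ;;
      .loop (d + 1) (.instr (.const (d + 2) 1) ;; .instr (.sub (d + 1) (d + 1) (d + 2)) ;;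
        t.compile β ((d + 1) :: vs) (d + 2) ;; .instr (.add d d (d + 2)))

/-- The context seen in a memory. -/
def ctxOf (input : List ℕ) (β : ℕ) (m : Memory) : Ctx := ⟨input, fun a => m (β + a), m 1⟩

theorem ctxOf_congr {input : List ℕ} {β d : ℕ} {m m' : Memory} (hd : 2 ≤ d)
    (h : ∀ r, r < d ∨ β ≤ r → m' r = m r) : ctxOf input β m' = ctxOf input β m := by
  simp only [ctxOf, Ctx.mk.injEq, true_and]
  exact ⟨funext fun a => h _ (.inr (by omega)), h _ (.inl (by omega))⟩

theorem map_congr_of_lt {vs : List ℕ} {d : ℕ} {m m' : Memory} (hv : ∀ v ∈ vs, v < d)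
    (h : ∀ r, r < d → m' r = m r) : vs.map m' = vs.map m :=
  List.map_congr_left fun v hvs => h v (hv v hvs)

/-- The compiled term computes its value within the cost. -/
theorem Tm.compile_spec (input : List ℕ) (β : ℕ) (t : Tm) : ∀ (vs : List ℕ) (d : ℕ) (m : Memory),
    2 ≤ d → (∀ v ∈ vs, v < d) → d + t.size ≤ β →
    ∃ τ m', Runs input (t.compile β vs d) m τ m' ∧ τ ≤ t.cost (m 1) ∧
      m' d = t.eval (ctxOf input β m) (vs.map m) ∧ ∀ r, r < d ∨ β ≤ r → m' r = m r := by
  induction t with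
  | var i =>
    intro vs d m hd hv hβ
    simp only [Tm.size] at hβ
    rcases hvi : vs[i]? with _ | v
    · have hc : Tm.compile β (.var i) vs d = (.instr (.const d 0) ;; .instr (.const d 0)) := by
        simp [Tm.compile, hvi]
      rw [hc]
      refine ⟨_, _, .seq (.instr _ _) (.instr _ _), ?_, ?_, ?_⟩
      · simp [Tm.cost]
      · simp [Instr.exec, Tm.eval, hvi]
      · intro r hr
        have : r ≠ d := by omega
        simp [Instr.exec, this]
    · have hvd : v < d := hv v (List.mem_of_getElem? hvi)
      have hc : Tm.compile β (.var i) vs d = (.instr (.const d 0) ;; .instr (.add d v d)) := by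
        simp [Tm.compile, hvi]
      rw [hc]
      refine ⟨_, _, .seq (.instr _ _) (.instr _ _), ?_, ?_, ?_⟩
      · simp [Tm.cost]
      · simp [Instr.exec, Tm.eval, hvi, hvd.ne]
      · intro r hr
        have : r ≠ d := by omega
        simp [Instr.exec, this]
  | const k =>
    intro vs d m hd hv hβ
    simp only [Tm.size] at hβ
    refine ⟨_, _, .instr _ _, by simp [Tm.cost], by simp [Instr.exec, Tm.eval], ?_⟩
    intro r hr
    have : r ≠ d := by omega
    simp [Instr.exec, this]
  | add s t ihs iht =>
    intro vs d m hd hv hβ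
    simp only [Tm.size] at hβ
    obtain ⟨τ₁, m₁, h₁, c₁, v₁, f₁⟩ := ihs vs d m hd hv (by omega)
    obtain ⟨τ₂, m₂, h₂, c₂, v₂, f₂⟩ := iht vs (d + 1) m₁ (by omega)
      (fun v hvs => (hv v hvs).trans (by omega)) (by omega)
    refine ⟨_, _, .seq h₁ (.seq h₂ (.instr _ _)), ?_, ?_, ?_⟩
    · rw [f₁ 1 (by omega)] at c₂
      simp only [Tm.cost]; omega
    · rw [ctxOf_congr hd f₁, map_congr_of_lt hv (fun r hr => f₁ r (.inl hr))] at v₂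
      simp [Instr.exec, Tm.eval, v₂, f₂ d (by omega), v₁]
    · intro r hr
      have : r ≠ d := by omega
      simp only [Instr.exec, Function.update_of_ne this]
      rw [f₂ r (by omega), f₁ r hr]
  | sub s t ihs iht =>
    intro vs d m hd hv hβ
    simp only [Tm.size] at hβ
    obtain ⟨τ₁, m₁, h₁, c₁, v₁, f₁⟩ := ihs vs d m hd hv (by omega)
    obtain ⟨τ₂, m₂, h₂, c₂, v₂, f₂⟩ := iht vs (d + 1) m₁ (by omega)
      (fun v hvs => (hv v hvs).trans (by omega)) (by omega)
    refine ⟨_, _, .seq h₁ (.seq h₂ (.instr _ _)), ?_, ?_, ?_⟩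
    · rw [f₁ 1 (by omega)] at c₂
      simp only [Tm.cost]; omega
    · rw [ctxOf_congr hd f₁, map_congr_of_lt hv (fun r hr => f₁ r (.inl hr))] at v₂
      simp [Instr.exec, Tm.eval, v₂, f₂ d (by omega), v₁]
    · intro r hr
      have : r ≠ d := by omega
      simp only [Instr.exec, Function.update_of_ne this]
      rw [f₂ r (by omega), f₁ r hr]
  | inp t ih =>
    intro vs d m hd hv hβ
    simp only [Tm.size] at hβ
    obtain ⟨τ₁, m₁, h₁, c₁, v₁, f₁⟩ := ih vs d m hd hv (by omega)
    refine ⟨_, _, .seq h₁ (.instr _ _), ?_, ?_, ?_⟩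
    · simp only [Tm.cost]; omega
    · simp [Instr.exec, Tm.eval, v₁, ctxOf]
    · intro r hr
      have : r ≠ d := by omega
      simp only [Instr.exec, Function.update_of_ne this]
      exact f₁ r hr
  | tab t ih =>
    intro vs d m hd hv hβ
    simp only [Tm.size] at hβ
    obtain ⟨τ₁, m₁, h₁, c₁, v₁, f₁⟩ := ih vs d m hd hv (by omega)
    refine ⟨_, _, .seq h₁ (.seq (.instr _ _) (.seq (.instr _ _) (.instr _ _))), ?_, ?_, ?_⟩
    · simp only [Tm.cost]; omega
    -- Table cells lie at `β` or above, beyond the working registers, so the scratch writes to `d`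
    -- and `d + 1` leave them intact.
    · have e : m₁ d + β ≠ d := by omega
      have e' : m₁ d + β ≠ d + 1 := by omega
      simp only [Instr.exec, Tm.eval, Function.update_self]
      rw [Function.update_of_ne (by omega : d ≠ d + 1)]
      rw [Function.update_of_ne e, Function.update_of_ne e', f₁ _ (by omega), v₁, add_comm]
      rfl
    · intro r hr
      have : r ≠ d := by omega
      have h' : r ≠ d + 1 := by omega
      simp only [Instr.exec, Function.update_of_ne this, Function.update_of_ne h']
      exact f₁ r hr
  | sum t ih =>
    intro vs d m hd hv hβ
    simp only [Tm.size] at hβ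
    set body : Program := .instr (.const (d + 2) 1) ;; .instr (.sub (d + 1) (d + 1) (d + 2)) ;;
        t.compile β ((d + 1) :: vs) (d + 2) ;; .instr (.add d d (d + 2)) with hbody
    -- Induction on the counter. Outside the registers from `d` to `β` the memory stays that of `m`,
    -- so every round evaluates the body in the same context.
    have key : ∀ (k : ℕ) (m₀ : Memory), m₀ (d + 1) = k → (∀ r, r < d ∨ β ≤ r → m₀ r = m r) →
        ∃ τ m', Runs input (.loop (d + 1) body) m₀ τ m' ∧ τ ≤ 1 + k * (4 + t.cost (m 1)) ∧
          m' d = m₀ d + ∑ x ∈ Finset.range k, t.eval (ctxOf input β m) (x :: vs.map m) ∧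
          ∀ r, r < d ∨ β ≤ r → m' r = m r := by
      intro k
      induction k with
      | zero =>
        intro m₀ h0 hf
        exact ⟨1, m₀, .loop_false h0, by simp, by simp, hf⟩
      | succ k ihk =>
        intro m₀ h0 hf
        set ma := Function.update (Function.update m₀ (d + 2) 1) (d + 1) k with hma
        have hma' : ∀ r, r < d ∨ β ≤ r → ma r = m r := by
          intro r hr
          have h1 : r ≠ d + 1 := by omega
          have h2 : r ≠ d + 2 := by omega
          rw [hma, Function.update_of_ne h1, Function.update_of_ne h2, hf r hr]
        obtain ⟨τ₁, m₁, h₁, c₁, v₁, f₁⟩ := ih ((d + 1) :: vs) (d + 2) ma (by omega)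
          (by
            intro v hvs
            rcases List.mem_cons.1 hvs with rfl | hvs
            · omega
            · have := hv v hvs; omega) (by omega)
        have hmd : ma d = m₀ d := by
          rw [hma, Function.update_of_ne (by omega), Function.update_of_ne (by omega)]
        have hmd1 : ma (d + 1) = k := by rw [hma, Function.update_self]
        have hctx : ctxOf input β ma = ctxOf input β m := ctxOf_congr hd hma'
        have hvs : vs.map ma = vs.map m := map_congr_of_lt hv (fun r hr => hma' r (.inl hr))
        rw [hctx, List.map_cons, hvs, hmd1] at v₁
        obtain ⟨τ₂, m₂, h₂, c₂, v₂, f₂⟩ := ihk (Function.update m₁ d (m₁ d + m₁ (d + 2)))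
          (by rw [Function.update_of_ne (by omega), f₁ _ (by omega), hmd1])
          (by
            intro r hr
            have : r ≠ d := by omega
            rw [Function.update_of_ne this, f₁ r (by omega), hma' r hr])
        have hrun : Runs input body m₀ (1 + (1 + (τ₁ + 1)))
            (Function.update m₁ d (m₁ d + m₁ (d + 2))) := by
          refine .seq (.instr _ _) (.seq (.instr _ _) (.seq ?_ (.instr _ _)))
          have : (Instr.sub (d + 1) (d + 1) (d + 2)).exec input
              ((Instr.const (d + 2) 1).exec input m₀) = ma := by
            simp [Instr.exec, hma, h0]
          rw [this]
          exact h₁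
        refine ⟨_, m₂, .loop_true (by omega) hrun h₂, ?_, ?_, f₂⟩
        · rw [hma' 1 (by omega)] at c₁
          rw [Nat.succ_mul]; omega
        · rw [v₂, Function.update_self, f₁ d (by omega), v₁, hmd, Finset.sum_range_succ]
          ring
    obtain ⟨τ, m', h', c', v', f'⟩ := key (m 1)
      (Function.update (Function.update (Function.update m d 0) (d + 1) 0) (d + 1) (m 1))
      (by simp) (by
        intro r hr
        have h1 : r ≠ d := by omega
        have h2 : r ≠ d + 1 := by omega
        simp [h1, h2])
    refine ⟨1 + (1 + (1 + τ)), m',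
      .seq (.instr _ _) (.seq (.instr _ _) (.seq (.instr _ _) ?_)), ?_, ?_, f'⟩
    · have e1 : (1 : ℕ) ≠ d := by omega
      have e2 : (1 : ℕ) ≠ d + 1 := by omega
      have : (Instr.add (d + 1) 1 (d + 1)).exec input ((Instr.const (d + 1) 0).exec input
          ((Instr.const d 0).exec input m)) = Function.update (Function.update
            (Function.update m d 0) (d + 1) 0) (d + 1) (m 1) := by
        simp only [Instr.exec, Function.update_self, Function.update_of_ne e2,
          Function.update_of_ne e1, add_zero]
      rw [this]
      exact h'
    · simp only [Tm.cost]; omega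
    · rw [v']
      simp [Tm.eval, ctxOf]

/-- The cost is polynomial in the bound. -/
theorem Tm.cost_le (t : Tm) : ∃ K D : ℕ, ∀ B, t.cost B ≤ K * (B + 1) ^ D := by
  have mono : ∀ {K D D' B : ℕ}, D ≤ D' → K * (B + 1) ^ D ≤ K * (B + 1) ^ D' := fun h =>
    Nat.mul_le_mul_left _ (Nat.pow_le_pow_right (by omega) h)
  have one : ∀ (B D : ℕ), 1 ≤ (B + 1) ^ D := fun B D => Nat.one_le_pow _ _ (by omega)
  induction t with
  | var i => exact ⟨2, 0, fun B => by simp [Tm.cost]⟩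
  | const k => exact ⟨2, 0, fun B => by simp [Tm.cost]⟩
  | add s t ihs iht | sub s t ihs iht =>
    obtain ⟨K₁, D₁, h₁⟩ := ihs
    obtain ⟨K₂, D₂, h₂⟩ := iht
    refine ⟨K₁ + K₂ + 1, max D₁ D₂, fun B => ?_⟩
    have := (h₁ B).trans (mono (le_max_left D₁ D₂))
    have := (h₂ B).trans (mono (le_max_right D₁ D₂))
    have := one B (max D₁ D₂)
    simp only [Tm.cost, add_mul]
    omega
  | inp t ih =>
    obtain ⟨K₁, D₁, h₁⟩ := ih
    refine ⟨K₁ + 1, D₁, fun B => ?_⟩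
    have := h₁ B
    have := one B D₁
    simp only [Tm.cost, add_mul]
    omega
  | tab t ih =>
    obtain ⟨K₁, D₁, h₁⟩ := ih
    refine ⟨K₁ + 3, D₁, fun B => ?_⟩
    have := h₁ B
    have := one B D₁
    simp only [Tm.cost, add_mul]
    omega
  | sum t ih =>
    obtain ⟨K₁, D₁, h₁⟩ := ih
    refine ⟨K₁ + 8, D₁ + 1, fun B => ?_⟩
    have h2 := h₁ B
    have h3 := one B D₁
    simp only [Tm.cost]
    calc 4 + B * (4 + t.cost B) ≤ 4 * (B + 1) ^ (D₁ + 1) +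
          (B + 1) * (4 * (B + 1) ^ D₁ + K₁ * (B + 1) ^ D₁) := by
          gcongr
          · have := one B (D₁ + 1); omega
          · omega
          · omega
      _ = _ := by ring

/-! ### Filling the table and enlarging the bound -/

/-- Filling the table: `T[a] := F(a)` for all `a < N`, in this order. -/
def fill (β : ℕ) (N F : Tm) : Program :=
  N.compile β [] 3 ;; .instr (.const 2 0) ;;
  .loop 3 (F.compile β [2] 4 ;; .instr (.const 5 β) ;; .instr (.add 5 5 2) ;;
    .instr (.store 5 4) ;; .instr (.const 5 1) ;; .instr (.add 2 2 5) ;; .instr (.sub 3 3 5))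

/-- `T` is the table at the moment when cell `a` is computed. It agrees with the final table only
below `a`; the later cells may hold anything, for instance remains of an earlier filling. -/
theorem fill_spec (input : List ℕ) (β : ℕ) (N F : Tm) (n : ℕ) (m : Memory)
    (hN : N.size + 6 ≤ β) (hF : F.size + 6 ≤ β)
    (hn : ∀ T, N.eval ⟨input, T, m 1⟩ [] = n) :
    ∃ τ m', Runs input (fill β N F) m τ m' ∧
      τ ≤ N.cost (m 1) + 2 + n * (7 + F.cost (m 1)) ∧ m' 0 = m 0 ∧ m' 1 = m 1 ∧
      ∀ a < n, ∃ T : ℕ → ℕ, (∀ a' < a, T a' = m' (β + a')) ∧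
        m' (β + a) = F.eval ⟨input, T, m 1⟩ [a] := by
  obtain ⟨τ₀, m₀, h₀, c₀, v₀, f₀⟩ := N.compile_spec input β [] 3 m (by omega) (by simp) (by omega)
  rw [ctxOf, List.map_nil, hn] at v₀
  set body : Program := F.compile β [2] 4 ;; .instr (.const 5 β) ;; .instr (.add 5 5 2) ;;
    .instr (.store 5 4) ;; .instr (.const 5 1) ;; .instr (.add 2 2 5) ;;
      .instr (.sub 3 3 5) with hbody
  have key : ∀ (k : ℕ) (m₁ : Memory), m₁ 3 = k → m₁ 2 + k = n → m₁ 0 = m 0 → m₁ 1 = m 1 →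
      (∀ a < m₁ 2, ∃ T : ℕ → ℕ, (∀ a' < a, T a' = m₁ (β + a')) ∧
        m₁ (β + a) = F.eval ⟨input, T, m 1⟩ [a]) →
      ∃ τ m', Runs input (.loop 3 body) m₁ τ m' ∧ τ ≤ 1 + k * (7 + F.cost (m 1)) ∧
        m' 0 = m 0 ∧ m' 1 = m 1 ∧
        ∀ a < n, ∃ T : ℕ → ℕ, (∀ a' < a, T a' = m' (β + a')) ∧
          m' (β + a) = F.eval ⟨input, T, m 1⟩ [a] := by
    intro k
    induction k with
    | zero =>
      intro m₁ h3 h2 h0 h1 hT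
      refine ⟨1, m₁, .loop_false h3, by simp, h0, h1, ?_⟩
      rwa [show m₁ 2 = n by omega] at hT
    | succ k ihk =>
      intro m₁ h3 h2 h0 h1 hT
      obtain ⟨τa, ma, ha, ca, va, fa⟩ := F.compile_spec input β [2] 4 m₁ (by omega) (by simp)
        (by omega)
      simp only [ctxOf, List.map_cons, List.map_nil, h1] at va
      set mb : Memory := Function.update (Function.update (Function.update (Function.update
        (Function.update (Function.update ma 5 β) 5 (β + ma 2)) (β + ma 2) (ma 4)) 5 1)
          2 (ma 2 + 1)) 3 (ma 3 - 1) with hmb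
      have e2 : ma 2 = m₁ 2 := fa 2 (by omega)
      have e3 : ma 3 = m₁ 3 := fa 3 (by omega)
      have hrun : Runs input body m₁ (τa + (1 + (1 + (1 + (1 + (1 + 1)))))) mb := by
        refine .seq ha (.seq (.instr _ _) (.seq (.instr _ _) (.seq (.instr _ _) (.seq (.instr _ _)
          (.seq (.instr _ _) ?_)))))
        have : mb = (Instr.sub 3 3 5).exec input ((Instr.add 2 2 5).exec input
          ((Instr.const 5 1).exec input ((Instr.store 5 4).exec input
          ((Instr.add 5 5 2).exec input ((Instr.const 5 β).exec input ma))))) := by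
          have i2 : (2 : ℕ) ≠ β + ma 2 := by omega
          have i3 : (3 : ℕ) ≠ β + ma 2 := by omega
          simp [Instr.exec, hmb, i2, i3]
        rw [this]
        exact .instr _ _
      have hmbβ : ∀ a, mb (β + a) = if a = m₁ 2 then ma 4 else m₁ (β + a) := by
        intro a
        rw [hmb, Function.update_of_ne (by omega), Function.update_of_ne (by omega),
          Function.update_of_ne (by omega)]
        split_ifs with h
        · rw [h, e2, Function.update_self]
        · rw [Function.update_of_ne (by omega), Function.update_of_ne (by omega),
            Function.update_of_ne (by omega), fa _ (by omega)]
      have hlow : ∀ r, r < 2 → mb r = m₁ r := by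
        intro r hr
        rw [hmb, Function.update_of_ne (by omega), Function.update_of_ne (by omega),
          Function.update_of_ne (by omega), Function.update_of_ne (by omega),
          Function.update_of_ne (by omega), Function.update_of_ne (by omega), fa _ (by omega)]
      have hb3 : mb 3 = k := by rw [hmb, Function.update_self]; omega
      have hb2 : mb 2 = m₁ 2 + 1 := by
        rw [hmb, Function.update_of_ne (by omega), Function.update_self, e2]
      obtain ⟨τ, m', h', c', r0, r1, hr⟩ := ihk mb hb3 (by omega) ((hlow 0 (by omega)).trans h0)
        ((hlow 1 (by omega)).trans h1) (by
          intro a ha'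
          rw [hb2] at ha'
          rcases Nat.lt_succ_iff_lt_or_eq.1 ha' with h | h
          · obtain ⟨T, hT1, hT2⟩ := hT a h
            refine ⟨T, fun a' ha2 => ?_, ?_⟩
            · rw [hmbβ, if_neg (by omega), hT1 a' ha2]
            · rw [hmbβ, if_neg (by omega), hT2]
          · subst h
            refine ⟨fun a => m₁ (β + a), fun a' ha2 => ?_, ?_⟩
            · rw [hmbβ, if_neg (by omega)]
            · rw [hmbβ, if_pos rfl, va])
      refine ⟨_, m', .loop_true (by omega) hrun h', ?_, r0, r1, hr⟩
      rw [h1] at ca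
      rw [Nat.succ_mul]; omega
  obtain ⟨τ, m', h', c', r0, r1, hr⟩ := key n (Function.update m₀ 2 0) (by simp [v₀]) (by simp)
    (by simp [f₀ 0]) (by simp [f₀ 1]) (by simp)
  exact ⟨_, m', .seq h₀ (.seq (.instr _ _) h'), by omega, r0, r1, hr⟩

/-- Doubling register `1` as often as the term `S` says. -/
def double (β : ℕ) (S : Tm) : Program :=
  S.compile β [] 3 ;; .instr (.const 2 1) ;;
  .loop 3 (.instr (.add 1 1 1) ;; .instr (.sub 3 3 2))

theorem double_spec (input : List ℕ) (β : ℕ) (S : Tm) (s : ℕ) (m : Memory)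
    (hS : S.size + 6 ≤ β) (hs : S.eval (ctxOf input β m) [] = s) :
    ∃ τ m', Runs input (double β S) m τ m' ∧ τ ≤ S.cost (m 1) + 2 + s * 3 ∧ m' 0 = m 0 ∧
      m' 1 = m 1 * 2 ^ s := by
  obtain ⟨τ₀, m₀, h₀, c₀, v₀, f₀⟩ := S.compile_spec input β [] 3 m (by omega) (by simp) (by omega)
  rw [List.map_nil, hs] at v₀
  have key : ∀ (k : ℕ) (m₁ : Memory), m₁ 3 = k → m₁ 2 = 1 →
      ∃ τ m', Runs input (.loop 3 (.instr (.add 1 1 1) ;; .instr (.sub 3 3 2))) m₁ τ m' ∧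
        τ ≤ 1 + k * 3 ∧ m' 0 = m₁ 0 ∧ m' 1 = m₁ 1 * 2 ^ k := by
    intro k
    induction k with
    | zero =>
      intro m₁ h3 _
      exact ⟨1, m₁, .loop_false h3, by simp, rfl, by simp⟩
    | succ k ihk =>
      intro m₁ h3 h2
      obtain ⟨τ, m', h', c', r0, r1⟩ := ihk
        ((Instr.sub 3 3 2).exec input ((Instr.add 1 1 1).exec input m₁))
        (by simp [Instr.exec, h3, h2]) (by simp [Instr.exec, h2])
      refine ⟨_, m', .loop_true (by omega) (.seq (.instr _ _) (.instr _ _)) h', by omega, ?_, ?_⟩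
      · rw [r0]; simp [Instr.exec]
      · rw [r1]; simp [Instr.exec]; ring
  obtain ⟨τ, m', h', c', r0, r1⟩ := key s (Function.update m₀ 2 1) (by simp [v₀]) (by simp)
  refine ⟨_, m', .seq h₀ (.seq (.instr _ _) h'), by omega, ?_, ?_⟩
  · rw [r0]; simp [f₀ 0]
  · rw [r1]; simp [f₀ 1]

end RAM

/-! ### Functions and predicates denoted by terms -/

namespace RAM

open Finset

/-- Moving the variables from index `k` on one place up. -/
def Tm.lift : ℕ → Tm → Tm
  | k, .var i => .var (if i < k then i else i + 1)
  | _, .const c => .const c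
  | k, .add s t => .add (s.lift k) (t.lift k)
  | k, .sub s t => .sub (s.lift k) (t.lift k)
  | k, .inp t => .inp (t.lift k)
  | k, .tab t => .tab (t.lift k)
  | k, .sum t => .sum (t.lift (k + 1))

theorem Tm.eval_lift (c : Ctx) (x : ℕ) (ρ : List ℕ) (t : Tm) : ∀ σ : List ℕ,
    (t.lift σ.length).eval c (σ ++ x :: ρ) = t.eval c (σ ++ ρ) := by
  induction t with
  | var i =>
    intro σ
    simp only [Tm.lift, Tm.eval]
    split_ifs with h
    · simp [List.getD_eq_getElem?_getD, List.getElem?_append_left h]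
    · rw [List.getD_eq_getElem?_getD, List.getD_eq_getElem?_getD,
        List.getElem?_append_right (by omega), List.getElem?_append_right (by omega),
        Nat.succ_sub (by omega), List.getElem?_cons_succ]
  | const k => intro σ; rfl
  | add s t ihs iht | sub s t ihs iht => intro σ; simp only [Tm.lift, Tm.eval, ihs, iht]
  | inp t ih | tab t ih => intro σ; simp only [Tm.lift, Tm.eval, ih]
  | sum t ih =>
    intro σ
    simp only [Tm.lift, Tm.eval]
    exact sum_congr rfl fun y _ => ih (y :: σ)

/-- The function is denoted by a term. -/
def Rz (F : Ctx → List ℕ → ℕ) : Prop := ∃ t : Tm, ∀ c ρ, t.eval c ρ = F c ρ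

open Classical in
/-- The predicate is decided by a term. -/
def RzP (P : Ctx → List ℕ → Prop) : Prop := Rz fun c ρ => if P c ρ then 1 else 0

namespace Rz

variable {F F' : Ctx → List ℕ → ℕ}

theorem of_eq (h : Rz F) (e : ∀ c ρ, F c ρ = F' c ρ) : Rz F' := by
  obtain ⟨t, ht⟩ := h
  exact ⟨t, fun c ρ => (ht c ρ).trans (e c ρ)⟩

/-- Weakening: it makes outer data available under a new bound variable, which occupies the head of
the list. -/
theorem tail (h : Rz F) : Rz fun c ρ => F c ρ.tail := by
  obtain ⟨t, ht⟩ := h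
  refine (⟨.sub (t.lift 0) (.const 0), fun c ρ => ?_⟩ : Rz fun c ρ => F c ρ.tail)
  rcases ρ with _ | ⟨x, ρ⟩
  -- On the empty list there is no head to skip, but shifted and unshifted free variables both read
  -- the default 0.
  · have : ∀ (t : Tm) (σ : List ℕ), (t.lift σ.length).eval c σ = t.eval c σ := by
      intro t
      induction t with
      | var i =>
        intro σ
        simp only [Tm.lift, Tm.eval]
        split_ifs with h
        · rfl
        · rw [List.getD_eq_default _ _ (by omega), List.getD_eq_default _ _ (by omega)]
      | const k => intro σ; rfl
      | add s t ihs iht | sub s t ihs iht => intro σ; simp only [Tm.lift, Tm.eval, ihs, iht]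
      | inp t ih | tab t ih => intro σ; simp only [Tm.lift, Tm.eval, ih]
      | sum t ih =>
        intro σ
        simp only [Tm.lift, Tm.eval]
        exact sum_congr rfl fun y _ => ih (y :: σ)
    simpa [Tm.eval, ht] using this t []
  · simpa [Tm.eval, ht] using Tm.eval_lift c x ρ t []

theorem head : Rz fun _ ρ => ρ.headI :=
  ⟨.var 0, fun c ρ => by cases ρ <;> rfl⟩

theorem const (k : ℕ) : Rz fun _ _ => k := ⟨.const k, fun _ _ => rfl⟩

theorem add (h : Rz F) (h' : Rz F') : Rz fun c ρ => F c ρ + F' c ρ := by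
  obtain ⟨t, ht⟩ := h
  obtain ⟨t', ht'⟩ := h'
  exact ⟨.add t t', fun c ρ => by rw [Tm.eval, ht, ht']⟩

theorem sub (h : Rz F) (h' : Rz F') : Rz fun c ρ => F c ρ - F' c ρ := by
  obtain ⟨t, ht⟩ := h
  obtain ⟨t', ht'⟩ := h'
  exact ⟨.sub t t', fun c ρ => by rw [Tm.eval, ht, ht']⟩

theorem inp (h : Rz F) : Rz fun c ρ => c.inp.getD (F c ρ) 0 := by
  obtain ⟨t, ht⟩ := h
  exact ⟨.inp t, fun c ρ => by rw [Tm.eval, ht]⟩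

theorem tab (h : Rz F) : Rz fun c ρ => c.tab (F c ρ) := by
  obtain ⟨t, ht⟩ := h
  exact ⟨.tab t, fun c ρ => by rw [Tm.eval, ht]⟩

theorem sum {F : Ctx → List ℕ → ℕ → ℕ} (h : Rz fun c ρ => F c ρ.tail ρ.headI) :
    Rz fun c ρ => ∑ x ∈ range c.B, F c ρ x := by
  obtain ⟨t, ht⟩ := h
  exact ⟨.sum t, fun c ρ => by simp [Tm.eval, ht]⟩

/-- There is no multiplication, but summing a constant over all values below the bound multiplies by
the bound. Addresses in base `B` need nothing more. -/
theorem mulB (h : Rz F) : Rz fun c ρ => F c ρ * c.B :=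
  (sum (F := fun c ρ _ => F c ρ) h.tail).of_eq fun c ρ => by simp [mul_comm]

end Rz

namespace RzP

variable {P Q : Ctx → List ℕ → Prop} {F F' : Ctx → List ℕ → ℕ}

theorem of_iff (h : RzP P) (e : ∀ c ρ, P c ρ ↔ Q c ρ) : RzP Q := by
  have : P = Q := funext₂ fun c ρ => propext (e c ρ)
  rwa [← this]

theorem lt (h : Rz F) (h' : Rz F') : RzP fun c ρ => F c ρ < F' c ρ :=
  ((Rz.const 1).sub ((Rz.const 1).sub (h'.sub h))).of_eq fun c ρ => by split_ifs <;> omega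

theorem not (h : RzP P) : RzP fun c ρ => ¬ P c ρ :=
  ((Rz.const 1).sub h).of_eq fun c ρ => by by_cases hp : P c ρ <;> simp [hp]

theorem and (h : RzP P) (h' : RzP Q) : RzP fun c ρ => P c ρ ∧ Q c ρ :=
  ((Rz.add h h').sub (Rz.const 1)).of_eq fun c ρ => by
    by_cases hp : P c ρ <;> by_cases hq : Q c ρ <;> simp [hp, hq]

theorem or (h : RzP P) (h' : RzP Q) : RzP fun c ρ => P c ρ ∨ Q c ρ :=
  (h.not.and h'.not).not.of_iff fun c ρ => by tauto

theorem imp (h : RzP P) (h' : RzP Q) : RzP fun c ρ => P c ρ → Q c ρ :=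
  (h.and h'.not).not.of_iff fun c ρ => by tauto

theorem iff (h : RzP P) (h' : RzP Q) : RzP fun c ρ => (P c ρ ↔ Q c ρ) :=
  ((h.imp h').and (h'.imp h)).of_iff fun c ρ => by tauto

theorem le (h : Rz F) (h' : Rz F') : RzP fun c ρ => F c ρ ≤ F' c ρ :=
  (lt h' h).not.of_iff fun _ _ => not_lt

theorem eq (h : Rz F) (h' : Rz F') : RzP fun c ρ => F c ρ = F' c ρ :=
  ((le h h').and (le h' h)).of_iff fun _ _ => le_antisymm_iff.symm

theorem ne (h : Rz F) (h' : Rz F') : RzP fun c ρ => F c ρ ≠ F' c ρ := (eq h h').not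

theorem count {P : Ctx → List ℕ → ℕ → Prop} {i : ∀ c ρ x, Decidable (P c ρ x)}
    (h : RzP fun c ρ => P c ρ.tail ρ.headI) :
    Rz fun c ρ => ∑ x ∈ range c.B, if P c ρ x then 1 else 0 :=
  Rz.sum (Rz.of_eq h fun c ρ => by split_ifs <;> rfl)

theorem ex {P : Ctx → List ℕ → ℕ → Prop} (h : RzP fun c ρ => P c ρ.tail ρ.headI) :
    RzP fun c ρ => ∃ x < c.B, P c ρ x :=
  (lt (Rz.const 0) (count (i := fun _ _ _ => Classical.propDecidable _) h)).of_iff fun c ρ => by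
    simp [pos_iff_ne_zero]

theorem all {P : Ctx → List ℕ → ℕ → Prop} (h : RzP fun c ρ => P c ρ.tail ρ.headI) :
    RzP fun c ρ => ∀ x < c.B, P c ρ x :=
  (ex (P := fun c ρ x => ¬ P c ρ x) h.not).not.of_iff fun c ρ => by
    push Not; rfl

end RzP

end RAM

/-! ### The tables of the algorithm -/

namespace Elim

open Finset RAM

/-- The data of an instance, vertices being natural numbers, with the tables for binary digits, the
rounds of the computation of the `2`-core of `G`, and the rounds of the computation of the connected
components of `H` after deletion of the edges at two vertices. -/
structure Data where
  (B h g : ℕ)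
  (aH aG : ℕ → ℕ → Prop)
  (bit : ℕ → ℕ → Prop)
  (core : ℕ → ℕ → Prop)
  (conn : ℕ → ℕ → ℕ → ℕ → ℕ → Prop)

variable (I : Data)

/-- Membership in the `2`-core. -/
def Core (v : ℕ) : Prop := I.core I.g v

/-- Having at least three neighbours in the core. -/
def Branch (v : ℕ) : Prop :=
  ∃ u < I.B, ∃ w < I.B, ∃ z < I.B, (u ≠ w ∧ u ≠ z ∧ w ≠ z) ∧
    (I.aG v u ∧ I.aG v w ∧ I.aG v z) ∧ (Core I u ∧ Core I w ∧ Core I z)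

/-- The edges of the core at branch vertices. -/
def XEdge (u v : ℕ) : Prop :=
  u < v ∧ I.aG u v ∧ Core I u ∧ Core I v ∧ (Branch I u ∨ Branch I v)

open Classical in
/-- The position of a pair in the lexicographic order of all edges of the core at branch vertices. -/
noncomputable def xidx (u v : ℕ) : ℕ :=
  ∑ u' ∈ range I.B, ∑ v' ∈ range I.B,
    if XEdge I u' v' ∧ (u' < u ∨ (u' = u ∧ v' < v)) then 1 else 0

/-- The binary digit of `m` at position `j`. -/
def Digit (m j : ℕ) : Prop := ∃ i < I.B, i = j ∧ I.bit i m

/-- Adjacency in the graph `G` without the edges selected by the mask `b`. -/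
def Adj' (b u v : ℕ) : Prop :=
  I.aG u v ∧ ¬ (XEdge I u v ∧ Digit I b (xidx I u v)) ∧ ¬ (XEdge I v u ∧ Digit I b (xidx I v u))

/-- Being the least vertex of a component of `H` without the edges at `x` and `t`. -/
def Rep (x t z : ℕ) : Prop := z < I.h ∧ ∀ w < I.B, I.conn I.h x t z w → z ≤ w

open Classical in
/-- The index of the component containing `y`. -/
noncomputable def cidx (x t y : ℕ) : ℕ :=
  ∑ z ∈ range I.B, if Rep I x t z ∧ ∀ w < I.B, I.conn I.h x t y w → z < w then 1 else 0

/-- The set of vertices of `H` coded by `x`, `t` and the mask `m`. -/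
def Mem (x t m y : ℕ) : Prop := y < I.h ∧ Digit I m (cidx I x t y)

/-! ### Elimination of vertices and merging of partial solutions -/

section Script

variable (al : ℕ → ℕ → ℕ → Prop) (dp : ℕ → ℕ → ℕ → ℕ → ℕ → ℕ → ℕ → Prop)

/-- Being alive with at most one alive neighbour. -/
def Low (s b v : ℕ) : Prop :=
  al s b v ∧ ∀ u < I.B, ∀ w < I.B, al s b u ∧ al s b w ∧ Adj' I b v u ∧ Adj' I b v w → u = w

/-- The vertex eliminated at time `s`. -/
def Pick (s b v : ℕ) : Prop :=
  (Low I al s b v ∧ ∀ u < I.B, u < v → ¬ Low I al s b u) ∨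
  ((∀ u < I.B, ¬ Low I al s b u) ∧ al s b v ∧ ∀ u < I.B, u < v → ¬ al s b u)

/-- The vertex into which `v` is merged at time `s`: its least alive neighbour, or the virtual
vertex `g` if there is none. -/
def Parent (s b v p : ℕ) : Prop :=
  (p < I.g ∧ al s b p ∧ Adj' I b v p ∧ ∀ u < I.B, u < p → ¬ (al s b u ∧ Adj' I b v u)) ∨
  (p = I.g ∧ ∀ u < I.B, ¬ (al s b u ∧ Adj' I b v u))

/-- The vertex `y` of `H` is known to be mapped to `w`. -/
def Located (x p t a m y w : ℕ) : Prop :=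
  Mem I x t m y ∧ ((y = x ∧ w = p) ∨ (y = t ∧ w = a))

/-- Compatibility of the partial solution `(x₁, t₁, a₁, m₁)` at `v` with `(x, t₂, a₂, m₂)` at `p`,
giving `(x, t, a, m)` at `p`. -/
def Compat (v p x t a m x₁ t₁ a₁ m₁ t₂ a₂ m₂ : ℕ) : Prop :=
  (∀ y < I.B, (Mem I x t m y ↔ Mem I x₁ t₁ m₁ y ∨ Mem I x t₂ m₂ y) ∧
    ¬ (Mem I x₁ t₁ m₁ y ∧ Mem I x t₂ m₂ y)) ∧
  -- An edge of H between the two parts can be checked only if the images of both ends are known,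
  -- that is, if the ends are labels of roots or tags.
  (∀ y < I.B, ∀ z < I.B, Mem I x₁ t₁ m₁ y ∧ Mem I x t₂ m₂ z ∧ I.aH y z →
    ∃ w < I.B, ∃ w' < I.B, Located I x₁ v t₁ a₁ m₁ y w ∧ Located I x p t₂ a₂ m₂ z w' ∧
      I.aG w w') ∧
  -- `x` must go to the root `p`, so it cannot belong to the block of `v`; the image of the new `t`
  -- must already be known in one of the parts.
  ¬ Mem I x₁ t₁ m₁ x ∧
  (Mem I x t m t → Located I x₁ v t₁ a₁ m₁ t a ∨ Located I x p t₂ a₂ m₂ t a)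

/-- The initial partial solutions. -/
def dpInit (p x t a m : ℕ) : Prop :=
  p ≤ I.g ∧ (∀ y < I.B, Mem I x t m y → y = x ∧ p < I.g) ∧ (Mem I x t m t → a = p)

/-- The partial solutions after a merge. -/
def dpMerge (s b v p x t a m : ℕ) : Prop :=
  ∃ x₁ < I.B, ∃ t₁ < I.B, ∃ a₁ < I.B, ∃ m₁ < I.B, ∃ t₂ < I.B, ∃ a₂ < I.B, ∃ m₂ < I.B,
    dp s b v x₁ t₁ a₁ m₁ ∧ dp s b p x t₂ a₂ m₂ ∧ Compat I v p x t a m x₁ t₁ a₁ m₁ t₂ a₂ m₂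

/-- The partial solutions at time `s + 1`. -/
def dpStep (s b p x t a m : ℕ) : Prop :=
  ∃ v < I.B, ∃ q < I.B, (Pick I al s b v ∧ Parent I al s b v q) ∧
    ((p = q ∧ dpMerge I dp s b v p x t a m) ∨ (p ≠ q ∧ p ≠ v ∧ dp s b p x t a m))

end Script

/-- The address of an entry of the table. -/
def code (B k s e₁ e₂ e₃ e₄ e₅ e₆ : ℕ) : ℕ :=
  ((((((k * B + s) * B + e₁) * B + e₂) * B + e₃) * B + e₄) * B + e₅) * B + e₆

/-- An entry of the table. -/
def Entry (c : Ctx) (k s e₁ e₂ e₃ e₄ e₅ e₆ : ℕ) : Prop :=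
  (k < c.B ∧ s < c.B ∧ e₁ < c.B ∧ e₂ < c.B ∧ e₃ < c.B ∧ e₄ < c.B ∧ e₅ < c.B ∧ e₆ < c.B) ∧
    c.tab (code c.B k s e₁ e₂ e₃ e₄ e₅ e₆) = 1

open Classical in
/-- The product, as long as the factors do not exceed the bound. -/
noncomputable def prod (B u v : ℕ) : ℕ :=
  ∑ y ∈ range B, ∑ z ∈ range B, if y < u ∧ z < v then 1 else 0

/-- Adjacency in `H` as read from the input. -/
def inH (c : Ctx) (u v : ℕ) : Prop :=
  (u < c.inp.getD 0 0 ∧ v < c.inp.getD 0 0) ∧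
    c.inp.getD (2 + prod c.B u (c.inp.getD 0 0) + v) 0 = 1

/-- Adjacency in `G` as read from the input. -/
def inG (c : Ctx) (u v : ℕ) : Prop :=
  (u < c.inp.getD 1 0 ∧ v < c.inp.getD 1 0) ∧
    c.inp.getD (2 + prod c.B (c.inp.getD 0 0) (c.inp.getD 0 0) +
      prod c.B u (c.inp.getD 1 0) + v) 0 = 1

/-- The data found in a context. -/
abbrev dat (c : Ctx) : Data where
  B := c.B
  h := c.inp.getD 0 0
  g := c.inp.getD 1 0
  aH := inH c
  aG := inG c
  bit s m := Entry c 0 s m 0 0 0 0 0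
  core s v := Entry c 1 s v 0 0 0 0 0
  conn s x t y z := Entry c 2 s x t y z 0 0

/-- The table of alive vertices. -/
abbrev datAl (c : Ctx) (s b v : ℕ) : Prop := Entry c 3 s b v 0 0 0 0

/-- The table of partial solutions. -/
abbrev datDp (c : Ctx) (s b p x t a m : ℕ) : Prop := Entry c 4 s b p x t a m

/-- Digit `s + 1` of `m` is digit `s` of the half of `m`; the half is found by a bounded search
instead of a division. -/
def bitStep (c : Ctx) (s m : ℕ) : Prop :=
  (s = 0 ∧ ∃ q < c.B, m = q + q + 1) ∨
  ∃ r < c.B, s = r + 1 ∧ ∃ q < c.B, (dat c).bit r q ∧ (m = q + q ∨ m = q + q + 1)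

/-- Each round keeps the vertices with two remaining neighbours. After `g` rounds the set is stable,
which gives the 2-core. -/
def coreStep (c : Ctx) (s v : ℕ) : Prop :=
  (s = 0 ∧ v < (dat c).g) ∨
  ∃ r < c.B, s = r + 1 ∧ (dat c).core r v ∧ ∃ u < c.B, ∃ w < c.B, u ≠ w ∧
    (inG c v u ∧ inG c v w) ∧ ((dat c).core r u ∧ (dat c).core r w)

/-- Breadth-first search from `y`, avoiding the edges at `x` and `t`. For x = t = h, which is no
vertex, nothing is deleted and the components of H itself result. -/
def connStep (c : Ctx) (s x t y z : ℕ) : Prop :=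
  (s = 0 ∧ y = z ∧ y < (dat c).h) ∨
  ∃ r < c.B, s = r + 1 ∧ ((dat c).conn r x t y z ∨
    ∃ w < c.B, (dat c).conn r x t y w ∧ inH c w z ∧ ((w ≠ x ∧ w ≠ t) ∧ (z ≠ x ∧ z ≠ t)))

def alStep (c : Ctx) (s b v : ℕ) : Prop :=
  (s = 0 ∧ v < (dat c).g) ∨
  ∃ r < c.B, s = r + 1 ∧ datAl c r b v ∧ ¬ Pick (dat c) (datAl c) r b v

def solStep (c : Ctx) (s b p x t a m : ℕ) : Prop :=
  (s = 0 ∧ dpInit (dat c) p x t a m) ∨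
  ∃ r < c.B, s = r + 1 ∧ dpStep (dat c) (datAl c) (datDp c) r b p x t a m

/-- The rules for the entries of the table. -/
def Rule (c : Ctx) (k s e₁ e₂ e₃ e₄ e₅ e₆ : ℕ) : Prop :=
  (k = 0 ∧ bitStep c s e₁) ∨ (k = 1 ∧ coreStep c s e₁) ∨ (k = 2 ∧ connStep c s e₁ e₂ e₃ e₄) ∨
  (k = 3 ∧ alStep c s e₁ e₂) ∨ (k = 4 ∧ solStep c s e₁ e₂ e₃ e₄ e₅ e₆)

/-- The rule for the address `a`. -/
def RuleAt (c : Ctx) (a : ℕ) : Prop :=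
  ∃ k < c.B, ∃ s < c.B, ∃ e₁ < c.B, ∃ e₂ < c.B, ∃ e₃ < c.B, ∃ e₄ < c.B, ∃ e₅ < c.B, ∃ e₆ < c.B,
    a = code c.B k s e₁ e₂ e₃ e₄ e₅ e₆ ∧ Rule c k s e₁ e₂ e₃ e₄ e₅ e₆

/-- The answer read off the table. -/
def Accept (c : Ctx) : Prop :=
  ∃ b < c.B, ∃ x < c.B, ∃ t < c.B, ∃ a < c.B, ∃ m < c.B,
    datDp c (dat c).g b (dat c).g x t a m ∧ ∀ y < c.B, y < (dat c).h → Mem (dat c) x t m y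

open Classical in
/-- The number of binary digits needed for the masks. -/
noncomputable def digits (c : Ctx) : ℕ :=
  (∑ u ∈ range c.B, ∑ v ∈ range c.B, if XEdge (dat c) u v then 1 else 0) +
    -- Six units of the final constant pay for the components that arise from deleting the edges at
    -- `x` and `t`.
    (∑ z ∈ range c.B, if Rep (dat c) (dat c).h (dat c).h z then 1 else 0) + 7

end Elim

/-! ### Terms for the rules and for acceptance -/

namespace RAM

/-- Under `n` bounded quantifiers or sums, outer data refer to the list with its first `n` entries
removed. -/
theorem Rz.drop {F : Ctx → List ℕ → ℕ} (h : Rz F) (n : ℕ) :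
    Rz fun c ρ => F c (List.tail^[n] ρ) := by
  induction n with
  | zero => exact h
  | succ n ih => exact ih.tail

theorem Rz.var (n : ℕ) : Rz fun _ ρ => (List.tail^[n] ρ).headI := Rz.head.drop n

end RAM

namespace Elim

open Finset RAM

variable {U V W X Y Z P Q : Ctx → List ℕ → ℕ}

theorem rz_h : Rz fun c _ => c.inp.getD 0 0 := (Rz.const 0).inp

theorem rz_g : Rz fun c _ => c.inp.getD 1 0 := (Rz.const 1).inp

theorem rz_prod (hU : Rz U) (hV : Rz V) : Rz fun c ρ => prod c.B (U c ρ) (V c ρ) := by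
  unfold prod
  exact .sum (RzP.count (.and (.lt (.var 1) (hU.drop 2)) (.lt (.var 0) (hV.drop 2))))

theorem rz_inH (hU : Rz U) (hV : Rz V) : RzP fun c ρ => inH c (U c ρ) (V c ρ) := by
  unfold inH
  exact .and (.and (.lt hU rz_h) (.lt hV rz_h))
    (.eq (.inp (.add (.add (.const 2) (rz_prod hU rz_h)) hV)) (.const 1))

theorem rz_inG (hU : Rz U) (hV : Rz V) : RzP fun c ρ => inG c (U c ρ) (V c ρ) := by
  unfold inG
  exact .and (.and (.lt hU rz_g) (.lt hV rz_g))
    (.eq (.inp (.add (.add (.add (.const 2) (rz_prod rz_h rz_h)) (rz_prod hU rz_g)) hV)) (.const 1))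

theorem rz_B : Rz fun c _ => c.B := ((Rz.const 1).mulB).of_eq fun c _ => by simp

theorem rz_code {A₁ A₂ A₃ A₄ A₅ A₆ A₇ A₈ : Ctx → List ℕ → ℕ} (h₁ : Rz A₁) (h₂ : Rz A₂)
    (h₃ : Rz A₃) (h₄ : Rz A₄) (h₅ : Rz A₅) (h₆ : Rz A₆) (h₇ : Rz A₇) (h₈ : Rz A₈) :
    Rz fun c ρ => code c.B (A₁ c ρ) (A₂ c ρ) (A₃ c ρ) (A₄ c ρ) (A₅ c ρ) (A₆ c ρ) (A₇ c ρ)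
      (A₈ c ρ) := by
  unfold code
  exact ((((((((h₁.mulB.add h₂).mulB).add h₃).mulB.add h₄).mulB.add h₅).mulB.add h₆).mulB.add
    h₇).mulB.add h₈)

theorem rz_entry {A₁ A₂ A₃ A₄ A₅ A₆ A₇ A₈ : Ctx → List ℕ → ℕ} (h₁ : Rz A₁) (h₂ : Rz A₂)
    (h₃ : Rz A₃) (h₄ : Rz A₄) (h₅ : Rz A₅) (h₆ : Rz A₆) (h₇ : Rz A₇) (h₈ : Rz A₈) :
    RzP fun c ρ => Entry c (A₁ c ρ) (A₂ c ρ) (A₃ c ρ) (A₄ c ρ) (A₅ c ρ) (A₆ c ρ) (A₇ c ρ)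
      (A₈ c ρ) := by
  unfold Entry
  exact .and (.and (.lt h₁ rz_B) (.and (.lt h₂ rz_B) (.and (.lt h₃ rz_B) (.and (.lt h₄ rz_B)
    (.and (.lt h₅ rz_B) (.and (.lt h₆ rz_B) (.and (.lt h₇ rz_B) (.lt h₈ rz_B))))))))
    (.eq (.tab (rz_code h₁ h₂ h₃ h₄ h₅ h₆ h₇ h₈)) (.const 1))

theorem rz_core (hU : Rz U) : RzP fun c ρ => Core (dat c) (U c ρ) :=
  rz_entry (.const 1) rz_g hU (.const 0) (.const 0) (.const 0) (.const 0) (.const 0)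

theorem rz_branch (hU : Rz U) : RzP fun c ρ => Branch (dat c) (U c ρ) := by
  unfold Branch
  have h3 := hU.drop 3
  exact .ex (.ex (.ex (.and (.and (.ne (.var 2) (.var 1)) (.and (.ne (.var 2) (.var 0))
    (.ne (.var 1) (.var 0)))) (.and (.and (rz_inG h3 (.var 2)) (.and (rz_inG h3 (.var 1))
    (rz_inG h3 (.var 0)))) (.and (rz_core (.var 2)) (.and (rz_core (.var 1))
    (rz_core (.var 0))))))))

theorem rz_xEdge (hU : Rz U) (hV : Rz V) : RzP fun c ρ => XEdge (dat c) (U c ρ) (V c ρ) := by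
  unfold XEdge
  exact .and (.lt hU hV) (.and (rz_inG hU hV) (.and (rz_core hU) (.and (rz_core hV)
    (.or (rz_branch hU) (rz_branch hV)))))

theorem rz_xidx (hU : Rz U) (hV : Rz V) : Rz fun c ρ => xidx (dat c) (U c ρ) (V c ρ) := by
  unfold xidx
  exact .sum (RzP.count (.and (rz_xEdge (.var 1) (.var 0)) (.or (.lt (.var 1) (hU.drop 2))
    (.and (.eq (.var 1) (hU.drop 2)) (.lt (.var 0) (hV.drop 2))))))

theorem rz_digit (hU : Rz U) (hV : Rz V) : RzP fun c ρ => Digit (dat c) (U c ρ) (V c ρ) := by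
  unfold Digit
  exact .ex (.and (.eq (.var 0) (hV.drop 1)) (rz_entry (.const 0) (.var 0) (hU.drop 1) (.const 0)
    (.const 0) (.const 0) (.const 0) (.const 0)))

theorem rz_adj' (hU : Rz U) (hV : Rz V) (hW : Rz W) :
    RzP fun c ρ => Adj' (dat c) (U c ρ) (V c ρ) (W c ρ) := by
  unfold Adj'
  exact .and (rz_inG hV hW) (.and (.not (.and (rz_xEdge hV hW) (rz_digit hU (rz_xidx hV hW))))
    (.not (.and (rz_xEdge hW hV) (rz_digit hU (rz_xidx hW hV)))))

theorem rz_conn (hU : Rz U) (hV : Rz V) (hW : Rz W) (hX : Rz X) (hY : Rz Y) :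
    RzP fun c ρ => (dat c).conn (U c ρ) (V c ρ) (W c ρ) (X c ρ) (Y c ρ) :=
  rz_entry (.const 2) hU hV hW hX hY (.const 0) (.const 0)

theorem rz_rep (hU : Rz U) (hV : Rz V) (hW : Rz W) :
    RzP fun c ρ => Rep (dat c) (U c ρ) (V c ρ) (W c ρ) := by
  unfold Rep
  exact .and (.lt hW rz_h) (.all (.imp (rz_conn rz_h (hU.drop 1) (hV.drop 1) (hW.drop 1) (.var 0))
    (.le (hW.drop 1) (.var 0))))

theorem rz_cidx (hU : Rz U) (hV : Rz V) (hW : Rz W) :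
    Rz fun c ρ => cidx (dat c) (U c ρ) (V c ρ) (W c ρ) := by
  unfold cidx
  exact RzP.count (.and (rz_rep (hU.drop 1) (hV.drop 1) (.var 0)) (.all (.imp (rz_conn rz_h (hU.drop 2)
    (hV.drop 2) (hW.drop 2) (.var 0)) (.lt (.var 1) (.var 0)))))

theorem rz_mem (hU : Rz U) (hV : Rz V) (hW : Rz W) (hX : Rz X) :
    RzP fun c ρ => Mem (dat c) (U c ρ) (V c ρ) (W c ρ) (X c ρ) := by
  unfold Mem
  exact .and (.lt hX rz_h) (rz_digit hW (rz_cidx hU hV hX))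

theorem rz_al (hU : Rz U) (hV : Rz V) (hW : Rz W) :
    RzP fun c ρ => datAl c (U c ρ) (V c ρ) (W c ρ) :=
  rz_entry (.const 3) hU hV hW (.const 0) (.const 0) (.const 0) (.const 0)

theorem rz_low (hU : Rz U) (hV : Rz V) (hW : Rz W) :
    RzP fun c ρ => Low (dat c) (datAl c) (U c ρ) (V c ρ) (W c ρ) := by
  unfold Low
  have u2 := hU.drop 2
  have v2 := hV.drop 2
  have w2 := hW.drop 2
  exact .and (rz_al hU hV hW) (.all (.all (.imp (.and (rz_al u2 v2 (.var 1))
    (.and (rz_al u2 v2 (.var 0)) (.and (rz_adj' v2 w2 (.var 1)) (rz_adj' v2 w2 (.var 0)))))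
    (.eq (.var 1) (.var 0)))))

theorem rz_pick (hU : Rz U) (hV : Rz V) (hW : Rz W) :
    RzP fun c ρ => Pick (dat c) (datAl c) (U c ρ) (V c ρ) (W c ρ) := by
  unfold Pick
  have u1 := hU.drop 1
  have v1 := hV.drop 1
  have w1 := hW.drop 1
  exact .or (.and (rz_low hU hV hW) (.all (.imp (.lt (.var 0) w1) (.not (rz_low u1 v1 (.var 0))))))
    (.and (.all (.not (rz_low u1 v1 (.var 0)))) (.and (rz_al hU hV hW)
      (.all (.imp (.lt (.var 0) w1) (.not (rz_al u1 v1 (.var 0)))))))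

theorem rz_parent (hU : Rz U) (hV : Rz V) (hW : Rz W) (hX : Rz X) :
    RzP fun c ρ => Parent (dat c) (datAl c) (U c ρ) (V c ρ) (W c ρ) (X c ρ) := by
  unfold Parent
  have n := RzP.not (.and (rz_al (hU.drop 1) (hV.drop 1) (.var 0))
    (rz_adj' (hV.drop 1) (hW.drop 1) (.var 0)))
  exact .or (.and (.lt hX rz_g) (.and (rz_al hU hV hX) (.and (rz_adj' hV hW hX)
    (.all (.imp (.lt (.var 0) (hX.drop 1)) n))))) (.and (.eq hX rz_g) (.all n))

theorem rz_located (hU : Rz U) (hV : Rz V) (hW : Rz W) (hX : Rz X) (hY : Rz Y) (hZ : Rz Z)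
    (hP : Rz P) : RzP fun c ρ => Located (dat c) (U c ρ) (V c ρ) (W c ρ) (X c ρ) (Y c ρ) (Z c ρ)
      (P c ρ) := by
  unfold Located
  exact .and (rz_mem hU hW hY hZ) (.or (.and (.eq hZ hU) (.eq hP hV)) (.and (.eq hZ hW) (.eq hP hX)))

theorem rz_compat {V P X T A M X₁ T₁ A₁ M₁ T₂ A₂ M₂ : Ctx → List ℕ → ℕ} (hV : Rz V) (hP : Rz P)
    (hX : Rz X) (hT : Rz T) (hA : Rz A) (hM : Rz M) (hX₁ : Rz X₁) (hT₁ : Rz T₁) (hA₁ : Rz A₁)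
    (hM₁ : Rz M₁) (hT₂ : Rz T₂) (hA₂ : Rz A₂) (hM₂ : Rz M₂) :
    RzP fun c ρ => Compat (dat c) (V c ρ) (P c ρ) (X c ρ) (T c ρ) (A c ρ) (M c ρ) (X₁ c ρ) (T₁ c ρ)
      (A₁ c ρ) (M₁ c ρ) (T₂ c ρ) (A₂ c ρ) (M₂ c ρ) := by
  unfold Compat
  have m₁ := rz_mem (hX₁.drop 1) (hT₁.drop 1) (hM₁.drop 1) (.var 0)
  have m₂ := rz_mem (hX.drop 1) (hT₂.drop 1) (hM₂.drop 1) (.var 0)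
  refine .and (.all (.and (.iff (rz_mem (hX.drop 1) (hT.drop 1) (hM.drop 1) (.var 0))
    (.or m₁ m₂)) (.not (.and m₁ m₂)))) (.and (.all (.all (.imp (.and
    (rz_mem (hX₁.drop 2) (hT₁.drop 2) (hM₁.drop 2) (.var 1)) (.and
    (rz_mem (hX.drop 2) (hT₂.drop 2) (hM₂.drop 2) (.var 0)) (rz_inH (.var 1) (.var 0))))
    (.ex (.ex (.and (rz_located (hX₁.drop 4) (hV.drop 4) (hT₁.drop 4) (hA₁.drop 4) (hM₁.drop 4)
      (.var 3) (.var 1)) (.and (rz_located (hX.drop 4) (hP.drop 4) (hT₂.drop 4) (hA₂.drop 4)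
      (hM₂.drop 4) (.var 2) (.var 0)) (rz_inG (.var 1) (.var 0))))))))) (.and
    (.not (rz_mem hX₁ hT₁ hM₁ hX)) (.imp (rz_mem hX hT hM hT) (.or
      (rz_located hX₁ hV hT₁ hA₁ hM₁ hT hA) (rz_located hX hP hT₂ hA₂ hM₂ hT hA)))))

theorem rz_dpInit (hU : Rz U) (hV : Rz V) (hW : Rz W) (hX : Rz X) (hY : Rz Y) :
    RzP fun c ρ => dpInit (dat c) (U c ρ) (V c ρ) (W c ρ) (X c ρ) (Y c ρ) := by
  unfold dpInit
  exact .and (.le hU rz_g) (.and (.all (.imp (rz_mem (hV.drop 1) (hW.drop 1) (hY.drop 1) (.var 0))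
    (.and (.eq (.var 0) (hV.drop 1)) (.lt (hU.drop 1) rz_g)))) (.imp (rz_mem hV hW hY hW)
      (.eq hX hU)))

theorem rz_dpMerge {S : Ctx → List ℕ → ℕ} (hS : Rz S) (hU : Rz U) (hV : Rz V) (hP : Rz P)
    (hX : Rz X) (hY : Rz Y) (hZ : Rz Z) (hW : Rz W) :
    RzP fun c ρ => dpMerge (dat c) (datDp c) (S c ρ) (U c ρ) (V c ρ) (P c ρ) (X c ρ) (Y c ρ)
      (Z c ρ) (W c ρ) := by
  unfold dpMerge
  exact .ex (.ex (.ex (.ex (.ex (.ex (.ex (.and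
    (rz_entry (.const 4) (hS.drop 7) (hU.drop 7) (hV.drop 7) (.var 6) (.var 5) (.var 4) (.var 3))
    (.and
    (rz_entry (.const 4) (hS.drop 7) (hU.drop 7) (hP.drop 7) (hX.drop 7) (.var 2) (.var 1) (.var 0))
    (rz_compat (hV.drop 7) (hP.drop 7) (hX.drop 7) (hY.drop 7) (hZ.drop 7) (hW.drop 7)
      (.var 6) (.var 5) (.var 4) (.var 3) (.var 2) (.var 1) (.var 0))))))))))

theorem rz_dpStep {S : Ctx → List ℕ → ℕ} (hS : Rz S) (hU : Rz U) (hP : Rz P)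
    (hX : Rz X) (hY : Rz Y) (hZ : Rz Z) (hW : Rz W) :
    RzP fun c ρ => dpStep (dat c) (datAl c) (datDp c) (S c ρ) (U c ρ) (P c ρ) (X c ρ) (Y c ρ)
      (Z c ρ) (W c ρ) := by
  unfold dpStep
  have s := hS.drop 2
  have u := hU.drop 2
  have p := hP.drop 2
  exact .ex (.ex (.and (.and (rz_pick s u (.var 1)) (rz_parent s u (.var 1) (.var 0)))
    (.or (.and (.eq p (.var 0)) (rz_dpMerge s u (.var 1) p (hX.drop 2) (hY.drop 2) (hZ.drop 2)
      (hW.drop 2))) (.and (.ne p (.var 0)) (.and (.ne p (.var 1)) (rz_entry (.const 4) s u p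
        (hX.drop 2) (hY.drop 2) (hZ.drop 2) (hW.drop 2)))))))

theorem rz_bitStep (hU : Rz U) (hV : Rz V) : RzP fun c ρ => bitStep c (U c ρ) (V c ρ) := by
  unfold bitStep
  have q : Rz fun _ ρ => ρ.headI + ρ.headI := .add .head .head
  exact .or (.and (.eq hU (.const 0)) (.ex (.eq (hV.drop 1) (.add q (.const 1)))))
    (.ex (.and (.eq (hU.drop 1) (.add (.var 0) (.const 1))) (.ex (.and (rz_entry (.const 0) (.var 1)
      (.var 0) (.const 0) (.const 0) (.const 0) (.const 0) (.const 0)) (.or (.eq (hV.drop 2) q)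
        (.eq (hV.drop 2) (.add q (.const 1))))))))

theorem rz_coreStep (hU : Rz U) (hV : Rz V) : RzP fun c ρ => coreStep c (U c ρ) (V c ρ) := by
  unfold coreStep
  exact .or (.and (.eq hU (.const 0)) (.lt hV rz_g)) (.ex (.and (.eq (hU.drop 1)
    (.add (.var 0) (.const 1))) (.and (rz_entry (.const 1) (.var 0) (hV.drop 1) (.const 0) (.const 0)
    (.const 0) (.const 0) (.const 0)) (.ex (.ex (.and (.ne (.var 1) (.var 0)) (.and (.and
    (rz_inG (hV.drop 3) (.var 1)) (rz_inG (hV.drop 3) (.var 0))) (.and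
    (rz_entry (.const 1) (.var 2) (.var 1) (.const 0) (.const 0) (.const 0) (.const 0) (.const 0))
    (rz_entry (.const 1) (.var 2) (.var 0) (.const 0) (.const 0) (.const 0) (.const 0)
      (.const 0))))))))))

theorem rz_connStep (hU : Rz U) (hV : Rz V) (hW : Rz W) (hX : Rz X) (hY : Rz Y) :
    RzP fun c ρ => connStep c (U c ρ) (V c ρ) (W c ρ) (X c ρ) (Y c ρ) := by
  unfold connStep
  exact .or (.and (.eq hU (.const 0)) (.and (.eq hX hY) (.lt hX rz_h))) (.ex (.and (.eq (hU.drop 1)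
    (.add (.var 0) (.const 1))) (.or (rz_conn (.var 0) (hV.drop 1) (hW.drop 1) (hX.drop 1)
    (hY.drop 1)) (.ex (.and (rz_conn (.var 1) (hV.drop 2) (hW.drop 2) (hX.drop 2) (.var 0))
    (.and (rz_inH (.var 0) (hY.drop 2)) (.and (.and (.ne (.var 0) (hV.drop 2))
    (.ne (.var 0) (hW.drop 2))) (.and (.ne (hY.drop 2) (hV.drop 2))
    (.ne (hY.drop 2) (hW.drop 2))))))))))

theorem rz_alStep (hU : Rz U) (hV : Rz V) (hW : Rz W) :
    RzP fun c ρ => alStep c (U c ρ) (V c ρ) (W c ρ) := by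
  unfold alStep
  exact .or (.and (.eq hU (.const 0)) (.lt hW rz_g)) (.ex (.and (.eq (hU.drop 1)
    (.add (.var 0) (.const 1))) (.and (rz_al (.var 0) (hV.drop 1) (hW.drop 1))
    (.not (rz_pick (.var 0) (hV.drop 1) (hW.drop 1))))))

theorem rz_solStep {S : Ctx → List ℕ → ℕ} (hS : Rz S) (hU : Rz U) (hP : Rz P)
    (hX : Rz X) (hY : Rz Y) (hZ : Rz Z) (hW : Rz W) :
    RzP fun c ρ => solStep c (S c ρ) (U c ρ) (P c ρ) (X c ρ) (Y c ρ) (Z c ρ) (W c ρ) := by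
  unfold solStep
  exact .or (.and (.eq hS (.const 0)) (rz_dpInit hP hX hY hZ hW)) (.ex (.and (.eq (hS.drop 1)
    (.add (.var 0) (.const 1))) (rz_dpStep (.var 0) (hU.drop 1) (hP.drop 1) (hX.drop 1) (hY.drop 1)
      (hZ.drop 1) (hW.drop 1))))

theorem rz_rule {K S : Ctx → List ℕ → ℕ} (hK : Rz K) (hS : Rz S) (hU : Rz U) (hP : Rz P)
    (hX : Rz X) (hY : Rz Y) (hZ : Rz Z) (hW : Rz W) :
    RzP fun c ρ => Rule c (K c ρ) (S c ρ) (U c ρ) (P c ρ) (X c ρ) (Y c ρ) (Z c ρ) (W c ρ) := by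
  unfold Rule
  exact .or (.and (.eq hK (.const 0)) (rz_bitStep hS hU)) (.or (.and (.eq hK (.const 1))
    (rz_coreStep hS hU)) (.or (.and (.eq hK (.const 2)) (rz_connStep hS hU hP hX hY))
    (.or (.and (.eq hK (.const 3)) (rz_alStep hS hU hP)) (.and (.eq hK (.const 4))
    (rz_solStep hS hU hP hX hY hZ hW)))))

theorem rz_ruleAt : RzP fun c ρ => RuleAt c ρ.headI := by
  unfold RuleAt
  exact .ex (.ex (.ex (.ex (.ex (.ex (.ex (.ex (.and (.eq (.var 8) (rz_code (.var 7) (.var 6)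
    (.var 5) (.var 4) (.var 3) (.var 2) (.var 1) (.var 0))) (rz_rule (.var 7) (.var 6)
    (.var 5) (.var 4) (.var 3) (.var 2) (.var 1) (.var 0))))))))))

theorem rz_accept : RzP fun c _ => Accept c := by
  unfold Accept
  exact .ex (.ex (.ex (.ex (.ex (.and (rz_entry (.const 4) rz_g (.var 4) rz_g (.var 3) (.var 2)
    (.var 1) (.var 0)) (.all (.imp (.lt (.var 0) rz_h) (rz_mem (.var 4) (.var 3) (.var 1)
      (.var 0)))))))))

theorem rz_digits : Rz fun c _ => digits c := by
  unfold digits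
  exact .add (.add (.sum (.sum (rz_xEdge (.var 1) (.var 0)))) (.sum (rz_rep rz_h rz_h (.var 0))))
    (.const 7)

end Elim

/-! ### Addresses and the order of filling -/

namespace Elim

open Finset RAM

theorem horner_lt {B x x' e e' : ℕ} (he : e < B) (h : x < x') : x * B + e < x' * B + e' := by
  have : (x + 1) * B ≤ x' * B := Nat.mul_le_mul_right _ h
  rw [Nat.add_mul] at this
  omega

theorem horner_inj {B x x' e e' : ℕ} (he : e < B) (he' : e' < B) (h : x * B + e = x' * B + e') :
    x = x' ∧ e = e' := by
  rcases lt_trichotomy x x' with hx | rfl | hx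
  · have := horner_lt (e' := e') he hx; omega
  · exact ⟨rfl, by omega⟩
  · have := horner_lt (e' := e) he' hx; omega

/-- Kind and stage are the leading digits in base `B`. Entries of a smaller kind, or of the same
kind and an earlier stage, are therefore filled first, whatever their other arguments are. -/
theorem code_lt {B k s e₁ e₂ e₃ e₄ e₅ e₆ k' s' f₁ f₂ f₃ f₄ f₅ f₆ : ℕ} (hs : s < B)
    (h₁ : e₁ < B) (h₂ : e₂ < B) (h₃ : e₃ < B) (h₄ : e₄ < B) (h₅ : e₅ < B) (h₆ : e₆ < B)
    (h : k < k' ∨ (k = k' ∧ s < s')) :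
    code B k s e₁ e₂ e₃ e₄ e₅ e₆ < code B k' s' f₁ f₂ f₃ f₄ f₅ f₆ := by
  unfold code
  refine horner_lt h₆ (horner_lt h₅ (horner_lt h₄ (horner_lt h₃ (horner_lt h₂ (horner_lt h₁ ?_)))))
  rcases h with h | ⟨rfl, h⟩
  · exact horner_lt hs h
  · omega

theorem code_inj {B k s e₁ e₂ e₃ e₄ e₅ e₆ k' s' f₁ f₂ f₃ f₄ f₅ f₆ : ℕ} (hs : s < B)
    (h₁ : e₁ < B) (h₂ : e₂ < B) (h₃ : e₃ < B) (h₄ : e₄ < B) (h₅ : e₅ < B) (h₆ : e₆ < B)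
    (hs' : s' < B) (g₁ : f₁ < B) (g₂ : f₂ < B) (g₃ : f₃ < B) (g₄ : f₄ < B) (g₅ : f₅ < B)
    (g₆ : f₆ < B) (h : code B k s e₁ e₂ e₃ e₄ e₅ e₆ = code B k' s' f₁ f₂ f₃ f₄ f₅ f₆) :
    k = k' ∧ s = s' ∧ e₁ = f₁ ∧ e₂ = f₂ ∧ e₃ = f₃ ∧ e₄ = f₄ ∧ e₅ = f₅ ∧ e₆ = f₆ := by
  unfold code at h
  obtain ⟨h, r₆⟩ := horner_inj h₆ g₆ h
  obtain ⟨h, r₅⟩ := horner_inj h₅ g₅ h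
  obtain ⟨h, r₄⟩ := horner_inj h₄ g₄ h
  obtain ⟨h, r₃⟩ := horner_inj h₃ g₃ h
  obtain ⟨h, r₂⟩ := horner_inj h₂ g₂ h
  obtain ⟨h, r₁⟩ := horner_inj h₁ g₁ h
  obtain ⟨h, r₀⟩ := horner_inj hs hs' h
  exact ⟨h, r₀, r₁, r₂, r₃, r₄, r₅, r₆⟩

theorem code_lt_pow {B k s e₁ e₂ e₃ e₄ e₅ e₆ : ℕ} (hk : k < B) (hs : s < B)
    (h₁ : e₁ < B) (h₂ : e₂ < B) (h₃ : e₃ < B) (h₄ : e₄ < B) (h₅ : e₅ < B) (h₆ : e₆ < B) :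
    code B k s e₁ e₂ e₃ e₄ e₅ e₆ < B ^ 8 := by
  have : code B k s e₁ e₂ e₃ e₄ e₅ e₆ < code B B 0 0 0 0 0 0 0 :=
    code_lt hs h₁ h₂ h₃ h₄ h₅ h₆ (.inl hk)
  refine this.trans_eq ?_
  unfold code
  ring

/-- The entries of the table are those given by the rules. -/
def Filled (c : Ctx) : Prop := ∀ k s e₁ e₂ e₃ e₄ e₅ e₆, Entry c k s e₁ e₂ e₃ e₄ e₅ e₆ ↔
  (k < c.B ∧ s < c.B ∧ e₁ < c.B ∧ e₂ < c.B ∧ e₃ < c.B ∧ e₄ < c.B ∧ e₅ < c.B ∧ e₆ < c.B) ∧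
    Rule c k s e₁ e₂ e₃ e₄ e₅ e₆

/-- A rule uses only entries of a smaller kind, or of the same kind and an earlier stage. -/
theorem Rule.congr {c c' : Ctx} (hi : c'.inp = c.inp) (hB : c'.B = c.B) {k s : ℕ}
    (hE : ∀ k' s', (k' < k ∨ (k' = k ∧ s' < s)) → Entry c' k' s' = Entry c k' s')
    (e₁ e₂ e₃ e₄ e₅ e₆ : ℕ) :
    Rule c' k s e₁ e₂ e₃ e₄ e₅ e₆ ↔ Rule c k s e₁ e₂ e₃ e₄ e₅ e₆ := by
  have hH : inH c' = inH c := by unfold inH; rw [hi, hB]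
  have hG : inG c' = inG c := by unfold inG; rw [hi, hB]
  have hlt : ∀ k' < k, Entry c' k' = Entry c k' := fun k' h => funext fun s' => hE k' s' (.inl h)
  have hst : ∀ {F F' : ℕ → Prop}, (∀ r, s = r + 1 → (F' r ↔ F r)) →
      ((∃ r < c.B, s = r + 1 ∧ F' r) ↔ ∃ r < c.B, s = r + 1 ∧ F r) := by
    intro F F' h
    refine exists_congr fun r => and_congr_right fun _ => and_congr_right fun hr => h r hr
  -- Kinds 3 and 4 read the tables of digits, core and connectivity, all of which are of smaller
  -- kind.
  have hdat : 2 < k → dat c' = dat c := by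
    intro h
    unfold dat
    rw [hi, hB, hH, hG, hlt 0 (by omega), hlt 1 (by omega), hlt 2 h]
  unfold Rule
  refine or_congr (and_congr_right ?_) (or_congr (and_congr_right ?_) (or_congr (and_congr_right ?_)
    (or_congr (and_congr_right ?_) (and_congr_right ?_))))
  · rintro rfl
    unfold bitStep dat
    rw [hB]
    refine or_congr Iff.rfl (hst fun r hr => ?_)
    dsimp only
    rw [hE 0 r (.inr ⟨rfl, by omega⟩)]
  · rintro rfl
    unfold coreStep dat
    rw [hB, hi, hG]
    refine or_congr Iff.rfl (hst fun r hr => ?_)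
    dsimp only
    rw [hE 1 r (.inr ⟨rfl, by omega⟩)]
  · rintro rfl
    unfold connStep dat
    rw [hB, hi, hH]
    refine or_congr Iff.rfl (hst fun r hr => ?_)
    dsimp only
    rw [hE 2 r (.inr ⟨rfl, by omega⟩)]
  · rintro rfl
    unfold alStep
    rw [hB, hdat (by omega)]
    refine or_congr Iff.rfl (hst fun r hr => ?_)
    have : datAl c' r = datAl c r := by
      unfold datAl; rw [hE 3 r (.inr ⟨rfl, by omega⟩)]
    unfold Pick Low
    rw [this]
  · rintro rfl
    have hal : datAl c' = datAl c := by unfold datAl; rw [hlt 3 (by omega)]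
    unfold solStep
    rw [hB, hdat (by omega), hal]
    refine or_congr Iff.rfl (hst fun r hr => ?_)
    have : datDp c' r = datDp c r := by
      unfold datDp; rw [hE 4 r (.inr ⟨rfl, by omega⟩)]
    unfold dpStep dpMerge
    rw [this]

open Classical in
-- While a cell is computed, only the smaller addresses are known to be final. By `Rule.congr` the
-- rule depends on no others, so the intermediate table `T` and the final one give the same value.
theorem filled_of_fill (c : Ctx) (h : ∀ a < c.B ^ 8, ∃ T : ℕ → ℕ, (∀ a' < a, T a' = c.tab a') ∧
    c.tab a = if RuleAt ⟨c.inp, T, c.B⟩ a then 1 else 0) : Filled c := by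
  intro k s e₁ e₂ e₃ e₄ e₅ e₆
  unfold Entry
  refine and_congr_right ?_
  rintro ⟨hk, hs, h₁, h₂, h₃, h₄, h₅, h₆⟩
  obtain ⟨T, hT, hv⟩ := h _ (code_lt_pow hk hs h₁ h₂ h₃ h₄ h₅ h₆)
  have hc := Rule.congr (c := c) (c' := ⟨c.inp, T, c.B⟩) rfl rfl (k := k) (s := s) (by
    intro k' s' hlt
    funext f₁ f₂ f₃ f₄ f₅ f₆
    refine propext (and_congr_right ?_)
    rintro ⟨hk', hs', g₁, g₂, g₃, g₄, g₅, g₆⟩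
    rw [show (⟨c.inp, T, c.B⟩ : Ctx).tab = T from rfl,
      hT _ (code_lt hs' g₁ g₂ g₃ g₄ g₅ g₆ hlt)]) e₁ e₂ e₃ e₄ e₅ e₆
  rw [hv, ← hc]
  have : RuleAt ⟨c.inp, T, c.B⟩ (code c.B k s e₁ e₂ e₃ e₄ e₅ e₆) ↔
      Rule ⟨c.inp, T, c.B⟩ k s e₁ e₂ e₃ e₄ e₅ e₆ := by
    constructor
    · rintro ⟨k', hk', s', hs', f₁, g₁, f₂, g₂, f₃, g₃, f₄, g₄, f₅, g₅, f₆, g₆, heq, hr⟩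
      obtain ⟨rfl, rfl, rfl, rfl, rfl, rfl, rfl, rfl⟩ :=
        code_inj hs h₁ h₂ h₃ h₄ h₅ h₆ hs' g₁ g₂ g₃ g₄ g₅ g₆ heq
      exact hr
    · intro hr
      exact ⟨k, hk, s, hs, e₁, h₁, e₂, h₂, e₃, h₃, e₄, h₄, e₅, h₅, e₆, h₆, rfl, hr⟩
  rw [← this]
  split_ifs <;> simp_all

end Elim

/-! ### Correct tables; components of H without the edges at two vertices -/

namespace Elim

open Finset RAM

/-- The tables are correct: they satisfy their recursive equations, for two graphs on the vertices
below `h` and `g`. -/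
structure Good (I : Data) (al : ℕ → ℕ → ℕ → Prop) (dp : ℕ → ℕ → ℕ → ℕ → ℕ → ℕ → ℕ → Prop) :
    Prop where
  h_lt : I.h + 1 < I.B
  g_lt : I.g + 1 < I.B
  symmH : ∀ {u v}, I.aH u v → I.aH v u
  ltH : ∀ {u v}, I.aH u v → u < I.h
  neH : ∀ {u v}, I.aH u v → u ≠ v
  symmG : ∀ {u v}, I.aG u v → I.aG v u
  ltG : ∀ {u v}, I.aG u v → u < I.g
  neG : ∀ {u v}, I.aG u v → u ≠ v
  bit_iff : ∀ {j m}, j < I.B → m < I.B → (I.bit j m ↔ m.testBit j)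
  core_zero : ∀ {v}, I.core 0 v ↔ v < I.g
  core_succ : ∀ {r v}, r + 1 < I.B → (I.core (r + 1) v ↔
    I.core r v ∧ ∃ u w, u ≠ w ∧ (I.aG v u ∧ I.aG v w) ∧ (I.core r u ∧ I.core r w))
  conn_zero : ∀ {x t y z}, x < I.B → t < I.B → (I.conn 0 x t y z ↔ y = z ∧ y < I.h)
  conn_succ : ∀ {r x t y z}, x < I.B → t < I.B → r + 1 < I.B → (I.conn (r + 1) x t y z ↔
    I.conn r x t y z ∨
      ∃ w, I.conn r x t y w ∧ I.aH w z ∧ ((w ≠ x ∧ w ≠ t) ∧ (z ≠ x ∧ z ≠ t)))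
  al_zero : ∀ {b v}, b < I.B → (al 0 b v ↔ v < I.g)
  al_succ : ∀ {r b v}, b < I.B → r + 1 < I.B → (al (r + 1) b v ↔ al r b v ∧ ¬ Pick I al r b v)
  dp_lt : ∀ {s b p x t a m}, dp s b p x t a m → s < I.B ∧ b < I.B ∧ p < I.B ∧ x < I.B ∧ t < I.B ∧
    a < I.B ∧ m < I.B
  dp_zero : ∀ {b p x t a m}, b < I.B → p < I.B → x < I.B → t < I.B → a < I.B → m < I.B →
    (dp 0 b p x t a m ↔ dpInit I p x t a m)
  dp_succ : ∀ {r b p x t a m}, r + 1 < I.B → b < I.B → p < I.B → x < I.B → t < I.B → a < I.B →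
    m < I.B → (dp (r + 1) b p x t a m ↔ dpStep I al dp r b p x t a m)

/-- An increasing sequence of subsets of `{0, …, n - 1}` that is constant once it stagnates is
constant from `n` on. -/
theorem stable_of_increasing {n : ℕ} {S : ℕ → ℕ → Prop} (hmono : ∀ r ≤ n, ∀ v, S r v → S (r + 1) v)
    (hlt : ∀ r ≤ n + 1, ∀ v, S r v → v < n)
    (hstep : ∀ r < n, (∀ v, S (r + 1) v → S r v) → ∀ v, S (r + 2) v → S (r + 1) v) :
    ∀ v, S (n + 1) v → S n v := by
  classical
  by_contra hcon
  -- Stagnation at any stage up to `n` would persist to stage `n`. If it fails there, every stage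
  -- gains an element, and stage `n + 1` would have `n + 1` elements below `n`.
  have hns : ∀ k ≤ n, ¬ ∀ v, S (n - k + 1) v → S (n - k) v := by
    intro k
    induction k with
    | zero => intro _; exact hcon
    | succ k ih =>
      intro hk hst
      refine ih (by omega) ?_
      have := hstep (n - (k + 1)) (by omega) hst
      rwa [show n - (k + 1) + 2 = n - k + 1 by omega, show n - (k + 1) + 1 = n - k by omega] at this
  have hcard : ∀ r ≤ n + 1, r ≤ ((range n).filter (S r)).card := by
    intro r
    induction r with
    | zero => intro _; omega
    | succ r ih =>
      intro hr
      have h1 := ih (by omega)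
      have h2 : ((range n).filter (S r)).card < ((range n).filter (S (r + 1))).card := by
        refine card_lt_card ?_
        rw [ssubset_iff_of_subset]
        · have := hns (n - r) (by omega)
          rw [show n - (n - r) = r by omega] at this
          push Not at this
          obtain ⟨v, hv, hv'⟩ := this
          refine ⟨v, ?_, ?_⟩
          · simp [hlt _ hr v hv, hv]
          · simp [hv']
        · intro v
          simp only [mem_filter]
          exact fun hv => ⟨hv.1, hmono r (by omega) v hv.2⟩
      omega
  have h1 := hcard (n + 1) le_rfl
  have h2 := card_filter_le (range n) (S (n + 1))
  rw [card_range] at h2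
  omega

variable {I : Data} {al : ℕ → ℕ → ℕ → Prop} {dp : ℕ → ℕ → ℕ → ℕ → ℕ → ℕ → ℕ → Prop}

namespace Good

section Classes

variable (G : Good I al dp) {x t : ℕ} (hx : x < I.B) (ht : t < I.B)

include G

theorem ltH' {u v : ℕ} (h : I.aH u v) : v < I.h := G.ltH (G.symmH h)

theorem ltG' {u v : ℕ} (h : I.aG u v) : v < I.g := G.ltG (G.symmG h)

include hx ht

theorem conn_lt {r y z : ℕ} (hr : r < I.B) (h : I.conn r x t y z) : y < I.h ∧ z < I.h := by
  induction r generalizing z with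
  | zero => obtain ⟨rfl, hy⟩ := (G.conn_zero hx ht).1 h; exact ⟨hy, hy⟩
  | succ r ih =>
    rcases (G.conn_succ hx ht hr).1 h with h | ⟨w, h, hw, _⟩
    · exact ih (by omega) h
    · exact ⟨(ih (by omega) h).1, G.ltH' hw⟩

theorem conn_refl {y : ℕ} (hy : y < I.h) {r : ℕ} (hr : r < I.B) : I.conn r x t y y := by
  induction r with
  | zero => exact (G.conn_zero hx ht).2 ⟨rfl, hy⟩
  | succ r ih => exact (G.conn_succ hx ht hr).2 (.inl (ih (by omega)))

/-- A class has at most `h` vertices, so round `h + 1` adds nothing to round `h`. -/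
theorem conn_step {y w z : ℕ} (h : I.conn I.h x t y w) (hw : I.aH w z) (h1 : w ≠ x) (h2 : w ≠ t)
    (h3 : z ≠ x) (h4 : z ≠ t) : I.conn I.h x t y z := by
  have hB := G.h_lt
  refine stable_of_increasing (n := I.h) (S := fun r v => I.conn r x t y v)
    (fun r hr v hv => (G.conn_succ hx ht (by omega)).2 (.inl hv))
    (fun r hr v hv => (G.conn_lt hx ht (by omega) hv).2) ?_ z
    ((G.conn_succ hx ht (by omega)).2 (.inr ⟨w, h, hw, ⟨h1, h2⟩, h3, h4⟩))
  intro r hr hst v hv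
  rcases (G.conn_succ hx ht (by omega)).1 hv with hv | ⟨u, hu, h'⟩
  · exact hv
  · exact (G.conn_succ hx ht (by omega)).2 (.inr ⟨u, hst u hu, h'⟩)

/-- A set of vertices closed under the edges not at `x` or `t` is closed under `conn`. -/
theorem conn_closed {U : ℕ → Prop} (hU : ∀ y z, I.aH y z → y ≠ x → y ≠ t → z ≠ x → z ≠ t → U y → U z)
    {r y z : ℕ} (hr : r < I.B) (h : I.conn r x t y z) (hy : U y) : U z := by
  induction r generalizing z with
  | zero => obtain ⟨rfl, _⟩ := (G.conn_zero hx ht).1 h; exact hy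
  | succ r ih =>
    rcases (G.conn_succ hx ht hr).1 h with h | ⟨w, h, hw, ⟨h1, h2⟩, h3, h4⟩
    · exact ih (by omega) h
    · exact hU w z hw h1 h2 h3 h4 (ih (by omega) h)

theorem conn_symm {y z : ℕ} (h : I.conn I.h x t y z) : I.conn I.h x t z y := by
  have hB := G.h_lt
  have hy := (G.conn_lt hx ht (by omega) h).1
  refine G.conn_closed hx ht (U := fun z => I.conn I.h x t z y) ?_ (by omega) h
    (G.conn_refl hx ht hy (by omega))
  intro u v huv h1 h2 h3 h4 hu
  have hv := G.ltH' huv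
  have : I.conn I.h x t v u := G.conn_step hx ht (G.conn_refl hx ht hv (by omega)) (G.symmH huv)
    h3 h4 h1 h2
  exact G.conn_closed hx ht (U := fun y => I.conn I.h x t v y)
    (fun a b hab e1 e2 e3 e4 ha => G.conn_step hx ht ha hab e1 e2 e3 e4) (by omega) hu this

theorem conn_trans {u y z : ℕ} (h : I.conn I.h x t u y) (h' : I.conn I.h x t y z) :
    I.conn I.h x t u z := by
  have hB := G.h_lt
  exact G.conn_closed hx ht (U := fun y => I.conn I.h x t u y)
    (fun a b hab e1 e2 e3 e4 ha => G.conn_step hx ht ha hab e1 e2 e3 e4) (by omega) h' h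

theorem rep_iff {z : ℕ} : Rep I x t z ↔ z < I.h ∧ ∀ w, I.conn I.h x t z w → z ≤ w := by
  have hB := G.h_lt
  refine and_congr_right fun _ => ⟨fun h w hw => h w ?_ hw, fun h w _ hw => h w hw⟩
  have := (G.conn_lt hx ht (by omega) hw).2
  omega

/-- The representative is the least vertex of the class; the last clause turns the condition in
`cidx` into a comparison with it. -/
theorem exists_rep {y : ℕ} (hy : y < I.h) : ∃ r, I.conn I.h x t y r ∧ Rep I x t r ∧
    ∀ z, (∀ w < I.B, I.conn I.h x t y w → z < w) ↔ z < r := by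
  classical
  have hB := G.h_lt
  have hex : ∃ r, I.conn I.h x t y r := ⟨y, G.conn_refl hx ht hy (by omega)⟩
  have hr := Nat.find_spec hex
  have hlt := (G.conn_lt hx ht (by omega) hr).2
  refine ⟨Nat.find hex, hr, (G.rep_iff hx ht).2 ⟨hlt, fun w hw => ?_⟩, fun z => ?_⟩
  · exact Nat.find_min' hex (G.conn_trans hx ht hr hw)
  · exact ⟨fun h => h _ (by omega) hr, fun h w _ hw => h.trans_le (Nat.find_min' hex hw)⟩

omit G hx ht in
open Classical in
theorem cidx_eq_card {y r : ℕ} (hr : ∀ z, (∀ w < I.B, I.conn I.h x t y w → z < w) ↔ z < r) :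
    cidx I x t y = ((range I.B).filter fun z => Rep I x t z ∧ z < r).card := by
  unfold cidx
  rw [card_filter]
  exact sum_congr rfl fun z _ => by simp only [hr]

/-- The index counts the representatives below the one of the class, so it is strictly increasing in
the representative and separates classes. -/
theorem conn_of_cidx_eq {y y' : ℕ} (hy : y < I.h) (hy' : y' < I.h)
    (h : cidx I x t y = cidx I x t y') : I.conn I.h x t y y' := by
  classical
  obtain ⟨r, hr, hrep, hlt⟩ := G.exists_rep hx ht hy
  obtain ⟨r', hr', hrep', hlt'⟩ := G.exists_rep hx ht hy'
  rw [cidx_eq_card hlt, cidx_eq_card hlt'] at h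
  have key : ∀ {a a' : ℕ}, Rep I x t a → a < a' →
      ((range I.B).filter fun z => Rep I x t z ∧ z < a).card <
        ((range I.B).filter fun z => Rep I x t z ∧ z < a').card := by
    intro a a' ha haa
    have hB := G.h_lt
    have := ha.1
    refine card_lt_card ((ssubset_iff_of_subset ?_).2 ⟨a, ?_, ?_⟩)
    · intro z
      simp only [mem_filter]
      exact fun hz => ⟨hz.1, hz.2.1, hz.2.2.trans haa⟩
    · simp only [mem_filter, mem_range]
      exact ⟨by omega, ha, haa⟩
    · simp
  have : r = r' := by
    rcases lt_trichotomy r r' with hl | he | hl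
    · have := key hrep hl; omega
    · exact he
    · have := key hrep' hl; omega
  subst this
  exact G.conn_trans hx ht hr (G.conn_symm hx ht hr')

open Classical in
theorem cidx_lt {y : ℕ} (hy : y < I.h) :
    cidx I x t y < ((range I.B).filter (Rep I x t)).card := by
  obtain ⟨r, hr, hrep, hlt⟩ := G.exists_rep hx ht hy
  have hB := G.h_lt
  have := hrep.1
  rw [cidx_eq_card hlt]
  refine card_lt_card ((ssubset_iff_of_subset ?_).2 ⟨r, ?_, ?_⟩)
  · intro z
    simp only [mem_filter]
    exact fun hz => ⟨hz.1, hz.2.1⟩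
  · simp only [mem_filter, mem_range]
    exact ⟨by omega, hrep⟩
  · simp

open Classical in
/-- Deleting the edges at two vertices of degree at most two creates at most six new components. -/
theorem card_rep_le (hdeg : ∀ y, ∃ n₁ n₂, ∀ z, I.aH y z → z = n₁ ∨ z = n₂) :
    ((range I.B).filter (Rep I x t)).card ≤ ((range I.B).filter (Rep I I.h I.h)).card + 6 := by
  have hB := G.h_lt
  have hh : I.h < I.B := by omega
  obtain ⟨n₁, n₂, hn⟩ := hdeg x
  obtain ⟨n₃, n₄, hn'⟩ := hdeg t
  have hrep : ∀ y, ∃ r, y < I.h → I.conn I.h x t y r ∧ Rep I x t r := by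
    intro y
    by_cases hy : y < I.h
    · obtain ⟨r, h1, h2, _⟩ := G.exists_rep hx ht hy
      exact ⟨r, fun _ => ⟨h1, h2⟩⟩
    · exact ⟨0, fun h => absurd h hy⟩
  choose rp hrp using hrep
  -- The two vertices and their at most four neighbours. A component avoiding all six touches no
  -- deleted edge, so it is a component of H with the same least vertex.
  set E : Finset ℕ := {x, t, n₁, n₂, n₃, n₄} with hE
  have hsub : (range I.B).filter (Rep I x t) ⊆ (range I.B).filter (Rep I I.h I.h) ∪ E.image rp := by
    intro r hr
    rw [mem_filter] at hr
    rw [mem_union, mem_image, or_iff_not_imp_right]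
    intro hno
    rw [mem_filter]
    refine ⟨hr.1, (G.rep_iff hh hh).2 ⟨hr.2.1, fun w hw => ?_⟩⟩
    have hE' : ∀ y, I.conn I.h x t r y → y ∉ E := by
      intro y hy hyE
      refine hno ⟨y, hyE, ?_⟩
      have hy' := (G.conn_lt hx ht (by omega) hy).2
      obtain ⟨h1, h2⟩ := hrp y hy'
      have h3 := G.conn_trans hx ht hy h1
      exact le_antisymm (((G.rep_iff hx ht).1 h2).2 _ (G.conn_symm hx ht h3))
        (((G.rep_iff hx ht).1 hr.2).2 _ h3)
    refine ((G.rep_iff hx ht).1 hr.2).2 w ?_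
    refine G.conn_closed hh hh (U := fun w => I.conn I.h x t r w) ?_ hh hw
      (G.conn_refl hx ht hr.2.1 hh)
    intro y z hyz _ _ _ _ hy
    have hyE := hE' y hy
    simp only [hE, mem_insert, mem_singleton, not_or] at hyE
    refine G.conn_step hx ht hy hyz hyE.1 hyE.2.1 ?_ ?_
    · rintro rfl
      have := hn y (G.symmH hyz)
      tauto
    · rintro rfl
      have := hn' y (G.symmH hyz)
      tauto
  calc _ ≤ _ := card_le_card hsub
    _ ≤ _ := card_union_le _ _
    _ ≤ _ := Nat.add_le_add_left (card_image_le.trans (card_le_six)) _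

omit hx ht in
theorem digit_iff {m j : ℕ} (hm : m < I.B) (hj : j < I.B) : Digit I m j ↔ m.testBit j := by
  constructor
  · rintro ⟨i, hi, rfl, h⟩
    exact (G.bit_iff hi hm).1 h
  · intro h
    exact ⟨j, hj, rfl, (G.bit_iff hj hm).2 h⟩

/-- Every union of components is coded by a mask. -/
theorem exists_mask {J : ℕ} (hJ : 2 ^ J ≤ I.B)
    (hcard : ∀ y < I.h, cidx I x t y < J) {U : ℕ → Prop} (hU : ∀ y, U y → y < I.h)
    (hcl : ∀ y z, I.aH y z → y ≠ x → y ≠ t → z ≠ x → z ≠ t → U y → U z) :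
    ∃ m < I.B, ∀ y, Mem I x t m y ↔ U y := by
  classical
  have hB := G.h_lt
  -- Digit `j` tells whether the class with index `j` meets `U`. As `U` is closed, a class that
  -- meets it is contained in it.
  refine ⟨Nat.ofBits fun j : Fin J => decide (∃ y, U y ∧ cidx I x t y = j),
    (Nat.ofBits_lt_two_pow _).trans_le hJ, fun y => ?_⟩
  have hm := (Nat.ofBits_lt_two_pow fun j : Fin J => decide (∃ y, U y ∧ cidx I x t y = j)).trans_le hJ
  by_cases hy : y < I.h
  · have hc := hcard y hy
    rw [Mem, G.digit_iff hm ((hc.trans Nat.lt_two_pow_self).trans_le hJ),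
      Nat.testBit_ofBits_lt _ _ hc]
    simp only [hy, true_and, decide_eq_true_eq]
    constructor
    · rintro ⟨z, hz, he⟩
      exact G.conn_closed hx ht hcl (by omega) (G.conn_of_cidx_eq hx ht (hU z hz) hy he) hz
    · intro h
      exact ⟨y, h, rfl⟩
  · exact ⟨fun h => absurd h.1 hy, fun h => absurd (hU y h) hy⟩

end Classes

end Good

end Elim

/-! ### The elimination process and soundness -/

namespace Elim

open Finset RAM

variable {I : Data} {al : ℕ → ℕ → ℕ → Prop} {dp : ℕ → ℕ → ℕ → ℕ → ℕ → ℕ → ℕ → Prop}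

namespace Good

variable (G : Good I al dp)

include G

theorem al_lt {s b v : ℕ} (hb : b < I.B) (hs : s < I.B) (h : al s b v) : v < I.g := by
  induction s with
  | zero => exact (G.al_zero hb).1 h
  | succ s ih => exact ih (by omega) ((G.al_succ hb hs).1 h).1

omit G in
theorem pick_al {s b v : ℕ} (h : Pick I al s b v) : al s b v := by
  rcases h with ⟨h, _⟩ | ⟨_, h, _⟩
  · exact h.1
  · exact h

theorem pick_lt {s b v : ℕ} (hb : b < I.B) (hs : s < I.B) (h : Pick I al s b v) : v < I.g :=
  G.al_lt hb hs (pick_al h)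

theorem pick_unique {s b v v' : ℕ} (hb : b < I.B) (hs : s < I.B) (h : Pick I al s b v)
    (h' : Pick I al s b v') : v = v' := by
  have hB := G.g_lt
  have h1 := G.pick_lt hb hs h
  have h2 := G.pick_lt hb hs h'
  rcases h with ⟨hl, hm⟩ | ⟨hl, ha, hm⟩ <;> rcases h' with ⟨hl', hm'⟩ | ⟨hl', ha', hm'⟩
  · rcases lt_trichotomy v v' with hlt | he | hlt
    · exact absurd hl (hm' v (by omega) hlt)
    · exact he
    · exact absurd hl' (hm v' (by omega) hlt)
  · exact absurd hl (hl' v (by omega))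
  · exact absurd hl' (hl v' (by omega))
  · rcases lt_trichotomy v v' with hlt | he | hlt
    · exact absurd ha (hm' v (by omega) hlt)
    · exact he
    · exact absurd ha' (hm v' (by omega) hlt)

omit G in
theorem exists_pick {s b : ℕ} (h : ∃ v, al s b v) :
    ∃ v, Pick I al s b v := by
  classical
  by_cases hl : ∃ v, Low I al s b v
  · exact ⟨Nat.find hl, .inl ⟨Nat.find_spec hl, fun u _ hu => Nat.find_min hl hu⟩⟩
  · push Not at hl
    exact ⟨Nat.find h, .inr ⟨fun u _ => hl u, Nat.find_spec h, fun u _ hu => Nat.find_min h hu⟩⟩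

theorem adj'_symm {b u v : ℕ} (h : Adj' I b u v) : Adj' I b v u := ⟨G.symmG h.1, h.2.2, h.2.1⟩

theorem parent_unique {s b v q q' : ℕ} (h : Parent I al s b v q)
    (h' : Parent I al s b v q') : q = q' := by
  have hB := G.g_lt
  rcases h with ⟨hg, ha, hq, hm⟩ | ⟨hg, hm⟩ <;> rcases h' with ⟨hg', ha', hq', hm'⟩ | ⟨hg', hm'⟩
  · rcases lt_trichotomy q q' with hlt | he | hlt
    · exact absurd ⟨ha, hq⟩ (hm' q (by omega) hlt)
    · exact he
    · exact absurd ⟨ha', hq'⟩ (hm q' (by omega) hlt)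
  · exact absurd ⟨ha, hq⟩ (hm' q (by omega))
  · exact absurd ⟨ha', hq'⟩ (hm q' (by omega))
  · omega

theorem exists_parent {s b : ℕ} (hb : b < I.B) (hs : s < I.B) (v : ℕ) :
    ∃ q, Parent I al s b v q := by
  classical
  by_cases h : ∃ q, al s b q ∧ Adj' I b v q
  · have hq := Nat.find_spec h
    exact ⟨Nat.find h, .inl ⟨G.al_lt hb hs hq.1, hq.1, hq.2, fun u _ hu => Nat.find_min h hu⟩⟩
  · push Not at h
    exact ⟨I.g, .inr ⟨rfl, fun u _ hu => h u hu.1 hu.2⟩⟩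

theorem parent_ne {s b v q : ℕ} (hv : v < I.g) (h : Parent I al s b v q) : q ≠ v := by
  rcases h with ⟨_, _, h, _⟩ | ⟨rfl, _⟩
  · exact (G.neG h.1).symm
  · omega

omit G in
theorem parent_le {s b v q : ℕ} (h : Parent I al s b v q) : q ≤ I.g := by
  rcases h with ⟨h, _⟩ | ⟨h, _⟩ <;> omega

end Good

open Classical in
/-- The vertex to which the block of `u` belongs at time `s`. -/
noncomputable def root (I : Data) (al : ℕ → ℕ → ℕ → Prop) (b : ℕ) : ℕ → ℕ → ℕ
  | 0, u => u
  | s + 1, u => if Pick I al s b (root I al b s u)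
      then Classical.epsilon (Parent I al s b (root I al b s u)) else root I al b s u

namespace Good

variable (G : Good I al dp)

include G

theorem root_succ {s b v q : ℕ} (hb : b < I.B) (hs : s < I.B) (hv : Pick I al s b v)
    (hq : Parent I al s b v q) (u : ℕ) :
    root I al b (s + 1) u = if root I al b s u = v then q else root I al b s u := by
  rw [root]
  by_cases h : root I al b s u = v
  · rw [if_pos h, h, if_pos hv]
    exact G.parent_unique (Classical.epsilon_spec (p := Parent I al s b v) ⟨q, hq⟩) hq
  · rw [if_neg h, if_neg]
    intro h'
    exact h (G.pick_unique hb hs h' hv)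

theorem mem_lt {x t m y : ℕ} (h : Mem I x t m y) : y < I.B := by
  have := G.h_lt
  have := h.1
  omega

/-- Every entry of the table comes from an embedding of a part of `H` into a block. -/
theorem sound {s b p x t a m : ℕ} (h : dp s b p x t a m) :
    ∃ η : ℕ → ℕ, (∀ y, Mem I x t m y → η y < I.g ∧ root I al b s (η y) = p) ∧
      (∀ y z, Mem I x t m y → Mem I x t m z → η y = η z → y = z) ∧
      (∀ y z, Mem I x t m y → Mem I x t m z → I.aH y z → I.aG (η y) (η z)) ∧
      (Mem I x t m x → η x = p) ∧ (Mem I x t m t → η t = a) := by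
  induction s generalizing p x t a m with
  | zero =>
    obtain ⟨_, hb, hp, hx, ht, ha, hm⟩ := G.dp_lt h
    obtain ⟨hpg, h1, h2⟩ := (G.dp_zero hb hp hx ht ha hm).1 h
    have h1' : ∀ y, Mem I x t m y → y = x ∧ p < I.g := fun y hy => h1 y (G.mem_lt hy) hy
    refine ⟨fun _ => p, fun y hy => ⟨(h1' y hy).2, rfl⟩, fun y z hy hz _ => ?_,
      fun y z hy hz hyz => ?_, fun _ => rfl, fun htm => (h2 htm).symm⟩
    · rw [(h1' y hy).1, (h1' z hz).1]
    · exact absurd ((h1' y hy).1.trans (h1' z hz).1.symm) (G.neH hyz)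
  | succ s ih =>
    obtain ⟨hs, hb, hp, hx, ht, ha, hm⟩ := G.dp_lt h
    obtain ⟨v, hv, q, hq, ⟨hpick, hpar⟩, ⟨rfl, hmer⟩ | ⟨hpq, hpv, hcopy⟩⟩ :=
      (G.dp_succ hs hb hp hx ht ha hm).1 h
    · have hpv := G.parent_ne (G.pick_lt hb (by omega) hpick) hpar
      have hroot := G.root_succ hb (by omega) hpick hpar
      obtain ⟨x₁, _, t₁, _, a₁, _, m₁, _, t₂, _, a₂, _, m₂, _, hd₁, hd₂, hU, hE, hX, hT⟩ := hmer
      obtain ⟨η₁, hr₁, hi₁, he₁, hx₁, ht₁⟩ := ih hd₁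
      obtain ⟨η₂, hr₂, hi₂, he₂, hx₂, ht₂⟩ := ih hd₂
      have hU' : ∀ y, Mem I x t m y ↔ Mem I x₁ t₁ m₁ y ∨ Mem I x t₂ m₂ y := by
        intro y
        by_cases hy : y < I.B
        · exact (hU y hy).1
        · refine ⟨fun h => absurd (G.mem_lt h) hy, ?_⟩
          rintro (h | h) <;> exact absurd (G.mem_lt h) hy
      have hD : ∀ y, Mem I x₁ t₁ m₁ y → ¬ Mem I x t₂ m₂ y :=
        fun y h1 h2 => (hU y (G.mem_lt h1)).2 ⟨h1, h2⟩
      -- A located vertex is the label of a root or a tag, and the induction hypothesis fixes the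
      -- images of both.
      have hL₁ : ∀ {y w}, Located I x₁ v t₁ a₁ m₁ y w → η₁ y = w := by
        rintro y w ⟨hm, ⟨rfl, rfl⟩ | ⟨rfl, rfl⟩⟩
        exacts [hx₁ hm, ht₁ hm]
      have hL₂ : ∀ {y w}, Located I x p t₂ a₂ m₂ y w → η₂ y = w := by
        rintro y w ⟨hm, ⟨rfl, rfl⟩ | ⟨rfl, rfl⟩⟩
        exacts [hx₂ hm, ht₂ hm]
      classical
      set η : ℕ → ℕ := fun y => if Mem I x₁ t₁ m₁ y then η₁ y else η₂ y with hη
      have e₁ : ∀ y, Mem I x₁ t₁ m₁ y → η y = η₁ y := fun y h => if_pos h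
      have e₂ : ∀ y, Mem I x t₂ m₂ y → η y = η₂ y := fun y h => if_neg fun h' => hD y h' h
      -- Images in the two blocks have the different roots `v` and `p`, so injectivity survives the
      -- merge.
      have hne : ∀ y z, Mem I x₁ t₁ m₁ y → Mem I x t₂ m₂ z → η₁ y ≠ η₂ z := by
        intro y z hy hz h
        have := (hr₁ y hy).2
        rw [h, (hr₂ z hz).2] at this
        exact hpv this
      have hcross : ∀ y z, Mem I x₁ t₁ m₁ y → Mem I x t₂ m₂ z → I.aH y z → I.aG (η₁ y) (η₂ z) := by
        intro y z hy hz hyz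
        obtain ⟨w, _, w', _, hw, hw', hww⟩ := hE y (G.mem_lt hy) z (G.mem_lt hz) ⟨hy, hz, hyz⟩
        rwa [hL₁ hw, hL₂ hw']
      refine ⟨η, ?_, ?_, ?_, ?_, ?_⟩
      · intro y hy
        rcases (hU' y).1 hy with hy | hy
        · rw [e₁ y hy, hroot, if_pos (hr₁ y hy).2]
          exact ⟨(hr₁ y hy).1, rfl⟩
        · rw [e₂ y hy, hroot, if_neg (by rw [(hr₂ y hy).2]; exact hpv)]
          exact hr₂ y hy
      · intro y z hy hz h
        rcases (hU' y).1 hy with hy | hy <;> rcases (hU' z).1 hz with hz | hz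
        · rw [e₁ y hy, e₁ z hz] at h
          exact hi₁ y z hy hz h
        · rw [e₁ y hy, e₂ z hz] at h
          exact absurd h (hne y z hy hz)
        · rw [e₂ y hy, e₁ z hz] at h
          exact absurd h.symm (hne z y hz hy)
        · rw [e₂ y hy, e₂ z hz] at h
          exact hi₂ y z hy hz h
      · intro y z hy hz hyz
        rcases (hU' y).1 hy with hy | hy <;> rcases (hU' z).1 hz with hz | hz
        · rw [e₁ y hy, e₁ z hz]
          exact he₁ y z hy hz hyz
        · rw [e₁ y hy, e₂ z hz]
          exact hcross y z hy hz hyz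
        · rw [e₂ y hy, e₁ z hz]
          exact G.symmG (hcross z y hz hy (G.symmH hyz))
        · rw [e₂ y hy, e₂ z hz]
          exact he₂ y z hy hz hyz
      · intro hxm
        have hx2 := ((hU' x).1 hxm).resolve_left hX
        rw [e₂ x hx2, hx₂ hx2]
      · intro htm
        rcases hT htm with hl | hl
        · rw [e₁ t hl.1, hL₁ hl]
        · rw [e₂ t hl.1, hL₂ hl]
    · obtain ⟨η, hr, hrest⟩ := ih hcopy
      refine ⟨η, fun y hy => ⟨(hr y hy).1, ?_⟩, hrest⟩
      rw [G.root_succ hb (by omega) hpick hpar, (hr y hy).2, if_neg hpv]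

end Good

end Elim

/-! ### The shape of the graph of blocks -/

namespace Elim

open Finset RAM

variable {I : Data} {al : ℕ → ℕ → ℕ → Prop} {dp : ℕ → ℕ → ℕ → ℕ → ℕ → ℕ → ℕ → Prop}

/-- Being an alive neighbour. -/
def Nb (I : Data) (al : ℕ → ℕ → ℕ → Prop) (b s w u : ℕ) : Prop := al s b u ∧ Adj' I b w u

/-- All edges between different blocks join their roots. -/
def Untagged (I : Data) (al : ℕ → ℕ → ℕ → Prop) (b s : ℕ) : Prop :=
  ∀ u u', Adj' I b u u' → root I al b s u ≠ root I al b s u' → u = root I al b s u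

/-- All edges between different blocks join their roots, except for one edge between the tags of the
blocks `P` and `Q`; the alive vertices form paths and cycles, `P` and `Q` being the ends of a path. -/
structure Tagged (I : Data) (al : ℕ → ℕ → ℕ → Prop) (b s : ℕ) (τ : ℕ → ℕ) (P Q : ℕ) : Prop where
  ne : P ≠ Q
  alP : al s b P
  alQ : al s b Q
  id : ∀ p, p ≠ P → p ≠ Q → τ p = p
  rootP : root I al b s (τ P) = P
  rootQ : root I al b s (τ Q) = Q
  leP : τ P < I.g
  leQ : τ Q < I.g
  cross : ∀ u u', Adj' I b u u' → root I al b s u ≠ root I al b s u' →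
    (u = root I al b s u ∧ u' = root I al b s u') ∨
    (root I al b s u = P ∧ root I al b s u' = Q ∧ u = τ P ∧ u' = τ Q) ∨
    (root I al b s u = Q ∧ root I al b s u' = P ∧ u = τ Q ∧ u' = τ P)
  degP : ∃ u, Nb I al b s P u ∧ ∀ u', Nb I al b s P u' → u' = u
  degQ : ∃ u, Nb I al b s Q u ∧ ∀ u', Nb I al b s Q u' → u' = u
  deg : ∀ w, al s b w → w ≠ P → w ≠ Q → (∀ u, ¬ Nb I al b s w u) ∨
    ∃ u u', u ≠ u' ∧ Nb I al b s w u ∧ Nb I al b s w u' ∧ ∀ z, Nb I al b s w z → z = u ∨ z = u'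

theorem Tagged.symm {b s P Q : ℕ} {τ : ℕ → ℕ} (h : Tagged I al b s τ P Q) :
    Tagged I al b s τ Q P where
  ne := h.ne.symm
  alP := h.alQ
  alQ := h.alP
  id p h1 h2 := h.id p h2 h1
  rootP := h.rootQ
  rootQ := h.rootP
  leP := h.leQ
  leQ := h.leP
  cross u u' h1 h2 := by rcases h.cross u u' h1 h2 with h | h | h <;> tauto
  degP := h.degQ
  degQ := h.degP
  deg w hw h1 h2 := h.deg w hw h2 h1

/-- The possible shapes of the graph of blocks. -/
def Shape (I : Data) (al : ℕ → ℕ → ℕ → Prop) (b s : ℕ) (τ : ℕ → ℕ) : Prop :=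
  ((∀ p, τ p = p) ∧ Untagged I al b s) ∨ ∃ P Q, Tagged I al b s τ P Q

namespace Good

variable (G : Good I al dp)

include G

theorem root_al {s b u : ℕ} (hb : b < I.B) (hs : s < I.B) (hu : u ≤ I.g) :
    al s b (root I al b s u) ∨ root I al b s u = I.g := by
  induction s with
  | zero =>
    rw [root, G.al_zero hb]
    omega
  | succ s ih =>
    by_cases hp : Pick I al s b (root I al b s u)
    · obtain ⟨q, hq⟩ := G.exists_parent (s := s) hb (by omega) (root I al b s u)
      rw [G.root_succ hb (by omega) hp hq, if_pos rfl]
      rcases id hq with ⟨_, ha, _⟩ | ⟨h, _⟩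
      · refine .inl ((G.al_succ hb hs).2 ⟨ha, fun h => ?_⟩)
        exact G.parent_ne (G.pick_lt hb (by omega) hp) hq (G.pick_unique hb (by omega) h hp)
      · exact .inr h
    · rw [root, if_neg hp]
      rcases ih (by omega) with h | h
      · exact .inl ((G.al_succ hb hs).2 ⟨h, hp⟩)
      · exact .inr h

theorem root_self {s b v : ℕ} (hb : b < I.B) (hs : s < I.B) (hv : al s b v) :
    root I al b s v = v := by
  induction s with
  | zero => rfl
  | succ s ih =>
    obtain ⟨h1, h2⟩ := (G.al_succ hb hs).1 hv
    rw [root, ih (by omega) h1, if_neg h2]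

theorem root_g {s b : ℕ} (hb : b < I.B) (hs : s < I.B) : root I al b s I.g = I.g := by
  induction s with
  | zero => rfl
  | succ s ih =>
    rw [root, ih (by omega), if_neg]
    intro h
    exact lt_irrefl _ (G.pick_lt hb (by omega) h)

open Classical in
-- As long as a vertex is alive, exactly one is eliminated per step; so none is left at time `g`.
theorem card_al {s b : ℕ} (hb : b < I.B) (hs : s ≤ I.g) :
    ((range I.g).filter (al s b)).card + s = I.g := by
  have hB := G.g_lt
  induction s with
  | zero =>
    have : (range I.g).filter (al 0 b) = range I.g := by
      ext v
      simp [G.al_zero hb]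
    rw [this, card_range, add_zero]
  | succ s ih =>
    have h1 := ih (by omega)
    have hne : ((range I.g).filter (al s b)).Nonempty := by
      rw [← card_pos]; omega
    obtain ⟨v, hv⟩ := exists_pick (I := I) (hne.imp fun v hv => (mem_filter.1 hv).2)
    have hvl := G.pick_lt hb (by omega) hv
    have : (range I.g).filter (al (s + 1) b) = ((range I.g).filter (al s b)).erase v := by
      ext u
      simp only [mem_filter, mem_erase, mem_range, G.al_succ hb (show s + 1 < I.B by omega)]
      constructor
      · rintro ⟨hu, ha, hp⟩
        exact ⟨fun h => hp (h ▸ hv), hu, ha⟩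
      · rintro ⟨hne, hu, ha⟩
        exact ⟨hu, ha, fun hp => hne (G.pick_unique hb (by omega) hp hv)⟩
    have hc := card_erase_of_mem (mem_filter.2 ⟨mem_range.2 hvl, pick_al hv⟩)
    rw [this, hc]
    have := card_pos.2 hne
    omega

theorem exists_al {s b : ℕ} (hb : b < I.B) (hs : s < I.g) : ∃ v, al s b v := by
  classical
  have h := G.card_al hb hs.le
  have hne : ((range I.g).filter (al s b)).Nonempty := by
    rw [← card_pos]; omega
  exact hne.imp fun v hv => (mem_filter.1 hv).2

theorem not_al {b v : ℕ} (hb : b < I.B) : ¬ al I.g b v := by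
  classical
  intro hv
  have hB := G.g_lt
  have h := G.card_al hb le_rfl
  have := card_pos.2 ⟨v, mem_filter.2 ⟨mem_range.2 (G.al_lt hb (by omega) hv), hv⟩⟩
  omega

section Step

variable {s b v q : ℕ} (hb : b < I.B) (hs : s + 1 < I.B) (hv : Pick I al s b v)
  (hq : Parent I al s b v q)

include hb hs hv hq

omit hv in
theorem nb_parent {u : ℕ} (hu : Nb I al b s v u) : Nb I al b s v q := by
  have hB := G.g_lt
  rcases hq with ⟨_, h1, h2, _⟩ | ⟨_, h⟩
  · exact ⟨h1, h2⟩
  · have := G.al_lt hb (by omega) hu.1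
    exact absurd hu (h u (by omega))

omit hq in
theorem al_succ_of_ne {u : ℕ} (hu : al s b u) (hne : u ≠ v) : al (s + 1) b u :=
  (G.al_succ hb hs).2 ⟨hu, fun h => hne (G.pick_unique hb (by omega) h hv)⟩

omit hq in
theorem nb_succ_iff {w u : ℕ} : Nb I al b (s + 1) w u ↔ Nb I al b s w u ∧ u ≠ v := by
  unfold Nb
  rw [G.al_succ hb hs]
  constructor
  · rintro ⟨⟨h1, h2⟩, h3⟩
    exact ⟨⟨h1, h3⟩, fun h => h2 (h ▸ hv)⟩
  · rintro ⟨⟨h1, h3⟩, h2⟩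
    exact ⟨⟨h1, fun h => h2 (G.pick_unique hb (by omega) h hv)⟩, h3⟩

omit hs hv hq in
theorem al_of_root_eq (hs : s < I.B) {u u' : ℕ} (h : Adj' I b u u') (hu : u = root I al b s u) :
    al s b u := by
  have h1 := G.ltG h.1
  rcases G.root_al (s := s) hb hs h1.le with h2 | h2
  · rwa [← hu] at h2
  · omega

/-- Eliminating a vertex with at most one alive neighbour creates no tags. -/
theorem untagged_succ (hl : Low I al s b v) (hU : Untagged I al b s) :
    Untagged I al b (s + 1) := by
  have hB := G.g_lt
  intro u u' huu hne
  have hroot := G.root_succ hb (by omega) hv hq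
  have hne' : root I al b s u ≠ root I al b s u' := by
    intro h
    rw [hroot, hroot, h] at hne
    exact hne rfl
  have h1 := hU u u' huu hne'
  have h2 := hU u' u (G.adj'_symm huu) hne'.symm
  have h3 := G.al_of_root_eq hb (by omega) (G.adj'_symm huu) h2
  -- If `u` lies in the block of `v`, then `u = v` and `u'` is the only alive neighbour of `v`, that
  -- is, its parent. The edge becomes internal to the merged block, contradicting `hne`.
  by_cases hr : root I al b s u = v
  · exfalso
    rw [hr] at h1
    subst h1
    have hn := G.nb_parent hb hs hq ⟨h3, huu⟩
    have := hl.2 u' (by have := G.al_lt hb (by omega) h3; omega) q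
      (by have := G.al_lt hb (by omega) hn.1; omega) ⟨h3, hn.1, huu, hn.2⟩
    subst this
    rw [hroot, hroot, if_pos hr, ← h2, if_neg (G.neG huu.1).symm] at hne
    exact hne rfl
  · rw [hroot, if_neg hr]
    exact h1

/-- Eliminating a vertex of a disjoint union of cycles creates two tags. -/
theorem tagged_of_untagged (hU : Untagged I al b s)
    (hdeg : ∀ w, al s b w → ∃ u u', u ≠ u' ∧ Nb I al b s w u ∧ Nb I al b s w u' ∧
      ∀ z, Nb I al b s w z → z = u ∨ z = u') :
    ∃ w, Tagged I al b (s + 1) (Function.update id q v) q w := by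
  have hB := G.g_lt
  have hva := pick_al hv
  have hroot := G.root_succ hb (by omega) hv hq
  have hsym : ∀ {u u'}, al s b u → Nb I al b s u u' → Nb I al b s u' u :=
    fun hu h => ⟨hu, G.adj'_symm h.2⟩
  have hqn : Nb I al b s v q := by
    obtain ⟨u, u', _, hu, _⟩ := hdeg v hva
    exact G.nb_parent hb hs hq hu
  -- `w` is the other neighbour of `v` on its cycle. After the merge the edge from `v` to `w` leaves
  -- the block of `q` at `v`, which becomes the tag of `q`; the cycle has turned into a path from
  -- `q` to `w`.
  obtain ⟨w, hwq, hwn, hall⟩ : ∃ w, w ≠ q ∧ Nb I al b s v w ∧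
      ∀ z, Nb I al b s v z → z = q ∨ z = w := by
    obtain ⟨u, u', hne, hu, hu', hall⟩ := hdeg v hva
    rcases hall q hqn with rfl | rfl
    · exact ⟨u', hne.symm, hu', hall⟩
    · exact ⟨u, hne, hu, fun z hz => (hall z hz).symm⟩
  have hqv : q ≠ v := (G.neG hqn.2.1).symm
  have hwv : w ≠ v := (G.neG hwn.2.1).symm
  have hdeg1 : ∀ p, Nb I al b s v p → ∃ u, Nb I al b (s + 1) p u ∧
      ∀ u', Nb I al b (s + 1) p u' → u' = u := by
    intro p hp
    have hvp := hsym hva hp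
    obtain ⟨u, u', hne, hu, hu', hall⟩ := hdeg p hp.1
    rcases hall v hvp with rfl | rfl
    · refine ⟨u', (G.nb_succ_iff hb hs hv).2 ⟨hu', hne.symm⟩, fun z hz => ?_⟩
      obtain ⟨h1, h2⟩ := (G.nb_succ_iff hb hs hv).1 hz
      exact (hall z h1).resolve_left h2
    · refine ⟨u, (G.nb_succ_iff hb hs hv).2 ⟨hu, hne⟩, fun z hz => ?_⟩
      obtain ⟨h1, h2⟩ := (G.nb_succ_iff hb hs hv).1 hz
      exact (hall z h1).resolve_right h2
  have eq : Function.update id q v q = v := by simp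
  have ew : Function.update id q v w = w := by simp [hwq]
  refine ⟨w, hwq.symm, G.al_succ_of_ne hb hs hv hqn.1 hqv, G.al_succ_of_ne hb hs hv hwn.1 hwv,
    fun p hp _ => by simp [hp], ?_, ?_, ?_, ?_, ?_, hdeg1 q hqn, hdeg1 w hwn, ?_⟩
  · rw [eq, hroot, if_pos (G.root_self hb (by omega) hva)]
  · rw [ew, G.root_self hb hs (G.al_succ_of_ne hb hs hv hwn.1 hwv)]
  · rw [eq]; exact G.al_lt hb (by omega) hva
  · rw [ew]; exact G.al_lt hb (by omega) hwn.1
  · intro u u' huu hne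
    rw [eq, ew]
    have hne' : root I al b s u ≠ root I al b s u' := by
      intro h
      rw [hroot, hroot, h] at hne
      exact hne rfl
    have h1 := hU u u' huu hne'
    have h2 := hU u' u (G.adj'_symm huu) hne'.symm
    have h3 := G.al_of_root_eq hb (by omega) huu h1
    have h4 := G.al_of_root_eq hb (by omega) (G.adj'_symm huu) h2
    rw [hroot, hroot, ← h1, ← h2] at hne ⊢
    by_cases hu : u = v
    · subst hu
      rw [if_pos rfl, if_neg (G.neG huu.1).symm] at hne ⊢
      rcases hall u' ⟨h4, huu⟩ with rfl | rfl
      · exact absurd rfl hne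
      · exact .inr (.inl ⟨rfl, rfl, rfl, rfl⟩)
    · by_cases hu' : u' = v
      · subst hu'
        rw [if_neg hu, if_pos rfl] at hne ⊢
        rcases hall u ⟨h3, G.adj'_symm huu⟩ with rfl | rfl
        · exact absurd rfl hne
        · exact .inr (.inr ⟨rfl, rfl, rfl, rfl⟩)
      · rw [if_neg hu, if_neg hu']
        exact .inl ⟨rfl, rfl⟩
  · intro p hp hpq hpw
    obtain ⟨hp1, hp2⟩ := (G.al_succ hb hs).1 hp
    have hpv : p ≠ v := fun h => hp2 (h ▸ hv)
    have hnv : ¬ Nb I al b s p v := by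
      intro h
      rcases hall p (hsym hp1 h) with h | h
      · exact hpq h
      · exact hpw h
    obtain ⟨u, u', hne, hu, hu', hall'⟩ := hdeg p hp1
    refine .inr ⟨u, u', hne, (G.nb_succ_iff hb hs hv).2 ⟨hu, fun h => hnv (h ▸ hu)⟩,
      (G.nb_succ_iff hb hs hv).2 ⟨hu', fun h => hnv (h ▸ hu')⟩, fun z hz => hall' z ?_⟩
    exact ((G.nb_succ_iff hb hs hv).1 hz).1

/-- Eliminating an isolated vertex preserves the tags. -/
theorem tagged_isolated {τ : ℕ → ℕ} {P Q : ℕ} (hT : Tagged I al b s τ P Q) (hP : v ≠ P) (hQ : v ≠ Q)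
    (hiso : ∀ u, ¬ Nb I al b s v u) : Tagged I al b (s + 1) τ P Q := by
  have hva := pick_al hv
  have hroot := G.root_succ hb (by omega) hv hq
  have hnb : ∀ {w u}, al s b w → (Nb I al b (s + 1) w u ↔ Nb I al b s w u) := by
    intro w u hw
    rw [G.nb_succ_iff hb hs hv, and_iff_left_iff_imp]
    rintro h rfl
    exact hiso w ⟨hw, G.adj'_symm h.2⟩
  refine ⟨hT.ne, G.al_succ_of_ne hb hs hv hT.alP hP.symm, G.al_succ_of_ne hb hs hv hT.alQ hQ.symm,
    hT.id, ?_, ?_, hT.leP, hT.leQ, ?_, ?_, ?_, ?_⟩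
  · rw [hroot, hT.rootP, if_neg hP.symm]
  · rw [hroot, hT.rootQ, if_neg hQ.symm]
  · intro u u' huu hne
    have hne' : root I al b s u ≠ root I al b s u' := by
      intro h
      rw [hroot, hroot, h] at hne
      exact hne rfl
    have hc := hT.cross u u' huu hne'
    have h1 : root I al b s u ≠ v := by
      intro h
      rcases hc with ⟨e1, e2⟩ | ⟨e1, _⟩ | ⟨e1, _⟩
      · have := G.al_of_root_eq hb (by omega) (G.adj'_symm huu) e2
        rw [h] at e1
        exact hiso u' ⟨this, e1 ▸ huu⟩
      · exact hP (h.symm.trans e1)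
      · exact hQ (h.symm.trans e1)
    have h2 : root I al b s u' ≠ v := by
      intro h
      rcases hc with ⟨e1, e2⟩ | ⟨_, e1, _⟩ | ⟨_, e1, _⟩
      · have := G.al_of_root_eq hb (by omega) huu e1
        rw [h] at e2
        exact hiso u ⟨this, G.adj'_symm (e2 ▸ huu)⟩
      · exact hQ (h.symm.trans e1)
      · exact hP (h.symm.trans e1)
    rw [hroot, hroot, if_neg h1, if_neg h2]
    exact hc
  · simpa only [hnb hT.alP] using hT.degP
  · simpa only [hnb hT.alQ] using hT.degQ
  · intro w hw h1 h2
    have hw' := ((G.al_succ hb hs).1 hw).1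
    simpa only [hnb hw'] using hT.deg w hw' h1 h2

/-- Eliminating an end of a path moves its tag, or removes the tags if the path has only one edge. -/
theorem tagged_end {τ : ℕ → ℕ} {Q : ℕ} (hT : Tagged I al b s τ v Q) :
    (q = Q ∧ Untagged I al b (s + 1)) ∨
      Tagged I al b (s + 1) (Function.update (Function.update τ v v) q (τ v)) q Q := by
  have hB := G.g_lt
  have hva := pick_al hv
  have hroot := G.root_succ hb (by omega) hv hq
  obtain ⟨q', hq', hall⟩ := hT.degP
  have hqn : Nb I al b s v q := G.nb_parent hb hs hq hq'
  obtain rfl := hall q hqn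
  have hqv : q ≠ v := (G.neG hqn.2.1).symm
  -- An edge between roots that starts at `v` can only lead to `q` and becomes internal. So the root
  -- edges that still join different blocks avoid `v`.
  have hcase : ∀ {u u'}, Adj' I b u u' → root I al b (s + 1) u ≠ root I al b (s + 1) u' →
      u = root I al b s u → u' = root I al b s u' → root I al b s u ≠ v := by
    intro u u' huu hne e1 e2 h
    have h4 := G.al_of_root_eq hb (by omega) (G.adj'_symm huu) e2
    rw [h] at e1
    subst e1
    have := hall u' ⟨h4, huu⟩
    subst this
    rw [hroot, hroot, if_pos h, ← e2, if_neg hqv] at hne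
    exact hne rfl
  have hne2 : ∀ {u u'}, root I al b (s + 1) u ≠ root I al b (s + 1) u' →
      root I al b s u ≠ root I al b s u' := by
    intro u u' hne h
    rw [hroot, hroot, h] at hne
    exact hne rfl
  -- If the path is the single edge from `v` to `Q`, the tagged edge becomes internal and no tags
  -- remain. Otherwise the new end `q` inherits the tag of `v`, and the value at `v` is reset.
  by_cases hqQ : q = Q
  · refine .inl ⟨hqQ, fun u u' huu hne => ?_⟩
    rcases hT.cross u u' huu (hne2 hne) with ⟨e1, e2⟩ | ⟨e1, e2, _⟩ | ⟨e1, e2, _⟩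
    · rw [hroot, if_neg (hcase huu hne e1 e2)]
      exact e1
    · rw [hroot, hroot, if_pos e1, e2, if_neg hT.ne.symm] at hne
      exact absurd hqQ hne
    · rw [hroot, hroot, if_pos e2, e1, if_neg hT.ne.symm] at hne
      exact absurd hqQ.symm hne
  · set τ' : ℕ → ℕ := Function.update (Function.update τ v v) q (τ v) with hτ'
    have eq : τ' q = τ v := by simp [hτ']
    have eQ : τ' Q = τ Q := by
      rw [hτ', Function.update_of_ne (Ne.symm hqQ), Function.update_of_ne hT.ne.symm]
    have hnv : ∀ {w}, al s b w → w ≠ q → ¬ Nb I al b s w v :=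
      fun hw hwq h => hwq (hall _ ⟨hw, G.adj'_symm h.2⟩)
    have hnb : ∀ {w u}, al s b w → w ≠ q → (Nb I al b (s + 1) w u ↔ Nb I al b s w u) := by
      intro w u hw hwq
      rw [G.nb_succ_iff hb hs hv, and_iff_left_iff_imp]
      rintro h rfl
      exact hnv hw hwq h
    refine .inr ⟨hqQ, G.al_succ_of_ne hb hs hv hqn.1 hqv,
      G.al_succ_of_ne hb hs hv hT.alQ hT.ne.symm, ?_, ?_, ?_, ?_, ?_, ?_, ?_, ?_, ?_⟩
    · intro p h1 h2
      rw [hτ', Function.update_of_ne h1]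
      by_cases hp : p = v
      · rw [hp, Function.update_self]
      · rw [Function.update_of_ne hp, hT.id p hp h2]
    · rw [eq, hroot, if_pos hT.rootP]
    · rw [eQ, hroot, hT.rootQ, if_neg hT.ne.symm]
    · rw [eq]; exact hT.leP
    · rw [eQ]; exact hT.leQ
    · intro u u' huu hne
      rw [eq, eQ]
      rcases hT.cross u u' huu (hne2 hne) with ⟨e1, e2⟩ | ⟨e1, e2, e3⟩ | ⟨e1, e2, e3⟩
      · rw [hroot, hroot, if_neg (hcase huu hne e1 e2),
          if_neg (hcase (G.adj'_symm huu) hne.symm e2 e1)]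
        exact .inl ⟨e1, e2⟩
      · rw [hroot, hroot, if_pos e1, e2, if_neg hT.ne.symm]
        exact .inr (.inl ⟨rfl, rfl, e3⟩)
      · rw [hroot, hroot, if_pos e2, e1, if_neg hT.ne.symm]
        exact .inr (.inr ⟨rfl, rfl, e3⟩)
    · have hvq : Nb I al b s q v := ⟨hva, G.adj'_symm hqn.2⟩
      rcases hT.deg q hqn.1 hqv hqQ with h | ⟨u, u', hne, hu, hu', hall'⟩
      · exact absurd hvq (h v)
      · rcases hall' v hvq with rfl | rfl
        · refine ⟨u', (G.nb_succ_iff hb hs hv).2 ⟨hu', hne.symm⟩, fun z hz => ?_⟩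
          obtain ⟨h1, h2⟩ := (G.nb_succ_iff hb hs hv).1 hz
          exact (hall' z h1).resolve_left h2
        · refine ⟨u, (G.nb_succ_iff hb hs hv).2 ⟨hu, hne⟩, fun z hz => ?_⟩
          obtain ⟨h1, h2⟩ := (G.nb_succ_iff hb hs hv).1 hz
          exact (hall' z h1).resolve_right h2
    · simpa only [hnb hT.alQ (Ne.symm hqQ)] using hT.degQ
    · intro w hw h1 h2
      obtain ⟨hw', hw2⟩ := (G.al_succ hb hs).1 hw
      have hwv : w ≠ v := fun h => hw2 (h ▸ hv)
      simpa only [hnb hw' h1] using hT.deg w hw' hwv h2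

end Step

end Good

end Elim

/-! ### Preservation of the shape and completeness -/

namespace Elim

open Finset RAM

variable {I : Data} {al : ℕ → ℕ → ℕ → Prop} {dp : ℕ → ℕ → ℕ → ℕ → ℕ → ℕ → ℕ → Prop}

/-- Every set of vertices in which all vertices have at least two neighbours is a disjoint union of
cycles. -/
def Cyclic (I : Data) (b : ℕ) : Prop :=
  ∀ A : ℕ → Prop, (∀ v, A v → ∃ u w, u ≠ w ∧ (A u ∧ A w) ∧ Adj' I b v u ∧ Adj' I b v w) →
    ∀ v, A v → ∀ u w z, A u → A w → A z → Adj' I b v u → Adj' I b v w → Adj' I b v z →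
      u = w ∨ u = z ∨ w = z

namespace Good

variable (G : Good I al dp)

include G

/-- The shape of the graph of blocks is preserved by elimination. -/
theorem shape_succ {s b v q : ℕ} {τ : ℕ → ℕ} (hb : b < I.B) (hs : s + 1 < I.B)
    (hv : Pick I al s b v) (hq : Parent I al s b v q) (hc : Cyclic I b) (hS : Shape I al b s τ) :
    ∃ τ', Shape I al b (s + 1) τ' ∧ (∀ p, p ≠ q → p ≠ v → τ' p = τ p) ∧
      (τ' q = q ∨ τ' q = v ∨ τ' q = τ q ∨ τ' q = τ v) := by
  have hB := G.g_lt
  have hlow : ∀ {w}, al s b w → (∀ u, ¬ Nb I al b s w u) → Low I al s b w := by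
    intro w hw h
    exact ⟨hw, fun u _ u' _ h' => absurd ⟨h'.1, h'.2.2.1⟩ (h u)⟩
  have hlow1 : ∀ {w}, al s b w → (∃ u, Nb I al b s w u ∧ ∀ u', Nb I al b s w u' → u' = u) →
      Low I al s b w := by
    rintro w hw ⟨z, _, h⟩
    exact ⟨hw, fun u _ u' _ h' => (h u ⟨h'.1, h'.2.2.1⟩).trans (h u' ⟨h'.2.1, h'.2.2.2⟩).symm⟩
  rcases hS with ⟨hid, hU⟩ | ⟨P, Q, hT⟩
  · rcases id hv with ⟨hl, _⟩ | ⟨hnl, _, _⟩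
    · exact ⟨τ, .inl ⟨hid, G.untagged_succ hb hs hv hq hl hU⟩, fun _ _ _ => rfl,
        .inr (.inr (.inl rfl))⟩
    · have hdeg : ∀ w, al s b w → ∃ u u', u ≠ u' ∧ Nb I al b s w u ∧ Nb I al b s w u' := by
        intro w hw
        have hn := hnl w (by have := G.al_lt hb (by omega) hw; omega)
        unfold Low at hn
        push Not at hn
        obtain ⟨u, _, u', _, ⟨h1, h2, h3, h4⟩, hne⟩ := hn hw
        exact ⟨u, u', hne, ⟨h1, h3⟩, ⟨h2, h4⟩⟩
      have hdeg' : ∀ w, al s b w → ∃ u u', u ≠ u' ∧ Nb I al b s w u ∧ Nb I al b s w u' ∧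
          ∀ z, Nb I al b s w z → z = u ∨ z = u' := by
        intro w hw
        obtain ⟨u, u', hne, hu, hu'⟩ := hdeg w hw
        refine ⟨u, u', hne, hu, hu', fun z hz => ?_⟩
        -- Without a low vertex, the alive vertices form a set of minimum degree two, so `Cyclic`
        -- excludes a third neighbour.
        have := hc (al s b) (fun w hw => by
          obtain ⟨u, u', hne, hu, hu'⟩ := hdeg w hw
          exact ⟨u, u', hne, ⟨hu.1, hu'.1⟩, hu.2, hu'.2⟩) w hw u u' z hu.1 hu'.1 hz.1 hu.2 hu'.2 hz.2
        rcases this with h | h | h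
        · exact absurd h hne
        · exact .inl h.symm
        · exact .inr h.symm
      obtain ⟨w, hw⟩ := G.tagged_of_untagged hb hs hv hq hU hdeg'
      exact ⟨_, .inr ⟨q, w, hw⟩, fun p hp _ => by simp [hp, hid], .inr (.inl (by simp))⟩
  · have hPl := hlow1 hT.alP hT.degP
    -- The end `P` of the path is low, so no further cycle is opened while tags exist; `v` is then
    -- an end of the path or isolated.
    have hl : Low I al s b v := by
      rcases id hv with ⟨hl, _⟩ | ⟨hnl, _, _⟩
      · exact hl
      · exact absurd hPl (hnl P (by have := G.al_lt hb (by omega) hT.alP; omega))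
    have hend : ∀ Q, Tagged I al b s τ v Q → ∃ τ', Shape I al b (s + 1) τ' ∧
        (∀ p, p ≠ q → p ≠ v → τ' p = τ p) ∧
        (τ' q = q ∨ τ' q = v ∨ τ' q = τ q ∨ τ' q = τ v) := by
      intro Q hT
      rcases G.tagged_end hb hs hv hq hT with ⟨rfl, hU⟩ | hT'
      · exact ⟨id, .inl ⟨fun _ => rfl, hU⟩, fun p h1 h2 => (hT.id p h2 h1).symm, .inl rfl⟩
      · refine ⟨_, .inr ⟨q, Q, hT'⟩, fun p h1 h2 => ?_, .inr (.inr (.inr (by simp)))⟩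
        rw [Function.update_of_ne h1, Function.update_of_ne h2]
    by_cases hP : v = P
    · subst hP
      exact hend Q hT
    · by_cases hQ : v = Q
      · subst hQ
        exact hend P hT.symm
      · refine ⟨τ, .inr ⟨P, Q, G.tagged_isolated hb hs hv hq hT hP hQ ?_⟩, fun _ _ _ => rfl,
          .inr (.inr (.inl rfl))⟩
        rcases hT.deg v (pick_al hv) hP hQ with h | ⟨u, u', hne, hu, hu', _⟩
        · exact h
        · exact absurd (hl.2 u (by have := G.al_lt hb (by omega) hu.1; omega) u'
            (by have := G.al_lt hb (by omega) hu'.1; omega) ⟨hu.1, hu'.1, hu.2, hu'.2⟩) hne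

/-- The tag of a block belongs to it. -/
theorem shape_root {s b : ℕ} {τ : ℕ → ℕ} (hb : b < I.B) (hs : s < I.B) (hS : Shape I al b s τ)
    {p : ℕ} (hp : al s b p ∨ p = I.g) : root I al b s (τ p) = p ∧ τ p ≤ I.g := by
  have h0 : root I al b s p = p ∧ p ≤ I.g := by
    rcases hp with hp | rfl
    · exact ⟨G.root_self hb hs hp, (G.al_lt hb hs hp).le⟩
    · exact ⟨G.root_g hb hs, le_rfl⟩
  rcases hS with ⟨hid, _⟩ | ⟨P, Q, hT⟩
  · rwa [hid]
  · by_cases hP : p = P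
    · rw [hP]; exact ⟨hT.rootP, hT.leP.le⟩
    · by_cases hQ : p = Q
      · rw [hQ]; exact ⟨hT.rootQ, hT.leQ.le⟩
      · rwa [hT.id p hP hQ]

omit G in
/-- Edges leaving a block start at its root or its tag. -/
theorem shape_cross {s b : ℕ} {τ : ℕ → ℕ} (hS : Shape I al b s τ) {u u' p : ℕ}
    (h : Adj' I b u u') (hu : root I al b s u = p) (hu' : root I al b s u' ≠ p) :
    u = p ∨ u = τ p := by
  have hne : root I al b s u ≠ root I al b s u' := by rw [hu]; exact hu'.symm
  rcases hS with ⟨_, hU⟩ | ⟨P, Q, hT⟩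
  · exact .inl ((hU u u' h hne).trans hu)
  · rcases hT.cross u u' h hne with ⟨h1, _⟩ | ⟨h1, _, h2, _⟩ | ⟨h1, _, h2, _⟩
    · exact .inl (h1.trans hu)
    · rw [← hu, h1]; exact .inr h2
    · rw [← hu, h1]; exact .inr h2

end Good

/-- An embedding of `H` into the part of `G` selected by `b`. -/
structure Embeds (I : Data) (b : ℕ) (η : ℕ → ℕ) : Prop where
  lt : ∀ {y}, y < I.h → η y < I.g
  inj : ∀ {y z}, y < I.h → z < I.h → η y = η z → y = z
  adj : ∀ {y z}, I.aH y z → Adj' I b (η y) (η z)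

open Classical in
/-- The vertex of `H` mapped to `v`, and `h` if there is none. -/
noncomputable def label (I : Data) (η : ℕ → ℕ) (v : ℕ) : ℕ :=
  if h : ∃ y < I.h, η y = v then h.choose else I.h

theorem label_le (η : ℕ → ℕ) (v : ℕ) : label I η v ≤ I.h := by
  unfold label
  split_ifs with h
  · exact h.choose_spec.1.le
  · exact le_rfl

theorem apply_label {η : ℕ → ℕ} {v : ℕ} (h : label I η v < I.h) : η (label I η v) = v := by
  unfold label at h ⊢
  split_ifs at h ⊢ with h'
  · exact h'.choose_spec.2
  · exact absurd h (lt_irrefl _)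

theorem Embeds.label_apply {b y v : ℕ} {η : ℕ → ℕ} (E : Embeds I b η) (hy : y < I.h) (h : η y = v) :
    label I η v = y := by
  have h' : ∃ y < I.h, η y = v := ⟨y, hy, h⟩
  unfold label
  rw [dif_pos h']
  exact E.inj h'.choose_spec.1 hy (h'.choose_spec.2.trans h.symm)

/-- The table has an entry for the restriction of the embedding to the block of `p`. -/
def Listed (I : Data) (al : ℕ → ℕ → ℕ → Prop) (dp : ℕ → ℕ → ℕ → ℕ → ℕ → ℕ → ℕ → Prop) (b : ℕ)
    (η : ℕ → ℕ) (s : ℕ) (τ : ℕ → ℕ) (p : ℕ) : Prop :=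
  ∃ m, dp s b p (label I η p) (label I η (τ p)) (τ p) m ∧
    ∀ y, Mem I (label I η p) (label I η (τ p)) m y ↔ y < I.h ∧ root I al b s (η y) = p

namespace Good

variable (G : Good I al dp) {b J : ℕ} {η : ℕ → ℕ} (hb : b < I.B) (E : Embeds I b η)
  (hJ : 2 ^ J ≤ I.B) (hidx : ∀ x < I.B, ∀ t < I.B, ∀ y < I.h, cidx I x t y < J)

include G hb E hJ hidx

omit hb in
-- An edge of H leaving the preimage of the block is sent to an edge leaving the block, hence starts
-- at the label of the root or of the tag. The preimage is thus closed under all other edges and has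
-- a mask.
theorem exists_block_mask {s : ℕ} {τ : ℕ → ℕ} (hS : Shape I al b s τ) (p : ℕ) :
    ∃ m < I.B, ∀ y, Mem I (label I η p) (label I η (τ p)) m y ↔
      y < I.h ∧ root I al b s (η y) = p := by
  have hB := G.h_lt
  have h1 := label_le (I := I) η p
  have h2 := label_le (I := I) η (τ p)
  refine G.exists_mask (by omega) (by omega) hJ (hidx _ (by omega) _ (by omega))
    (U := fun y => y < I.h ∧ root I al b s (η y) = p) (fun y hy => hy.1) ?_
  intro y z hyz hy1 hy2 _ _ hy
  refine ⟨G.ltH' hyz, ?_⟩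
  by_contra hz
  rcases shape_cross hS (E.adj hyz) hy.2 hz with h | h
  · exact hy1 (E.label_apply hy.1 h).symm
  · exact hy2 (E.label_apply hy.1 h).symm

theorem listed_zero (p : ℕ) (hp : p ≤ I.g) (hS : Shape I al b 0 id) : Listed I al dp b η 0 id p := by
  have hB := G.h_lt
  have hB' := G.g_lt
  have h1 := label_le (I := I) η p
  obtain ⟨m, hm, hmem⟩ := G.exists_block_mask E hJ hidx hS p
  refine ⟨m, (G.dp_zero hb (by omega) (by omega) (by simp only [id]; omega) (by simp only [id]; omega)
    hm).2 ⟨hp, fun y _ hy => ?_, fun _ => rfl⟩, hmem⟩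
  obtain ⟨hy1, hy2⟩ := (hmem y).1 hy
  rw [root] at hy2
  exact ⟨(E.label_apply hy1 hy2).symm, hy2 ▸ E.lt hy1⟩

/-- The entries of the merged blocks restrict one embedding. Edges between the blocks join roots or
tags, so their ends are located; by `hτq` the new tag is an old root or tag of one of the two
blocks, so it is located as well. -/
theorem listed_succ {s v q : ℕ} {τ τ' : ℕ → ℕ} (hs : s + 1 < I.B) (hv : Pick I al s b v)
    (hq : Parent I al s b v q) (hS : Shape I al b s τ) (hS' : Shape I al b (s + 1) τ')
    (hτ : ∀ p, p ≠ q → p ≠ v → τ' p = τ p) (hτq : τ' q = q ∨ τ' q = v ∨ τ' q = τ q ∨ τ' q = τ v)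
    (hL : ∀ p, al s b p ∨ p = I.g → Listed I al dp b η s τ p) :
    ∀ p, al (s + 1) b p ∨ p = I.g → Listed I al dp b η (s + 1) τ' p := by
  intro p hp
  have hB := G.h_lt
  have hB' := G.g_lt
  have hvl := G.pick_lt hb (by omega) hv
  have hroot := G.root_succ hb (by omega) hv hq
  have hqv := G.parent_ne hvl hq
  have hpv : p ≠ v := by
    rcases hp with hp | hp
    · rintro rfl
      exact ((G.al_succ hb hs).1 hp).2 hv
    · omega
  have hp' : al s b p ∨ p = I.g := hp.imp_left fun h => ((G.al_succ hb hs).1 h).1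
  have hpg : p ≤ I.g := by
    rcases hp' with h | h
    · exact (G.al_lt hb (by omega) h).le
    · omega
  by_cases hpq : p = q
  · subst hpq
    obtain ⟨m₁, hd₁, hm₁⟩ := hL v (.inl (pick_al hv))
    obtain ⟨m₂, hd₂, hm₂⟩ := hL p hp'
    obtain ⟨m, hm, hmem⟩ := G.exists_block_mask E hJ hidx hS' p
    obtain ⟨_, _, hvB, hx₁, ht₁, ha₁, hmB₁⟩ := G.dp_lt hd₁
    obtain ⟨_, _, hpB, hx₂, ht₂, ha₂, hmB₂⟩ := G.dp_lt hd₂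
    have hl' := label_le (I := I) η (τ' p)
    have hτ'g := (G.shape_root hb hs hS' hp).2
    refine ⟨m, (G.dp_succ hs hb hpB hx₂ (by omega) (by omega) hm).2 ⟨v, hvB, p, hpB, ⟨hv, hq⟩,
      .inl ⟨rfl, _, hx₁, _, ht₁, _, ha₁, _, hmB₁, _, ht₂, _, ha₂, _, hmB₂, hd₁, hd₂, ?_, ?_, ?_,
        ?_⟩⟩, hmem⟩
    · intro y _
      rw [hmem, hm₁, hm₂, hroot]
      split_ifs with h
      · rw [h]
        exact ⟨by tauto, fun h' => hqv (h'.2.2.symm)⟩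
      · exact ⟨by tauto, fun h' => h h'.1.2⟩
    · rintro y _ z _ ⟨hy, hz, hyz⟩
      have hy' := (hm₁ y).1 hy
      have hz' := (hm₂ z).1 hz
      have h1 := shape_cross hS (E.adj hyz) hy'.2 (by rw [hz'.2]; exact hqv)
      have h2 := shape_cross hS (E.adj (G.symmH hyz)) hz'.2 (by rw [hy'.2]; exact hqv.symm)
      have h3 := E.lt hy'.1
      have h4 := E.lt hz'.1
      refine ⟨η y, by omega, η z, by omega, ⟨hy, ?_⟩, ⟨hz, ?_⟩, (E.adj hyz).1⟩
      · exact h1.imp (fun h => ⟨(E.label_apply hy'.1 h).symm, h⟩)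
          fun h => ⟨(E.label_apply hy'.1 h).symm, h⟩
      · exact h2.imp (fun h => ⟨(E.label_apply hz'.1 h).symm, h⟩)
          fun h => ⟨(E.label_apply hz'.1 h).symm, h⟩
    · intro h
      obtain ⟨h1, h2⟩ := (hm₁ _).1 h
      rw [apply_label h1] at h2
      rcases hp' with h' | rfl
      · exact hqv (h2 ▸ (G.root_self hb (by omega) h').symm)
      · rw [G.root_g hb (by omega)] at h2
        omega
    · intro h
      obtain ⟨h1, _⟩ := (hmem _).1 h
      have h2 := apply_label h1
      have hrv := G.shape_root hb (by omega) hS (.inl (pick_al hv))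
      have hrp := G.shape_root hb (by omega) hS hp'
      have hself : root I al b s p = p := by
        rcases hp' with h' | rfl
        · exact G.root_self hb (by omega) h'
        · exact G.root_g hb (by omega)
      unfold Located
      rw [hm₁, hm₂, h2]
      rcases hτq with h | h | h | h <;> rw [h] at h1 ⊢
      · exact .inr ⟨⟨h1, hself⟩, .inl ⟨rfl, rfl⟩⟩
      · exact .inl ⟨⟨h1, G.root_self hb (by omega) (pick_al hv)⟩, .inl ⟨rfl, rfl⟩⟩
      · exact .inr ⟨⟨h1, hrp.1⟩, .inr ⟨rfl, rfl⟩⟩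
      · exact .inl ⟨⟨h1, hrv.1⟩, .inr ⟨rfl, rfl⟩⟩
  · obtain ⟨m, hd, hm⟩ := hL p hp'
    obtain ⟨_, _, hpB, hx, ht, ha, hmB⟩ := G.dp_lt hd
    have hq' := parent_le hq
    refine ⟨m, ?_, ?_⟩
    · rw [hτ p hpq hpv]
      exact (G.dp_succ hs hb hpB hx ht ha hmB).2 ⟨v, by omega, q, by omega, ⟨hv, hq⟩,
        .inr ⟨hpq, hpv, hd⟩⟩
    · intro y
      rw [hτ p hpq hpv, hm, hroot]
      refine and_congr_right fun _ => ?_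
      split_ifs with h
      · rw [h]
        exact ⟨fun h => absurd h.symm hpv, fun h => absurd h.symm hpq⟩
      · rfl

/-- Every embedding is found. -/
theorem complete (hc : Cyclic I b) : ∃ x t a m, dp I.g b I.g x t a m ∧
    ∀ y < I.h, Mem I x t m y := by
  have hB := G.g_lt
  have key : ∀ s ≤ I.g, ∃ τ, Shape I al b s τ ∧
      ∀ p, al s b p ∨ p = I.g → Listed I al dp b η s τ p := by
    intro s
    induction s with
    | zero =>
      intro _
      have hS : Shape I al b 0 id := .inl ⟨fun _ => rfl, fun u u' _ _ => rfl⟩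
      refine ⟨id, hS, fun p hp => G.listed_zero hb E hJ hidx p ?_ hS⟩
      rw [G.al_zero hb] at hp
      omega
    | succ s ih =>
      intro hs
      obtain ⟨τ, hS, hL⟩ := ih (by omega)
      obtain ⟨v, hv⟩ := exists_pick (I := I) (G.exists_al hb (show s < I.g by omega))
      obtain ⟨q, hq⟩ := G.exists_parent hb (show s < I.B by omega) v
      obtain ⟨τ', hS', h1, h2⟩ := G.shape_succ hb (by omega) hv hq hc hS
      exact ⟨τ', hS', G.listed_succ hb E hJ hidx (by omega) hv hq hS hS' h1 h2 hL⟩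
  obtain ⟨τ, _, hL⟩ := key I.g le_rfl
  obtain ⟨m, hd, hm⟩ := hL I.g (.inr rfl)
  refine ⟨_, _, _, m, hd, fun y hy => (hm y).2 ⟨hy, ?_⟩⟩
  -- At time `g` nothing is alive, so all of G lies in the block of the virtual vertex.
  exact (G.root_al hb (by omega) (E.lt hy).le).resolve_left (G.not_al hb)

end Good

end Elim

/-! ### Guessing the unused edges at branch vertices -/

namespace Elim

open Finset RAM

variable {I : Data} {al : ℕ → ℕ → ℕ → Prop} {dp : ℕ → ℕ → ℕ → ℕ → ℕ → ℕ → ℕ → Prop}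

open Classical in
/-- The edges of the core at branch vertices, as a finite set. -/
noncomputable def xEdges (I : Data) : Finset (ℕ × ℕ) :=
  (range I.B ×ˢ range I.B).filter fun e => XEdge I e.1 e.2

open Classical in
theorem xidx_eq_card (u v : ℕ) : xidx I u v =
    ((xEdges I).filter fun e => e.1 < u ∨ (e.1 = u ∧ e.2 < v)).card := by
  unfold xidx xEdges
  rw [filter_filter, card_filter, sum_product]

open Classical in
theorem sum_xEdge : (∑ u ∈ range I.B, ∑ v ∈ range I.B, if XEdge I u v then 1 else 0) =
    (xEdges I).card := by
  unfold xEdges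
  rw [card_filter, sum_product]

namespace Good

variable (G : Good I al dp)

include G

theorem mem_xEdges {u v : ℕ} : (u, v) ∈ xEdges I ↔ XEdge I u v := by
  classical
  have hB := G.g_lt
  unfold xEdges
  simp only [mem_filter, mem_product, mem_range, and_iff_right_iff_imp]
  intro h
  have h1 := G.ltG h.2.1
  have h2 := G.ltG' h.2.1
  omega

theorem xidx_lt {u v : ℕ} (h : XEdge I u v) : xidx I u v < (xEdges I).card := by
  classical
  rw [xidx_eq_card]
  refine card_lt_card (filter_ssubset.2 ⟨(u, v), G.mem_xEdges.2 h, ?_⟩)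
  simp

theorem xidx_lt_xidx {u v u' v' : ℕ} (h : XEdge I u v) (hlt : u < u' ∨ (u = u' ∧ v < v')) :
    xidx I u v < xidx I u' v' := by
  classical
  rw [xidx_eq_card, xidx_eq_card]
  refine card_lt_card ((ssubset_iff_of_subset ?_).2 ⟨(u, v), ?_, ?_⟩)
  · intro e
    simp only [mem_filter]
    rintro ⟨he, h'⟩
    exact ⟨he, by omega⟩
  · rw [mem_filter]
    exact ⟨G.mem_xEdges.2 h, hlt⟩
  · simp

theorem xidx_inj {u v u' v' : ℕ} (h : XEdge I u v) (h' : XEdge I u' v')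
    (he : xidx I u v = xidx I u' v') : u = u' ∧ v = v' := by
  by_contra hne
  have : (u < u' ∨ (u = u' ∧ v < v')) ∨ (u' < u ∨ (u' = u ∧ v' < v)) := by omega
  rcases this with hlt | hlt
  · have := G.xidx_lt_xidx h hlt; omega
  · have := G.xidx_lt_xidx h' hlt; omega

/-- Every set of edges of the core at branch vertices is coded by a mask. -/
theorem exists_edge_mask {N : ℕ} (hN : (xEdges I).card ≤ N) (hB : 2 ^ N ≤ I.B)
    (F : ℕ → ℕ → Prop) :
    ∃ b < I.B, ∀ u v, XEdge I u v → (Digit I b (xidx I u v) ↔ F u v) := by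
  classical
  set f : Fin N → Bool := fun j => decide (∃ u v, XEdge I u v ∧ xidx I u v = j ∧ F u v) with hf
  have hb := (Nat.ofBits_lt_two_pow f).trans_le hB
  refine ⟨Nat.ofBits f, hb, fun u v h => ?_⟩
  have hlt := (G.xidx_lt h).trans_le hN
  rw [G.digit_iff hb ((hlt.trans Nat.lt_two_pow_self).trans_le hB), Nat.testBit_ofBits_lt _ _ hlt]
  simp only [hf, decide_eq_true_eq]
  constructor
  · rintro ⟨u', v', h', he, hF⟩
    obtain ⟨rfl, rfl⟩ := G.xidx_inj h' h he
    exact hF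
  · intro hF
    exact ⟨u, v, h, rfl, hF⟩

/-- A set in which every vertex has two neighbours is contained in the core. -/
theorem core_of_closed {A : ℕ → Prop}
    (hA : ∀ v, A v → ∃ u w, u ≠ w ∧ (A u ∧ A w) ∧ I.aG v u ∧ I.aG v w) {v : ℕ} (hv : A v) :
    Core I v := by
  have hB := G.g_lt
  have : ∀ r ≤ I.g, ∀ v, A v → I.core r v := by
    intro r
    induction r with
    | zero =>
      intro _ v hv
      obtain ⟨u, w, _, _, h, _⟩ := hA v hv
      exact G.core_zero.2 (G.ltG h)
    | succ r ih =>
      intro hr v hv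
      obtain ⟨u, w, hne, ⟨hu, hw⟩, h⟩ := hA v hv
      exact (G.core_succ (by omega)).2 ⟨ih (by omega) v hv, u, w, hne, h, ih (by omega) u hu,
        ih (by omega) w hw⟩
  exact this I.g le_rfl v hv

theorem core_lt {r v : ℕ} (hr : r < I.B) (h : I.core r v) : v < I.g := by
  induction r with
  | zero => exact G.core_zero.1 h
  | succ r ih => exact ih (by omega) ((G.core_succ hr).1 h).1

/-- Every vertex of the core has two neighbours in the core. -/
theorem core_nbrs {v : ℕ} (h : Core I v) :
    ∃ u w, u ≠ w ∧ (I.aG v u ∧ I.aG v w) ∧ (Core I u ∧ Core I w) := by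
  have hB := G.g_lt
  have hv : v < I.g := G.core_lt (by omega) h
  -- The rounds of the core decrease, so the stabilisation argument is applied to their complements.
  have hst := stable_of_increasing (n := I.g) (S := fun r v => v < I.g ∧ ¬ I.core r v)
    (fun r hr v hv => ⟨hv.1, fun h => hv.2 ((G.core_succ (by omega)).1 h).1⟩)
    (fun r _ v hv => hv.1) (by
      intro r hr hst v hv
      refine ⟨hv.1, fun hc => hv.2 ((G.core_succ (by omega)).2 ⟨hc, ?_⟩)⟩
      obtain ⟨_, u, w, hne, hadj, hu, hw⟩ := (G.core_succ (by omega)).1 hc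
      refine ⟨u, w, hne, hadj, ?_, ?_⟩
      · by_contra hn
        exact (hst u ⟨G.ltG' hadj.1, hn⟩).2 hu
      · by_contra hn
        exact (hst w ⟨G.ltG' hadj.2, hn⟩).2 hw) v
  have : I.core (I.g + 1) v := by
    by_contra hn
    exact (hst ⟨hv, hn⟩).2 h
  obtain ⟨_, h⟩ := (G.core_succ (by omega)).1 this
  exact h

/-- For an embedding of a graph of maximum degree two, a suitable mask selects a graph that contains
the embedding and whose blocks of minimum degree two are cycles. -/
theorem exists_selection {N : ℕ} (hN : (xEdges I).card ≤ N) (hB : 2 ^ N ≤ I.B) {η : ℕ → ℕ}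
    (hlt : ∀ {y}, y < I.h → η y < I.g) (hinj : ∀ {y z}, y < I.h → z < I.h → η y = η z → y = z)
    (hadj : ∀ {y z}, I.aH y z → I.aG (η y) (η z))
    (hdeg : ∀ y, ∃ n₁ n₂, ∀ z, I.aH y z → z = n₁ ∨ z = n₂) :
    ∃ b < I.B, Embeds I b η ∧ Cyclic I b := by
  have hg := G.g_lt
  -- The mask marks for deletion exactly those edges at branch vertices that are not images of edges
  -- of H.
  obtain ⟨b, hb, hbit⟩ := G.exists_edge_mask hN hB
    fun u v => ¬ ∃ y z, I.aH y z ∧ η y = u ∧ η z = v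
  refine ⟨b, hb, ⟨hlt, hinj, ?_⟩, ?_⟩
  · intro y z hyz
    refine ⟨hadj hyz, ?_, ?_⟩
    · rintro ⟨hx, hd⟩
      exact (hbit _ _ hx).1 hd ⟨y, z, hyz, rfl, rfl⟩
    · rintro ⟨hx, hd⟩
      exact (hbit _ _ hx).1 hd ⟨z, y, G.symmH hyz, rfl, rfl⟩
  · intro A hA v hv u w z hu hw hz huv hwv hzv
    by_contra hcon
    push Not at hcon
    have hcore : ∀ v, A v → Core I v := fun v hv => G.core_of_closed (A := A) (fun v hv => by
      obtain ⟨u, w, hne, h, h1, h2⟩ := hA v hv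
      exact ⟨u, w, hne, h, h1.1, h2.1⟩) hv
    have hbr : Branch I v := by
      have h1 := G.ltG' huv.1
      have h2 := G.ltG' hwv.1
      have h3 := G.ltG' hzv.1
      exact ⟨u, by omega, w, by omega, z, by omega, hcon, ⟨huv.1, hwv.1, hzv.1⟩, hcore u hu,
        hcore w hw, hcore z hz⟩
    -- As `v` is a branch vertex, its edges within `A` were subject to the guess. They have not been
    -- deleted, so they are images of edges of H.
    have himg : ∀ u, A u → Adj' I b v u → ∃ y y', I.aH y y' ∧ η y = v ∧ η y' = u := by
      intro u hu huv
      rcases lt_or_gt_of_ne (G.neG huv.1) with h | h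
      · have hx : XEdge I v u := ⟨h, huv.1, hcore v hv, hcore u hu, .inl hbr⟩
        by_contra hn
        exact huv.2.1 ⟨hx, (hbit _ _ hx).2 hn⟩
      · have hx : XEdge I u v := ⟨h, G.symmG huv.1, hcore u hu, hcore v hv, .inr hbr⟩
        by_contra hn
        refine huv.2.2 ⟨hx, (hbit _ _ hx).2 ?_⟩
        rintro ⟨y, y', hy, h1, h2⟩
        exact hn ⟨y', y, G.symmH hy, h2, h1⟩
    obtain ⟨y₁, y₁', e₁, a₁, c₁⟩ := himg u hu huv
    obtain ⟨y₂, y₂', e₂, a₂, c₂⟩ := himg w hw hwv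
    obtain ⟨y₃, y₃', e₃, a₃, c₃⟩ := himg z hz hzv
    -- By injectivity the three edges of H share the end mapped to `v`, while their other ends are
    -- distinct.
    obtain rfl : y₂ = y₁ := hinj (G.ltH e₂) (G.ltH e₁) (a₂.trans a₁.symm)
    obtain rfl : y₃ = y₂ := hinj (G.ltH e₃) (G.ltH e₂) (a₃.trans a₂.symm)
    obtain ⟨n₁, n₂, hn⟩ := hdeg y₃
    obtain ⟨h1, h2, h3⟩ := hcon
    rw [← c₁, ← c₂] at h1
    rw [← c₁, ← c₃] at h2
    rw [← c₂, ← c₃] at h3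
    rcases hn _ e₁ with h | h <;> rcases hn _ e₂ with h' | h' <;> rcases hn _ e₃ with h'' | h'' <;>
      subst_vars <;> simp_all

end Good

/-! ### Counting the edges of the core at branch vertices -/

/-- A forest extends to a spanning tree of the complete graph, which has one edge less than
vertices. -/
theorem card_edgeFinset_le_of_isAcyclic {V : Type*} [Fintype V] (G : SimpleGraph V)
    [Fintype G.edgeSet] (h : G.IsAcyclic) : G.edgeFinset.card ≤ Fintype.card V := by
  classical
  rcases isEmpty_or_nonempty V with hV | hV
  · have : G.edgeFinset = ∅ := by
      rw [Finset.eq_empty_iff_forall_notMem]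
      intro e
      induction e with | _ u v => exact (hV.false u).elim
    simp [this]
  · obtain ⟨T, hGT, _, hT⟩ :=
      (SimpleGraph.connected_top (V := V)).exists_isTree_le_of_le_of_isAcyclic le_top h
    have h1 := hT.card_edgeFinset
    have h2 : G.edgeFinset.card ≤ T.edgeFinset.card :=
      card_le_card (SimpleGraph.edgeFinset_subset_edgeFinset.2 hGT)
    omega

open Classical in
-- The sum counts ordered adjacent pairs in `K`. At most `d * S.card` of them start in `S`, at most
-- as many lead into `S` from outside, and the others are the edges of a forest on `K \ S`, each
-- counted twice.
theorem sum_degree_le {V : Type*} [Fintype V] (G : SimpleGraph V) (K S : Finset V) (d : ℕ)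
    (hS : (G.induce {v | v ∉ S}).IsAcyclic) (hd : ∀ v, G.degree v ≤ d) :
    ∑ v ∈ K, (K.filter (G.Adj v)).card ≤ 2 * (K \ S).card + 2 * (d * S.card) := by
  have hle : ∀ (v : V) (L : Finset V), (L.filter (G.Adj v)).card ≤ d := by
    intro v L
    refine le_trans (card_le_card ?_) (hd v)
    intro u hu
    rw [SimpleGraph.mem_neighborFinset]
    exact (mem_filter.1 hu).2
  have hsplit : ∀ v, (K.filter (G.Adj v)).card =
      ((K ∩ S).filter (G.Adj v)).card + ((K \ S).filter (G.Adj v)).card := by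
    intro v
    rw [← card_union_of_disjoint, ← filter_union, union_comm, sdiff_union_inter]
    exact disjoint_filter_filter (disjoint_sdiff_inter K S).symm
  have hA : ∑ v ∈ K ∩ S, (K.filter (G.Adj v)).card ≤ d * S.card := by
    refine (sum_le_card_nsmul _ _ d fun v _ => hle v K).trans ?_
    rw [smul_eq_mul, mul_comm]
    exact Nat.mul_le_mul_left _ (card_le_card inter_subset_right)
  have hB : ∑ v ∈ K \ S, ((K ∩ S).filter (G.Adj v)).card ≤ d * S.card := by
    have : ∑ v ∈ K \ S, ((K ∩ S).filter (G.Adj v)).card =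
        ∑ v ∈ K ∩ S, ((K \ S).filter (G.Adj v)).card := by
      simp only [card_filter]
      rw [sum_comm]
      simp only [G.adj_comm]
    rw [this]
    refine (sum_le_card_nsmul _ _ d fun v _ => hle v _).trans ?_
    rw [smul_eq_mul, mul_comm]
    exact Nat.mul_le_mul_left _ (card_le_card inter_subset_right)
  have hC : ∑ v ∈ K \ S, ((K \ S).filter (G.Adj v)).card ≤ 2 * (K \ S).card := by
    set L := K \ S with hL
    set F := G.induce (L : Set V) with hF
    have hacy : F.IsAcyclic := by
      have hsub : ∀ v : (L : Set V), (v : V) ∈ {v | v ∉ S} := fun v => (mem_sdiff.1 v.2).2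
      refine hS.comap (G := F) ⟨fun v => ⟨v, hsub v⟩, fun h => h⟩ ?_
      intro u v h
      have h' := congrArg Subtype.val h
      exact Subtype.ext h'
    have h1 := card_edgeFinset_le_of_isAcyclic F hacy
    have h2 := F.sum_degrees_eq_twice_card_edges
    have h3 : ∑ v ∈ L, (L.filter (G.Adj v)).card = ∑ v : (L : Set V), F.degree v := by
      rw [← sum_coe_sort L]
      refine sum_congr rfl fun v _ => ?_
      rw [← SimpleGraph.card_neighborFinset_eq_degree, ← card_map (Function.Embedding.subtype _)]
      congr 1
      ext u
      simp only [mem_filter, mem_map, SimpleGraph.mem_neighborFinset, Function.Embedding.subtype_apply]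
      constructor
      · rintro ⟨hu, huv⟩
        exact ⟨⟨u, hu⟩, huv, rfl⟩
      · rintro ⟨w, hw, rfl⟩
        exact ⟨w.2, hw⟩
    have h4 : Fintype.card (L : Set V) = L.card := by simp
    omega
  have hK : ∑ v ∈ K, (K.filter (G.Adj v)).card = ∑ v ∈ K ∩ S, (K.filter (G.Adj v)).card +
      ∑ v ∈ K \ S, (K.filter (G.Adj v)).card := by
    rw [← sum_union (disjoint_sdiff_inter K S).symm, union_comm, sdiff_union_inter]
  rw [hK, sum_congr rfl (fun v (_ : v ∈ K \ S) => hsplit v), sum_add_distrib]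
  omega

open Classical in
/-- In a graph of maximum degree `d` with a feedback vertex set `S`, a set of minimum degree two has
few edges at vertices of degree at least three. -/
theorem sum_branch_degree_le {V : Type*} [Fintype V] (G : SimpleGraph V) (K S : Finset V) (d : ℕ)
    (hS : (G.induce {v | v ∉ S}).IsAcyclic) (hd : ∀ v, G.degree v ≤ d)
    (hK : ∀ v ∈ K, 2 ≤ (K.filter (G.Adj v)).card) :
    ∑ v ∈ K.filter (fun v => 3 ≤ (K.filter (G.Adj v)).card), (K.filter (G.Adj v)).card ≤
      6 * (d * S.card) := by
  have h1 := sum_degree_le G K S d hS hd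
  have h2 : ∑ v ∈ K, ((K.filter (G.Adj v)).card - 2) + 2 * K.card =
      ∑ v ∈ K, (K.filter (G.Adj v)).card := by
    rw [mul_comm, ← smul_eq_mul, ← sum_const, ← sum_add_distrib]
    exact sum_congr rfl fun v hv => Nat.sub_add_cancel (hK v hv)
  -- A degree of at least 3 is at most three times its excess over 2, and by `h1` and `h2` the total
  -- excess is at most `2 * (d * S.card)`.
  have h3 : ∑ v ∈ K.filter (fun v => 3 ≤ (K.filter (G.Adj v)).card), (K.filter (G.Adj v)).card ≤
      3 * ∑ v ∈ K, ((K.filter (G.Adj v)).card - 2) := by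
    rw [mul_sum]
    refine le_trans (sum_le_sum (g := fun v => 3 * ((K.filter (G.Adj v)).card - 2)) ?_)
      (sum_le_sum_of_subset (filter_subset _ _))
    intro v hv
    have := (mem_filter.1 hv).2
    omega
  have h4 := card_le_card (sdiff_subset : K \ S ⊆ K)
  omega

end Elim

/-! ### Reading the input -/

namespace Elim

open Finset RAM SubgraphIso

theorem prod_eq {B u v : ℕ} (hu : u ≤ B) (hv : v ≤ B) : prod B u v = u * v := by
  classical
  unfold prod
  rw [← sum_product', ← card_filter]
  have : (range B ×ˢ range B).filter (fun e => e.1 < u ∧ e.2 < v) = range u ×ˢ range v := by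
    ext e
    simp only [mem_filter, mem_product, mem_range]
    omega
  rw [this, card_product, card_range, card_range]

theorem length_flatMap_finRange {n k : ℕ} (f : Fin n → Fin k → ℕ) :
    ((List.finRange n).flatMap fun i => (List.finRange k).map (f i)).length = n * k := by
  simp [List.length_flatMap]

theorem getD_flatMap_finRange {n k : ℕ} (f : Fin n → Fin k → ℕ) (u : Fin n) (v : Fin k) :
    ((List.finRange n).flatMap fun i => (List.finRange k).map (f i)).getD (u * k + v) 0 =
      f u v := by
  induction n with
  | zero => exact u.elim0
  | succ n ih =>
    rw [List.finRange_succ, List.flatMap_cons, List.flatMap_map]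
    refine Fin.cases ?_ (fun u => ?_) u
    · rw [List.getD_append _ _ _ _ (by simp)]
      simp
    · have : (u.succ : ℕ) * k + v = k + (u * k + v) := by rw [Fin.val_succ]; ring
      rw [this, List.getD_append_right _ _ _ _ (by simp)]
      simpa using ih (fun i => f i.succ) u

theorem length_adjList {n : ℕ} (G : SimpleGraph (Fin n)) : (adjList G).length = n * n :=
  length_flatMap_finRange _

theorem getD_adjList {n : ℕ} (G : SimpleGraph (Fin n)) (u v : Fin n) :
    (adjList G).getD (u * n + v) 0 = 1 ↔ G.Adj u v := by
  classical
  unfold adjList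
  rw [getD_flatMap_finRange]
  simp

variable {h g : ℕ} {H : SimpleGraph (Fin h)} {G : SimpleGraph (Fin g)} {c : Ctx}

theorem length_encode : (encode H G).length = 2 + h ^ 2 + g ^ 2 := by
  simp only [encode, List.length_cons, List.length_append, length_adjList]
  ring

theorem getD_encode_zero : (encode H G).getD 0 0 = h := rfl

theorem getD_encode_one : (encode H G).getD 1 0 = g := rfl

theorem inH_iff (hi : c.inp = encode H G) (hB : h ≤ c.B) (u v : ℕ) :
    inH c u v ↔ ∃ (hu : u < h) (hv : v < h), H.Adj ⟨u, hu⟩ ⟨v, hv⟩ := by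
  unfold inH
  rw [hi, getD_encode_zero]
  constructor
  · rintro ⟨⟨hu, hv⟩, hh⟩
    refine ⟨hu, hv, (getD_adjList H ⟨u, hu⟩ ⟨v, hv⟩).1 ?_⟩
    rw [prod_eq (by omega) hB, show 2 + u * h + v = u * h + v + 1 + 1 by ring, encode,
      List.getD_cons_succ, List.getD_cons_succ, List.getD_append _ _ _ _ ?_] at hh
    · exact hh
    · rw [length_adjList]; nlinarith
  · rintro ⟨hu, hv, hh⟩
    refine ⟨⟨hu, hv⟩, ?_⟩
    rw [prod_eq (by omega) hB, show 2 + u * h + v = u * h + v + 1 + 1 by ring, encode,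
      List.getD_cons_succ, List.getD_cons_succ, List.getD_append _ _ _ _ ?_]
    · exact (getD_adjList H ⟨u, hu⟩ ⟨v, hv⟩).2 hh
    · rw [length_adjList]; nlinarith

theorem inG_iff (hi : c.inp = encode H G) (hB : h ≤ c.B) (hB' : g ≤ c.B) (u v : ℕ) :
    inG c u v ↔ ∃ (hu : u < g) (hv : v < g), G.Adj ⟨u, hu⟩ ⟨v, hv⟩ := by
  unfold inG
  rw [hi, getD_encode_zero, getD_encode_one]
  have key : u < g → (encode H G).getD (2 + prod c.B h h + prod c.B u g + v) 0 =
      (adjList G).getD (u * g + v) 0 := by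
    intro hu
    rw [prod_eq hB hB, prod_eq (by omega) hB',
      show 2 + h * h + u * g + v = h * h + (u * g + v) + 1 + 1 by ring, encode,
      List.getD_cons_succ, List.getD_cons_succ,
      List.getD_append_right _ _ _ _ (by rw [length_adjList]; omega), length_adjList,
      Nat.add_sub_cancel_left]
  constructor
  · rintro ⟨⟨hu, hv⟩, hh⟩
    rw [key hu] at hh
    exact ⟨hu, hv, (getD_adjList G ⟨u, hu⟩ ⟨v, hv⟩).1 hh⟩
  · rintro ⟨hu, hv, hh⟩
    exact ⟨⟨hu, hv⟩, (key hu).trans ((getD_adjList G ⟨u, hu⟩ ⟨v, hv⟩).2 hh)⟩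

/-! ### Filled tables are correct -/

theorem Entry.lt {k s e₁ e₂ e₃ e₄ e₅ e₆ : ℕ} (he : Entry c k s e₁ e₂ e₃ e₄ e₅ e₆) :
    k < c.B ∧ s < c.B ∧ e₁ < c.B ∧ e₂ < c.B ∧ e₃ < c.B ∧ e₄ < c.B ∧ e₅ < c.B ∧ e₆ < c.B := he.1

theorem exists_pred_iff {B r : ℕ} (hr : r + 1 < B) {P : ℕ → Prop} :
    (∃ r' < B, r + 1 = r' + 1 ∧ P r') ↔ P r := by
  constructor
  · rintro ⟨r', _, e, hp⟩
    obtain rfl : r = r' := by omega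
    exact hp
  · intro hp
    exact ⟨r, by omega, rfl, hp⟩

/-- Arguments of table entries are below the bound by definition, and adjacent vertices are below
`h` or `g`, so the bounded quantifiers of the rules lose nothing. The summand 10 leaves room for the
five kinds of entries. -/
theorem good_of_filled (hi : c.inp = encode H G) (hB : h + g + 10 ≤ c.B) (hF : Filled c) :
    Good (dat c) (datAl c) (datDp c) := by
  have hh : (dat c).h = h := by show c.inp.getD 0 0 = h; rw [hi]; rfl
  have hg : (dat c).g = g := by show c.inp.getD 1 0 = g; rw [hi]; rfl
  have hH := inH_iff (c := c) hi (by omega)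
  have hG := inG_iff (c := c) hi (by omega) (by omega)
  have hr : ∀ {k s e₁ e₂ e₃ e₄ e₅ e₆}, k < c.B → s < c.B → e₁ < c.B → e₂ < c.B → e₃ < c.B →
      e₄ < c.B → e₅ < c.B → e₆ < c.B →
      (Entry c k s e₁ e₂ e₃ e₄ e₅ e₆ ↔ Rule c k s e₁ e₂ e₃ e₄ e₅ e₆) := by
    intro k s e₁ e₂ e₃ e₄ e₅ e₆ h1 h2 h3 h4 h5 h6 h7 h8
    rw [hF]
    exact and_iff_right ⟨h1, h2, h3, h4, h5, h6, h7, h8⟩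
  have h0 : 0 < c.B := by omega
  have hbit : ∀ {j m}, j < c.B → m < c.B → ((dat c).bit j m ↔ bitStep c j m) := by
    intro j m hj hm
    exact (hr h0 hj hm h0 h0 h0 h0 h0).trans (by simp [Rule])
  have hcore : ∀ {s v}, s < c.B → v < c.B → ((dat c).core s v ↔ coreStep c s v) := by
    intro s v hs hv
    exact (hr (by omega) hs hv h0 h0 h0 h0 h0).trans (by simp [Rule])
  have hconn : ∀ {s x t y z}, s < c.B → x < c.B → t < c.B → y < c.B → z < c.B →
      ((dat c).conn s x t y z ↔ connStep c s x t y z) := by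
    intro s x t y z hs hx ht hy hz
    exact (hr (by omega) hs hx ht hy hz h0 h0).trans (by simp [Rule])
  have hal : ∀ {s b v}, s < c.B → b < c.B → v < c.B → (datAl c s b v ↔ alStep c s b v) := by
    intro s b v hs hb hv
    exact (hr (by omega) hs hb hv h0 h0 h0 h0).trans (by simp [Rule])
  have hdp : ∀ {s b p x t a m}, s < c.B → b < c.B → p < c.B → x < c.B → t < c.B → a < c.B →
      m < c.B → (datDp c s b p x t a m ↔ solStep c s b p x t a m) := by
    intro s b p x t a m hs hb hp hx ht ha hm
    exact (hr (by omega) hs hb hp hx ht ha hm).trans (by simp [Rule])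
  refine
    { h_lt := by rw [hh]; show h + 1 < c.B; omega
      g_lt := by rw [hg]; show g + 1 < c.B; omega
      symmH := ?_, ltH := ?_, neH := ?_, symmG := ?_, ltG := ?_, neG := ?_, bit_iff := ?_
      core_zero := ?_, core_succ := ?_, conn_zero := ?_, conn_succ := ?_, al_zero := ?_
      al_succ := ?_, dp_lt := ?_, dp_zero := ?_, dp_succ := ?_ }
  · intro u v he
    obtain ⟨hu, hv, he⟩ := (hH u v).1 he
    exact (hH v u).2 ⟨hv, hu, he.symm⟩
  · intro u v he
    rw [hh]
    exact ((hH u v).1 he).1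
  · rintro u v he rfl
    obtain ⟨hu, hv, he⟩ := (hH u u).1 he
    exact he.ne rfl
  · intro u v he
    obtain ⟨hu, hv, he⟩ := (hG u v).1 he
    exact (hG v u).2 ⟨hv, hu, he.symm⟩
  · intro u v he
    rw [hg]
    exact ((hG u v).1 he).1
  · rintro u v he rfl
    obtain ⟨hu, hv, he⟩ := (hG u u).1 he
    exact he.ne rfl
  · intro j
    induction j with
    | zero =>
      intro m hj hm
      have hm' : m < c.B := hm
      rw [hbit hj hm, Nat.testBit_zero]
      simp only [bitStep, decide_eq_true_eq]
      constructor
      · rintro (⟨_, q, _, rfl⟩ | ⟨r, _, he, _⟩) <;> omega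
      · intro hm
        exact .inl ⟨trivial, m / 2, by omega, by omega⟩
    | succ j ih =>
      intro m hj hm
      have hj' : j + 1 < c.B := hj
      have hm' : m < c.B := hm
      rw [hbit hj hm, Nat.testBit_succ]
      unfold bitStep
      rw [exists_pred_iff hj']
      have hq : m / 2 < c.B := by omega
      constructor
      · rintro (⟨he, _⟩ | ⟨q, hq, hb, hm⟩)
        · omega
        · have : m / 2 = q := by omega
          rw [this]
          exact (ih (by omega) hq).1 hb
      · intro hb
        exact .inr ⟨m / 2, hq, (ih (Nat.lt_of_succ_lt hj) hq).2 hb, by omega⟩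
  · intro v
    constructor
    · intro he
      rcases (hcore h0 he.lt.2.2.1).1 he with ⟨_, hv⟩ | ⟨r, _, hr, _⟩
      · exact hv
      · omega
    · intro hv
      exact (hcore h0 (by rw [hg] at hv; omega)).2 (.inl ⟨rfl, hv⟩)
  · intro r v hr
    have hr' : r + 1 < c.B := hr
    constructor
    · intro he
      have := (hcore hr he.lt.2.2.1).1 he
      unfold coreStep at this
      rw [exists_pred_iff hr'] at this
      rcases this with ⟨hr, _⟩ | ⟨hv, u, _, w, _, he⟩
      · omega
      · exact ⟨hv, u, w, he⟩
    · rintro ⟨hv, u, w, he⟩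
      refine (hcore hr hv.lt.2.2.1).2 (.inr ((exists_pred_iff hr').2 ?_))
      exact ⟨hv, u, he.2.2.1.lt.2.2.1, w, he.2.2.2.lt.2.2.1, he⟩
  · intro x t y z hx ht
    constructor
    · intro he
      rcases (hconn h0 hx ht he.lt.2.2.2.2.1 he.lt.2.2.2.2.2.1).1 he with ⟨_, hv⟩ | ⟨r, _, hr, _⟩
      · exact hv
      · omega
    · rintro ⟨rfl, hy⟩
      have hy' : y < c.B := by rw [hh] at hy; omega
      exact (hconn h0 hx ht hy' hy').2 (.inl ⟨rfl, rfl, hy⟩)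
  · intro r x t y z hx ht hr
    have hr' : r + 1 < c.B := hr
    constructor
    · intro he
      have := (hconn hr hx ht he.lt.2.2.2.2.1 he.lt.2.2.2.2.2.1).1 he
      unfold connStep at this
      rw [exists_pred_iff hr'] at this
      rcases this with ⟨hr, _⟩ | he | ⟨w, _, he⟩
      · omega
      · exact .inl he
      · exact .inr ⟨w, he⟩
    · intro he
      have hlt : y < c.B ∧ z < c.B := by
        rcases he with he | ⟨w, he, hw, _⟩
        · exact ⟨he.lt.2.2.2.2.1, he.lt.2.2.2.2.2.1⟩
        · obtain ⟨_, hz, _⟩ := (hH w z).1 hw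
          exact ⟨he.lt.2.2.2.2.1, by omega⟩
      refine (hconn hr hx ht hlt.1 hlt.2).2 (.inr ((exists_pred_iff hr').2 ?_))
      rcases he with he | ⟨w, he⟩
      · exact .inl he
      · exact .inr ⟨w, he.1.lt.2.2.2.2.2.1, he⟩
  · intro b v hb
    constructor
    · intro he
      rcases (hal h0 hb he.lt.2.2.2.1).1 he with ⟨_, hv⟩ | ⟨r, _, hr, _⟩
      · exact hv
      · omega
    · intro hv
      exact (hal h0 hb (by rw [hg] at hv; omega)).2 (.inl ⟨rfl, hv⟩)
  · intro r b v hb hr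
    have hr' : r + 1 < c.B := hr
    have key : v < c.B → (datAl c (r + 1) b v ↔
        datAl c r b v ∧ ¬ Pick (dat c) (datAl c) r b v) := by
      intro hv
      rw [hal hr hb hv]
      unfold alStep
      rw [exists_pred_iff hr']
      simp
    exact ⟨fun he => (key he.lt.2.2.2.1).1 he, fun he => (key he.1.lt.2.2.2.1).2 he⟩
  · intro s b p x t a m he
    exact he.lt.2
  · intro b p x t a m hb hp hx ht ha hm
    rw [hdp h0 hb hp hx ht ha hm]
    simp [solStep]
  · intro r b p x t a m hr hb hp hx ht ha hm
    have hr' : r + 1 < c.B := hr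
    rw [hdp hr hb hp hx ht ha hm]
    unfold solStep
    rw [exists_pred_iff hr']
    simp

end Elim

/-! ### Correctness of the answer -/

namespace Elim

open Finset RAM SubgraphIso

variable {I I' : Data} {al al' : ℕ → ℕ → ℕ → Prop}
  {dp dp' : ℕ → ℕ → ℕ → ℕ → ℕ → ℕ → ℕ → Prop}

theorem exists_fvs {V : Type*} [Fintype V] (G : SimpleGraph V) :
    ∃ S : Finset V, S.card = fvs G ∧ (G.induce {v | v ∉ S}).IsAcyclic := by
  have : {k | ∃ S : Finset V, S.card = k ∧ (G.induce {v | v ∉ S}).IsAcyclic}.Nonempty := by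
    refine ⟨_, univ, rfl, ?_⟩
    intro v
    exact absurd (mem_univ v.1) v.2
  exact Nat.sInf_mem this

/-- Each of these edges comes from an ordered pair of a branch vertex and a neighbour in the core;
`sum_branch_degree_le` bounds the number of such pairs. -/
theorem Good.card_xEdges_le (hI : Good I al dp) {g : ℕ} {G : SimpleGraph (Fin g)} (hg : I.g = g)
    (hG : ∀ u v, I.aG u v ↔ ∃ (hu : u < g) (hv : v < g), G.Adj ⟨u, hu⟩ ⟨v, hv⟩) :
    (xEdges I).card ≤ 6 * (maxDeg G * fvs G) := by
  classical
  subst hg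
  have hB := hI.g_lt
  obtain ⟨S, hS, hac⟩ := exists_fvs G
  have hd : ∀ v, G.degree v ≤ maxDeg G := by
    intro v
    unfold maxDeg
    convert G.degree_le_maxDegree v
  set K : Finset (Fin I.g) := univ.filter fun v => Core I v with hK
  have hcl : ∀ {v}, Core I v → v < I.g := fun h => hI.core_lt (by omega) h
  have hmem : ∀ {v u : Fin I.g}, u ∈ K.filter (G.Adj v) ↔ Core I u ∧ I.aG v u := by
    intro v u
    simp only [hK, mem_filter, mem_univ, true_and, hG]
    simp
  have h2 : ∀ v ∈ K, 2 ≤ (K.filter (G.Adj v)).card := by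
    intro v hv
    obtain ⟨u, w, hne, ⟨hu, hw⟩, cu, cw⟩ := hI.core_nbrs (mem_filter.1 hv).2
    refine one_lt_card.2 ⟨⟨u, hcl cu⟩, hmem.2 ⟨cu, hu⟩, ⟨w, hcl cw⟩, hmem.2 ⟨cw, hw⟩, ?_⟩
    simpa using hne
  have h3 : ∀ v : Fin I.g, Branch I v → 3 ≤ (K.filter (G.Adj v)).card := by
    rintro v ⟨u, _, w, _, z, _, ⟨n1, n2, n3⟩, ⟨hu, hw, hz⟩, cu, cw, cz⟩
    refine two_lt_card.2 ⟨⟨u, hcl cu⟩, hmem.2 ⟨cu, hu⟩, ⟨w, hcl cw⟩, hmem.2 ⟨cw, hw⟩,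
      ⟨z, hcl cz⟩, hmem.2 ⟨cz, hz⟩, ?_⟩
    simpa using ⟨n1, n2, n3⟩
  have hsum := sum_branch_degree_le G K S (maxDeg G) hac (by convert hd) (by convert h2)
  rw [hS, ← card_sigma] at hsum
  refine le_trans (card_le_card_of_surjOn (fun e => (min (e.1 : ℕ) e.2, max (e.1 : ℕ) e.2)) ?_) hsum
  rintro ⟨u, v⟩ he
  obtain ⟨hlt, ha, cu, cv, hbr⟩ := hI.mem_xEdges.1 (mem_coe.1 he)
  rcases hbr with hbr | hbr
  · refine ⟨⟨⟨u, hcl cu⟩, ⟨v, hcl cv⟩⟩, ?_, ?_⟩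
    · rw [mem_coe, mem_sigma]
      refine ⟨mem_filter.2 ⟨mem_filter.2 ⟨mem_univ _, cu⟩, ?_⟩, ?_⟩
      · convert h3 ⟨u, hcl cu⟩ hbr
      · convert (hmem (v := ⟨u, hcl cu⟩) (u := ⟨v, hcl cv⟩)).2 ⟨cv, ha⟩
    · simp [hlt.le]
  · refine ⟨⟨⟨v, hcl cv⟩, ⟨u, hcl cu⟩⟩, ?_, ?_⟩
    · rw [mem_coe, mem_sigma]
      refine ⟨mem_filter.2 ⟨mem_filter.2 ⟨mem_univ _, cv⟩, ?_⟩, ?_⟩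
      · convert h3 ⟨v, hcl cv⟩ hbr
      · convert (hmem (v := ⟨v, hcl cv⟩) (u := ⟨u, hcl cu⟩)).2 ⟨cu, hI.symmG ha⟩
    · simp [hlt.le]

open Classical in
-- Sending a component of H to its least vertex reaches every representative.
theorem Good.card_rep_le_cc (hI : Good I al dp) {h : ℕ} {H : SimpleGraph (Fin h)} (hh : I.h = h)
    (hH : ∀ u v, I.aH u v ↔ ∃ (hu : u < h) (hv : v < h), H.Adj ⟨u, hu⟩ ⟨v, hv⟩) :
    ((range I.B).filter (Rep I I.h I.h)).card ≤ cc H := by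
  subst hh
  have hB := hI.h_lt
  have hlt : I.h < I.B := by omega
  unfold cc
  rw [Nat.card_eq_fintype_card, ← card_univ]
  refine card_le_card_of_surjOn (fun C => sInf {z | ∃ hz, H.connectedComponentMk ⟨z, hz⟩ = C}) ?_
  intro z hz
  obtain ⟨hz, hmin⟩ := (hI.rep_iff hlt hlt).1 (mem_filter.1 (mem_coe.1 hz)).2
  refine ⟨H.connectedComponentMk ⟨z, hz⟩, by simp, ?_⟩
  refine IsLeast.csInf_eq ⟨⟨hz, rfl⟩, ?_⟩
  rintro w ⟨hw, he⟩
  refine hmin w ?_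
  have hr := (SimpleGraph.reachable_iff_reflTransGen _ _).1 (SimpleGraph.ConnectedComponent.exact he).symm
  have : ∀ v : Fin I.h, Relation.ReflTransGen H.Adj ⟨z, hz⟩ v → I.conn I.h I.h I.h z v := by
    intro v hv
    induction hv with
    | refl => exact hI.conn_refl hlt hlt hz hlt
    | @tail u v _ huv ih =>
      exact hI.conn_step hlt hlt ih ((hH u v).2 ⟨u.2, v.2, huv⟩) u.2.ne u.2.ne v.2.ne v.2.ne
  exact this _ hr

theorem exists_nbrs_of_maxDeg_le {h : ℕ} {H : SimpleGraph (Fin h)} (hdeg : maxDeg H ≤ 2) (y : ℕ) :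
    ∃ n₁ n₂, ∀ z, (∃ (hy : y < h) (hz : z < h), H.Adj ⟨y, hy⟩ ⟨z, hz⟩) → z = n₁ ∨ z = n₂ := by
  classical
  by_contra hcon
  push Not at hcon
  -- The negation provides a neighbour outside any given pair; three uses yield three distinct
  -- neighbours. The first pair is arbitrary.
  obtain ⟨n₁, ⟨hy, h₁, a₁⟩, -⟩ := hcon 0 0
  obtain ⟨n₂, ⟨_, h₂, a₂⟩, e₂, -⟩ := hcon n₁ n₁
  obtain ⟨n₃, ⟨_, h₃, a₃⟩, e₃, e₃'⟩ := hcon n₁ n₂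
  have h1 : H.degree ⟨y, hy⟩ ≤ 2 := by
    refine le_trans ?_ hdeg
    unfold maxDeg
    convert H.degree_le_maxDegree _
  have h2 : 2 < H.degree ⟨y, hy⟩ := by
    rw [← SimpleGraph.card_neighborFinset_eq_degree]
    refine two_lt_card.2 ⟨⟨n₁, h₁⟩, ?_, ⟨n₂, h₂⟩, ?_, ⟨n₃, h₃⟩, ?_, ?_⟩
    · simpa using a₁
    · simpa using a₂
    · simpa using a₃
    · simp only [ne_eq, Fin.mk.injEq]; omega
  omega

/-- This and the next lemmas compare the two fillings. The core of G and the components of H do not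
depend on the bound, so the number of digits found with the small bound is the one needed with the
large bound. -/
theorem Good.core_congr (hI : Good I al dp) (hI' : Good I' al' dp') (hg : I.g = I'.g)
    (haG : I.aG = I'.aG) {r v : ℕ} (hr : r ≤ I.g) : I.core r v ↔ I'.core r v := by
  have hB := hI.g_lt
  have hB' := hI'.g_lt
  induction r generalizing v with
  | zero => rw [hI.core_zero, hI'.core_zero, hg]
  | succ r ih =>
    have ih' : ∀ v, I.core r v ↔ I'.core r v := fun v => ih (by omega)
    rw [hI.core_succ (by omega), hI'.core_succ (by omega), haG]
    simp only [ih']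

theorem Good.conn_congr (hI : Good I al dp) (hI' : Good I' al' dp') (hh : I.h = I'.h)
    (haH : I.aH = I'.aH) {r y z : ℕ} (hr : r ≤ I.h) :
    I.conn r I.h I.h y z ↔ I'.conn r I.h I.h y z := by
  have hB := hI.h_lt
  have hB' := hI'.h_lt
  induction r generalizing z with
  | zero => rw [hI.conn_zero (by omega) (by omega), hI'.conn_zero (by omega) (by omega), hh]
  | succ r ih =>
    have ih' : ∀ z, I.conn r I.h I.h y z ↔ I'.conn r I.h I.h y z := fun z => ih (by omega)
    rw [hI.conn_succ (by omega) (by omega) (by omega),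
      hI'.conn_succ (by omega) (by omega) (by omega), haH]
    simp only [ih']

theorem Good.branch_iff (hI : Good I al dp) {v : ℕ} : Branch I v ↔
    ∃ u w z, (u ≠ w ∧ u ≠ z ∧ w ≠ z) ∧ (I.aG v u ∧ I.aG v w ∧ I.aG v z) ∧
      (Core I u ∧ Core I w ∧ Core I z) := by
  have hB := hI.g_lt
  have hcl : ∀ {v}, Core I v → v < I.B := fun h => (hI.core_lt (by omega) h).trans (by omega)
  constructor
  · rintro ⟨u, _, w, _, z, _, hh⟩
    exact ⟨u, w, z, hh⟩
  · rintro ⟨u, w, z, hh⟩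
    exact ⟨u, hcl hh.2.2.1, w, hcl hh.2.2.2.1, z, hcl hh.2.2.2.2, hh⟩

theorem Good.xEdges_congr (hI : Good I al dp) (hI' : Good I' al' dp') (hg : I.g = I'.g)
    (haG : I.aG = I'.aG) : xEdges I = xEdges I' := by
  have hc : ∀ v, Core I v ↔ Core I' v := by
    intro v
    unfold Core
    rw [hI.core_congr hI' hg haG le_rfl, hg]
  ext ⟨u, v⟩
  rw [hI.mem_xEdges, hI'.mem_xEdges]
  unfold XEdge
  simp only [hI.branch_iff, hI'.branch_iff, hc, haG]

open Classical in
theorem Good.card_rep_congr (hI : Good I al dp) (hI' : Good I' al' dp') (hh : I.h = I'.h)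
    (haH : I.aH = I'.aH) : ((range I.B).filter (Rep I I.h I.h)).card =
      ((range I'.B).filter (Rep I' I'.h I'.h)).card := by
  have hB := hI.h_lt
  have hB' := hI'.h_lt
  congr 1
  ext z
  simp only [mem_filter, mem_range]
  rw [hI.rep_iff (by omega) (by omega), hI'.rep_iff (by omega) (by omega), ← hh]
  simp only [hI.conn_congr hI' hh haH le_rfl]
  refine ⟨fun hz => ⟨?_, hz.2⟩, fun hz => ⟨?_, hz.2⟩⟩ <;> omega

variable {h g : ℕ} {H : SimpleGraph (Fin h)} {G : SimpleGraph (Fin g)} {c c' : Ctx}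

open Classical in
theorem digits_eq (c : Ctx) : digits c = (xEdges (dat c)).card +
    ((range (dat c).B).filter (Rep (dat c) (dat c).h (dat c).h)).card + 7 := by
  unfold digits
  rw [← sum_xEdge, card_filter]

theorem dat_h (hi : c.inp = encode H G) : (dat c).h = h := by
  show c.inp.getD 0 0 = h
  rw [hi, getD_encode_zero]

theorem dat_g (hi : c.inp = encode H G) : (dat c).g = g := by
  show c.inp.getD 1 0 = g
  rw [hi, getD_encode_one]

/-- The number of digits does not depend on the bound. -/
theorem digits_congr (hi : c.inp = encode H G) (hB : h + g + 10 ≤ c.B) (hF : Filled c)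
    (hi' : c'.inp = encode H G) (hB' : h + g + 10 ≤ c'.B) (hF' : Filled c') :
    digits c = digits c' := by
  have hI := good_of_filled hi hB hF
  have hI' := good_of_filled hi' hB' hF'
  rw [digits_eq, digits_eq]
  congr 2
  · rw [hI.xEdges_congr hI' ((dat_g hi).trans (dat_g hi').symm)]
    funext u v
    exact propext ((inG_iff hi (by omega) (by omega) u v).trans
      (inG_iff hi' (by omega) (by omega) u v).symm)
  · refine hI.card_rep_congr hI' ((dat_h hi).trans (dat_h hi').symm) ?_
    funext u v
    exact propext ((inH_iff hi (by omega) u v).trans (inH_iff hi' (by omega) u v).symm)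

theorem digits_le (hi : c.inp = encode H G) (hB : h + g + 10 ≤ c.B) (hF : Filled c) :
    digits c ≤ 6 * (maxDeg G * fvs G) + cc H + 7 := by
  have hI := good_of_filled hi hB hF
  have h1 := hI.card_xEdges_le (dat_g hi) (inG_iff hi (by omega) (by omega))
  have h2 := hI.card_rep_le_cc (dat_h hi) (inH_iff hi (by omega))
  rw [digits_eq]
  omega

/-- The answer is correct if the bound is large enough for the masks. -/
theorem accept_iff (hi : c.inp = encode H G) (hB : h + g + 10 ≤ c.B) (hF : Filled c)
    (hdeg : maxDeg H ≤ 2) (hD : 2 ^ digits c ≤ c.B) :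
    Accept c ↔ ∃ η : H →g G, Function.Injective η := by
  classical
  have hI := good_of_filled hi hB hF
  have hh := dat_h hi
  have hg := dat_g hi
  have hH := inH_iff hi (by omega : h ≤ c.B)
  have hG := inG_iff hi (by omega : h ≤ c.B) (by omega : g ≤ c.B)
  constructor
  · rintro ⟨b, _, x, _, t, _, a, _, m, _, hdp, hm⟩
    obtain ⟨η, h1, h2, h3, -⟩ := hI.sound hdp
    have hmem : ∀ y : Fin h, Mem (dat c) x t m y := fun y =>
      hm y (by have := y.2; omega) (by rw [hh]; exact y.2)
    have hlt : ∀ y : Fin h, η y < g := fun y => hg ▸ (h1 y (hmem y)).1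
    refine ⟨⟨fun y => ⟨η y, hlt y⟩, ?_⟩, ?_⟩
    · intro y z hyz
      exact ((hG _ _).1 (h3 y z (hmem y) (hmem z) ((hH y z).2 ⟨y.2, z.2, hyz⟩))).2.2
    · intro y z he
      exact Fin.ext (h2 y z (hmem y) (hmem z) (congrArg Fin.val he))
  · rintro ⟨η, hη⟩
    set ζ : ℕ → ℕ := fun y => if hy : y < h then η ⟨y, hy⟩ else 0 with hζ
    have hζy : ∀ {y} (hy : y < h), ζ y = η ⟨y, hy⟩ := fun hy => dif_pos hy
    have hnb : ∀ y, ∃ n₁ n₂, ∀ z, (dat c).aH y z → z = n₁ ∨ z = n₂ := by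
      intro y
      obtain ⟨n₁, n₂, hn⟩ := exists_nbrs_of_maxDeg_le hdeg y
      exact ⟨n₁, n₂, fun z hz => hn z ((hH y z).1 hz)⟩
    have hd := digits_eq c
    obtain ⟨b, hb, hE, hc⟩ := hI.exists_selection (N := digits c) (by omega) hD (η := ζ)
      (by intro y hy
          rw [hh] at hy
          rw [hg, hζy hy]
          exact (η _).2)
      (by intro y z hy hz he
          rw [hh] at hy hz
          rw [hζy hy, hζy hz] at he
          simpa using hη (Fin.ext he))
      (by intro y z hyz
          obtain ⟨hy, hz, hyz⟩ := (hH y z).1 hyz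
          rw [hζy hy, hζy hz]
          exact (hG _ _).2 ⟨(η _).2, (η _).2, η.map_adj hyz⟩)
      hnb
    obtain ⟨x, t, a, m, hdp, hm⟩ := hI.complete hb hE (J := digits c) hD
      (by intro x hx t ht y hy
          have h1 := hI.cidx_lt hx ht hy
          have h2 := hI.card_rep_le hx ht hnb
          omega) hc
    obtain ⟨_, _, _, hx, ht, ha, hm'⟩ := hI.dp_lt hdp
    exact ⟨b, hb, x, hx, t, ht, a, ha, m, hm', hdp, fun y _ hy => hm y hy⟩

end Elim

/-! ### The program and its running time -/

namespace Elim

open Finset RAM SubgraphIso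

theorem rz_pow (k : ℕ) : Rz fun c _ => c.B ^ k := by
  induction k with
  | zero => exact (Rz.const 1).of_eq fun c _ => (pow_zero _).symm
  | succ k ih => exact ih.mulB.of_eq fun c _ => (pow_succ _ _).symm

/-- Putting the first bound into register `1`. -/
def initBound : Program :=
  .instr (.read 3 2) ;; .instr (.const 2 1) ;; .instr (.read 4 2) ;; .instr (.const 2 10) ;;
    .instr (.add 1 3 4) ;; .instr (.add 1 1 2)

theorem initBound_spec {h g : ℕ} (H : SimpleGraph (Fin h)) (G : SimpleGraph (Fin g)) :
    ∃ m, Runs (encode H G) initBound (fun _ => 0) 6 m ∧ m 1 = h + g + 10 := by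
  refine ⟨_, .seq (.instr _ _) (.seq (.instr _ _) (.seq (.instr _ _) (.seq (.instr _ _)
    (.seq (.instr _ _) (.instr _ _))))), ?_⟩
  simp [Instr.exec, encode]

/-- A common bound for the running times of finitely many compiled terms. -/
theorem exists_cost_le (l : List Tm) : ∃ K D : ℕ, ∀ t ∈ l, ∀ B X, B < X → t.cost B ≤ K * X ^ D := by
  induction l with
  | nil => exact ⟨0, 0, by simp⟩
  | cons t l ih =>
    obtain ⟨K, D, ih⟩ := ih
    obtain ⟨K', D', ht⟩ := t.cost_le
    refine ⟨max K K', max D D', fun u hu B X hX => ?_⟩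
    rcases List.mem_cons.1 hu with rfl | hu
    · refine (ht B).trans (Nat.mul_le_mul (le_max_right _ _) ?_)
      exact (Nat.pow_le_pow_left hX _).trans (Nat.pow_le_pow_right (by omega) (le_max_right _ _))
    · refine (ih u hu B X hX).trans (Nat.mul_le_mul (le_max_left _ _) ?_)
      exact Nat.pow_le_pow_right (by omega) (le_max_left _ _)

/-- The program: fill the tables with a small bound, count the digits needed, enlarge the bound
accordingly, fill the tables again, and read off the answer. -/
def program (β : ℕ) (N F S A : Tm) : Program :=
  initBound ;; fill β N F ;; double β S ;; fill β N F ;; A.compile β [] 3 ;;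
    .instr (.const 2 0) ;; .instr (.add 0 3 2)

open Classical in
-- The bound h + g + 10 may be too small for the masks, but it is large enough for the core and the
-- components, hence for `s`. After `s` doublings the bound is at least `2 ^ s`, as `accept_iff`
-- requires.
theorem program_spec {β : ℕ} {N F S A : Tm} (hN : ∀ c ρ, N.eval c ρ = c.B ^ 8)
    (hF : ∀ c ρ, F.eval c ρ = if RuleAt c ρ.headI then 1 else 0)
    (hS : ∀ c ρ, S.eval c ρ = digits c) (hA : ∀ c ρ, A.eval c ρ = if Accept c then 1 else 0)
    (hβ : N.size + 6 ≤ β ∧ F.size + 6 ≤ β ∧ S.size + 6 ≤ β ∧ A.size + 6 ≤ β)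
    {h g : ℕ} (H : SimpleGraph (Fin h)) (G : SimpleGraph (Fin g)) (hdeg : maxDeg H ≤ 2) :
    ∃ t s, Answers (program β N F S A) (encode H G) t (∃ η : H →g G, Function.Injective η) ∧
      s ≤ 6 * (maxDeg G * fvs G) + cc H + 7 ∧
      ∀ B B', B = h + g + 10 → B' = B * 2 ^ s →
        t ≤ 6 + (N.cost B + 2 + B ^ 8 * (7 + F.cost B)) + (S.cost B + 2 + s * 3) +
          (N.cost B' + 2 + B' ^ 8 * (7 + F.cost B')) + A.cost B' + 2 := by
  obtain ⟨hβN, hβF, hβS, hβA⟩ := hβ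
  obtain ⟨m₀, r₀, b₀⟩ := initBound_spec H G
  have hfill : ∀ (m m' : Memory), m' 1 = m 1 → (∀ a < m 1 ^ 8, ∃ T : ℕ → ℕ,
      (∀ a' < a, T a' = m' (β + a')) ∧ m' (β + a) = F.eval ⟨encode H G, T, m 1⟩ [a]) →
      Filled (ctxOf (encode H G) β m') := by
    intro m m' h1 hT
    refine filled_of_fill _ fun a ha => ?_
    obtain ⟨T, hT, hv⟩ := hT a (by rw [← h1]; exact ha)
    refine ⟨T, hT, ?_⟩
    rw [hF, ← h1] at hv
    exact hv
  obtain ⟨t₁, m₁, r₁, c₁, -, b₁, f₁⟩ := fill_spec (encode H G) β N F (m₀ 1 ^ 8) m₀ hβN hβF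
    (fun T => hN _ _)
  have F₁ := hfill m₀ m₁ b₁ f₁
  obtain ⟨t₂, m₂, r₂, c₂, -, b₂⟩ := double_spec (encode H G) β S _ m₁ hβS (hS _ _)
  set s := digits (ctxOf (encode H G) β m₁) with hs
  obtain ⟨t₃, m₃, r₃, c₃, -, b₃, f₃⟩ := fill_spec (encode H G) β N F (m₂ 1 ^ 8) m₂ hβN hβF
    (fun T => hN _ _)
  have F₃ := hfill m₂ m₃ b₃ f₃
  obtain ⟨t₄, m₄, r₄, c₄, v₄, -⟩ := A.compile_spec (encode H G) β [] 3 m₃ (by omega) (by simp)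
    (by omega)
  have e₁ : m₁ 1 = h + g + 10 := b₁.trans b₀
  have e₃ : m₃ 1 = (h + g + 10) * 2 ^ s := by rw [b₃, b₂, e₁]
  have hp : 1 ≤ 2 ^ s := Nat.one_le_two_pow
  have hB₁ : h + g + 10 ≤ (ctxOf (encode H G) β m₁).B := e₁.ge
  have hB₃ : h + g + 10 ≤ (ctxOf (encode H G) β m₃).B := by
    show _ ≤ m₃ 1
    rw [e₃]
    exact Nat.le_mul_of_pos_right _ hp
  have hcorrect : Accept (ctxOf (encode H G) β m₃) ↔ ∃ η : H →g G, Function.Injective η := by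
    refine accept_iff rfl hB₃ F₃ hdeg ?_
    rw [← digits_congr rfl hB₁ F₁ rfl hB₃ F₃, ← hs]
    show _ ≤ m₃ 1
    rw [e₃]
    exact Nat.le_mul_of_pos_left _ (by omega)
  refine ⟨_, s, ⟨_, .seq r₀ (.seq r₁ (.seq r₂ (.seq r₃ (.seq r₄ (.seq (.instr _ _)
    (.instr _ _)))))), ?_, ?_⟩, digits_le rfl hB₁ F₁, ?_⟩
  · intro hy
    rw [hA, if_pos (hcorrect.2 hy)] at v₄
    simp [Instr.exec, v₄]
  · intro hn
    rw [hA, if_neg (fun hy => hn (hcorrect.1 hy))] at v₄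
    simp [Instr.exec, v₄]
  · rintro B B' rfl rfl
    rw [b₀] at c₁
    rw [e₁] at c₂
    rw [b₂, e₁] at c₃
    rw [e₃] at c₄
    omega

/-- Every cost is at most `K * X ^ D` with X = B·2^s + 1, and filling the table contributes a factor
`X ^ 8`. Six costs occur, whence `6 * K`; and 31 is the sum of 14 single steps, 7 steps per cell in
two fillings, and 3 steps per doubling. -/
theorem time_le {K D s n B : ℕ} (cN cF cS cN' cF' cA : ℕ) (hB : 1 ≤ B) (hn : B ≤ 5 * n)
    (hc : ∀ k ∈ [cN, cF, cS, cN', cF', cA], k ≤ K * (B * 2 ^ s + 1) ^ D) :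
    6 + (cN + 2 + B ^ 8 * (7 + cF)) + (cS + 2 + s * 3) +
      (cN' + 2 + (B * 2 ^ s) ^ 8 * (7 + cF')) + cA + 2 ≤
    (6 * K + 31) * 2 ^ ((D + 8) * (s + 4)) * n ^ (D + 8) := by
  set X := B * 2 ^ s + 1 with hX
  have hp : s < 2 ^ s := Nat.lt_two_pow_self
  have hBX : B * 2 ^ s ≤ X := by omega
  have h1 : B ≤ X := (Nat.le_mul_of_pos_right _ (by omega)).trans hBX
  have hs : s ≤ X := hp.le.trans ((Nat.le_mul_of_pos_left _ hB).trans hBX)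
  have hX1 : 1 ≤ X := by omega
  have hXn : X ≤ 2 ^ (s + 4) * n := by
    have : B * 2 ^ s ≤ 5 * n * 2 ^ s := Nat.mul_le_mul_right _ hn
    have h2 : 1 ≤ n * 2 ^ s := Nat.mul_pos (by omega) (by omega)
    rw [hX, pow_add]
    nlinarith
  set Y := X ^ (D + 8) with hY
  have hD : X ^ D ≤ Y := Nat.pow_le_pow_right hX1 (by omega)
  have h8 : X ^ 8 * X ^ D = Y := by rw [hY, pow_add, mul_comm]
  have h8' : X ^ 8 ≤ Y := Nat.pow_le_pow_right hX1 (by omega)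
  have hXY : X ≤ Y := Nat.le_self_pow (by omega) X
  have hk : ∀ k ∈ [cN, cF, cS, cN', cF', cA], k ≤ K * Y := fun k hk =>
    (hc k hk).trans (Nat.mul_le_mul_left _ hD)
  have hm : ∀ b ≤ X, ∀ k ∈ [cN, cF, cS, cN', cF', cA], b ^ 8 * (7 + k) ≤ (7 + K) * Y := by
    intro b hb k hk
    calc b ^ 8 * (7 + k) ≤ X ^ 8 * (7 + K * X ^ D) :=
          Nat.mul_le_mul (Nat.pow_le_pow_left hb 8) (Nat.add_le_add_left (hc k hk) 7)
      _ = 7 * X ^ 8 + K * (X ^ 8 * X ^ D) := by ring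
      _ ≤ 7 * Y + K * Y := by rw [h8]; omega
      _ = (7 + K) * Y := by ring
  have a1 := hk cN (by simp)
  have a2 := hk cS (by simp)
  have a3 := hk cN' (by simp)
  have a4 := hk cA (by simp)
  have a5 := hm B h1 cF (by simp)
  have a6 := hm (B * 2 ^ s) hBX cF' (by simp)
  rw [add_mul] at a5 a6
  calc _ ≤ (6 * K + 31) * Y := by rw [add_mul, mul_assoc]; omega
    _ ≤ (6 * K + 31) * (2 ^ (s + 4) * n) ^ (D + 8) :=
      Nat.mul_le_mul_left _ (Nat.pow_le_pow_left hXn _)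
    _ = _ := by rw [mul_pow, ← pow_mul, mul_comm (s + 4), mul_assoc]

/-- The dependence of the running time on the parameters. -/
def bound (K D : ℕ) (p : ℕ × ℕ × ℕ) : ℕ :=
  (6 * K + 31) * 2 ^ ((D + 8) * (6 * (p.1 * p.2.1) + p.2.2 + 11))

theorem computable_bound (K D : ℕ) : Computable (bound K D) := by
  have hpow : Primrec₂ fun a b : ℕ => a ^ b := Primrec₂.unpaired'.1 Nat.Primrec.pow
  have hmul := Primrec.nat_mul
  have hadd := Primrec.nat_add
  exact (hmul.comp (.const _) (hpow.comp (.const 2) (hmul.comp (.const _) (hadd.comp (hadd.comp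
    (hmul.comp (.const 6) (hmul.comp .fst (Primrec.fst.comp .snd))) (Primrec.snd.comp .snd))
    (.const 11))))).to_comp

end Elim

open Elim RAM in
theorem mainTheorem8 :
    ∃ (p : RAM.Program) (f : ℕ × ℕ × ℕ → ℕ) (c : ℕ), Computable f ∧
      ∀ (h g : ℕ) (H : SimpleGraph (Fin h)) (G : SimpleGraph (Fin g)),
        SubgraphIso.maxDeg H ≤ 2 →
          ∃ t : ℕ,
            t ≤ f (SubgraphIso.maxDeg G, SubgraphIso.fvs G, SubgraphIso.cc H) *
                (SubgraphIso.encode H G).length ^ c ∧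
              RAM.Answers p (SubgraphIso.encode H G) t
                (∃ η : H →g G, Function.Injective η) := by
  obtain ⟨N, hN⟩ := rz_pow 8
  obtain ⟨F, hF⟩ := rz_ruleAt
  obtain ⟨S, hS⟩ := rz_digits
  obtain ⟨A, hA⟩ := rz_accept
  obtain ⟨K, D, hK⟩ := exists_cost_le [N, F, S, A]
  refine ⟨program (N.size + F.size + S.size + A.size + 6) N F S A, bound K D, D + 8,
    computable_bound K D, fun h g H G hdeg => ?_⟩
  obtain ⟨t, s, ht, hs, hle⟩ :=
    program_spec (β := N.size + F.size + S.size + A.size + 6) hN hF hS hA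
    ⟨by omega, by omega, by omega, by omega⟩ H G hdeg
  refine ⟨t, (hle _ _ rfl rfl).trans ?_, ht⟩
  -- The length is 2 + h² + g², and five times the summand 2 covers the 10.
  have hn : h + g + 10 ≤ 5 * (SubgraphIso.encode H G).length := by
    rw [length_encode]
    have h1 : h ≤ h ^ 2 := Nat.le_self_pow (by omega) h
    have h2 : g ≤ g ^ 2 := Nat.le_self_pow (by omega) g
    omega
  have hp : 1 ≤ 2 ^ s := Nat.one_le_two_pow
  have hB : h + g + 10 < (h + g + 10) * 2 ^ s + 1 :=
    Nat.lt_succ_of_le (Nat.le_mul_of_pos_right _ hp)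
  refine (time_le _ _ _ _ _ _ (by omega) hn ?_).trans (Nat.mul_le_mul_right _
    (Nat.mul_le_mul_left _ (Nat.pow_le_pow_right (by omega) (Nat.mul_le_mul_left _ ?_))))
  · intro k hk
    simp only [List.mem_cons, List.not_mem_nil, or_false] at hk
    rcases hk with rfl | rfl | rfl | rfl | rfl | rfl
    exacts [hK N (by simp) _ _ hB, hK F (by simp) _ _ hB, hK S (by simp) _ _ hB,
      hK N (by simp) _ _ (Nat.lt_succ_self _), hK F (by simp) _ _ (Nat.lt_succ_self _),
      hK A (by simp) _ _ (Nat.lt_succ_self _)]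
  -- The 11 is the constant 7 in the bound for `s` plus the 4 from `time_le`.
  · show s + 4 ≤ 6 * (SubgraphIso.maxDeg G * SubgraphIso.fvs G) + SubgraphIso.cc H + 11
    omega
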